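/- Let $n\ge 2$, $\mu>0$, $\beta>2$, and let $$p=p_S(n)=\frac{n+1+\sqrt{n^2+10n-7}}{2(n-1)},$$ the positive root of $2+(n+1)p-(n-1)p^2=0$. Let $f\in H^1(\mathbf R^n)$ and $g\in L^2(\mathbf R^n)$ be real valued, non-negative, neither of them vanishing identically, and both supported in $\{|x|\le 1\}$. For $\varepsilon>0$ consider the Cauchy problem $$u_{tt}-\Delta u+\frac{\mu}{(1+|x|)^{\beta}}u_t=|u|^p,\qquad u(0,x)=\varepsilon f(x),\quad u_t(0,x)=\varepsilon g(x). \tag{1.1}$$ For $0<T<\infty$, an energy solution of (1.1) on $[0,T)$ is a function $$u\in C([0,T),H^1(\mathbf R^n))\cap C^1([0,T),L^2(\mathbf R^n))\cap L^p_{loc}(\mathbf R^n\times(0,T))$$ with $u(0)=\varepsilon f$, $u_t(0)=\varepsilon g$ such that, for every $\Psi\in C_0^\infty([0,T)\times\mathbf R^n)$, the function $|u|^p\Psi$ is integrable on $(0,T)\times\mathbf R^n$ and $$\varepsilon\int_{\mathbf R^n} g\,\Psi(0,x)\,dx+\varepsilon\int_{\mathbf R^n}\frac{\mu}{(1+|x|)^\beta}f\,\Psi(0,x)\,dx+\int_0^T\!\!\int_{\mathbf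 R^n}|u|^p\Psi\,dx\,dt$$ $$=-\int_0^T\!\!\int_{\mathbf R^n}u_t\Psi_t\,dx\,dt+\int_0^T\!\!\int_{\mathbf R^n}\nabla u\cdot\nabla\Psi\,dx\,dt-\int_0^T\!\!\int_{\mathbf R^n}\frac{\mu}{(1+|x|)^\beta}u\,\Psi_t\,dx\,dt .$$ Theorem 2.2. There exist constants $\varepsilon_0>0$ and $C>0$, depending only on $f,g,n,p,\mu,\beta$, such that for every $0<\varepsilon\le\varepsilon_0$ and every $0<T<\infty$: if (1.1) has an energy solution $u$ on $[0,T)$ with $$\operatorname{supp}u\subset\{(x,t)\in\mathbf R^n\times[0,T):|x|\le t+1\},$$ then $$T\le\exp\bigl(C\varepsilon^{-p(p-1)}\bigr).$$ -/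

import Mathlib

open MeasureTheory Set
open scoped ContDiff Gradient

noncomputable section

namespace DampedWave

/-- The quadratic `γ(p, n) = 2 + (n + 1) p - (n - 1) p²`. -/
def gammaPoly (n : ℕ) (p : ℝ) : ℝ :=
  2 + ((n : ℝ) + 1) * p - ((n : ℝ) - 1) * p ^ 2

/-- The Strauss exponent `p_S(n)`, for `n ≥ 2`. -/
def straussExponent (n : ℕ) : ℝ :=
  ((n : ℝ) + 1 + Real.sqrt ((n : ℝ) ^ 2 + 10 * n - 7)) / (2 * ((n : ℝ) - 1))

/-- For `n ≥ 2` the Strauss exponent is the unique positive root of `γ(·, n)`. -/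
theorem pos_root_gammaPoly_iff {n : ℕ} (hn : 2 ≤ n) (p : ℝ) :
    (0 < p ∧ gammaPoly n p = 0) ↔ p = straussExponent n := by
  have hn' : (2 : ℝ) ≤ n := by exact_mod_cast hn
  have h1 : (0 : ℝ) < (n : ℝ) - 1 := by linarith
  have hD : (0 : ℝ) ≤ (n : ℝ) ^ 2 + 10 * n - 7 := by nlinarith
  have hs : Real.sqrt ((n : ℝ) ^ 2 + 10 * n - 7) ^ 2 = (n : ℝ) ^ 2 + 10 * n - 7 :=
    Real.sq_sqrt hD
  have hs0 := Real.sqrt_nonneg ((n : ℝ) ^ 2 + 10 * n - 7)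
  unfold gammaPoly straussExponent
  set s := Real.sqrt ((n : ℝ) ^ 2 + 10 * n - 7)
  have hbig : (n : ℝ) + 1 < s := by
    by_contra hcon
    push Not at hcon
    nlinarith
  constructor
  · rintro ⟨hp, h⟩
    have hfac : (2 * ((n : ℝ) - 1) * p - (n + 1) - s) *
        (2 * ((n : ℝ) - 1) * p - (n + 1) + s) = 0 := by
      linear_combination (-4 * ((n : ℝ) - 1)) * h - hs
    rcases mul_eq_zero.mp hfac with h2 | h2
    · rw [eq_div_iff (by positivity)]
      linarith
    · have : 0 < 2 * ((n : ℝ) - 1) * p := by positivity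
      linarith
  · rintro rfl
    refine ⟨by positivity, ?_⟩
    field_simp
    linear_combination -hs

/-- `ℝⁿ` with the Euclidean norm. -/
abbrev Space (n : ℕ) : Type := EuclideanSpace ℝ (Fin n)

/-- `L²(ℝⁿ)`, real valued. -/
abbrev L2 (n : ℕ) : Type := Lp ℝ 2 (volume : Measure (Space n))

/-- `L²(ℝⁿ; ℝⁿ)`, square integrable vector fields. -/
abbrev L2Field (n : ℕ) : Type := Lp (Space n) 2 (volume : Measure (Space n))

/-- `F` is the weak gradient of `f`:
`∫ f ∇φ = - ∫ φ F` for all test functions `φ ∈ C_c^∞(ℝⁿ)`. -/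
def IsWeakGradient {n : ℕ} (f : Space n → ℝ) (F : Space n → Space n) : Prop :=
  ∀ φ : Space n → ℝ, ContDiff ℝ ∞ φ → HasCompactSupport φ →
    ∫ x, f x • gradient φ x = -∫ x, φ x • F x

theorem continuous_gradient {n : ℕ} {φ : Space n → ℝ} (hφ : ContDiff ℝ ∞ φ) :
    Continuous (gradient φ) :=
  (InnerProductSpace.toDual ℝ (Space n)).symm.continuous.comp
    (hφ.continuous_fderiv (by simp))

theorem hasCompactSupport_gradient {n : ℕ} {φ : Space n → ℝ} (hc : HasCompactSupport φ) :
    HasCompactSupport (gradient φ) :=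
  (hc.fderiv (𝕜 := ℝ)).comp_left (map_zero (InnerProductSpace.toDual ℝ (Space n)).symm)

theorem integrable_smul_gradient {n : ℕ} (f : L2 n) {φ : Space n → ℝ}
    (hφ : ContDiff ℝ ∞ φ) (hc : HasCompactSupport φ) :
    Integrable (fun x => f x • gradient φ x) :=
  ((Lp.memLp f).locallyIntegrable (by norm_num)).integrable_smul_right_of_hasCompactSupport
    (continuous_gradient hφ) (hasCompactSupport_gradient hc)

theorem integrable_smul_field {n : ℕ} (F : L2Field n) {φ : Space n → ℝ}
    (hφ : ContDiff ℝ ∞ φ) (hc : HasCompactSupport φ) :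
    Integrable (fun x => φ x • F x) :=
  ((Lp.memLp F).locallyIntegrable (by norm_num)).integrable_smul_left_of_hasCompactSupport
    hφ.continuous hc

/-- The Sobolev space `H¹(ℝⁿ)`: pairs `(f, ∇f)` with `f ∈ L²` and weak gradient `∇f ∈ L²`,
with the norm `(‖f‖² + ‖∇f‖²)^{1/2}` inherited from the product. -/
def H1Submodule (n : ℕ) : Submodule ℝ (WithLp 2 (L2 n × L2Field n)) where
  carrier := {w | IsWeakGradient (w.fst : Space n → ℝ) (w.snd : Space n → Space n)}
  zero_mem' := by
    intro φ _ _
    have h1 : ∫ x, ((0 : L2 n) : Space n → ℝ) x • gradient φ x = 0 := by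
      refine integral_eq_zero_of_ae ?_
      filter_upwards with x
      simp
    have h2 : ∫ x, φ x • ((0 : L2Field n) : Space n → Space n) x = 0 := by
      refine integral_eq_zero_of_ae ?_
      filter_upwards with x
      simp
    simp only [WithLp.zero_fst, WithLp.zero_snd, h1, h2, neg_zero]
  add_mem' := by
    intro v w hv hw φ hφ hc
    have h1 : ∫ x, ((v + w).fst : Space n → ℝ) x • gradient φ x =
        ∫ x, ((v.fst x • gradient φ x) + (w.fst x • gradient φ x)) := by
      refine integral_congr_ae ?_
      filter_upwards [Lp.coeFn_add v.fst w.fst] with x hx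
      simp only [WithLp.add_fst, hx, Pi.add_apply, add_smul]
    have h2 : ∫ x, φ x • ((v + w).snd : Space n → Space n) x =
        ∫ x, ((φ x • v.snd x) + (φ x • w.snd x)) := by
      refine integral_congr_ae ?_
      filter_upwards [Lp.coeFn_add v.snd w.snd] with x hx
      simp only [WithLp.add_snd, hx, Pi.add_apply, smul_add]
    rw [h1, h2, integral_add (integrable_smul_gradient _ hφ hc) (integrable_smul_gradient _ hφ hc),
      integral_add (integrable_smul_field _ hφ hc) (integrable_smul_field _ hφ hc),
      hv φ hφ hc, hw φ hφ hc, neg_add]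
  smul_mem' := by
    intro c w hw φ hφ hc
    have h1 : ∫ x, ((c • w).fst : Space n → ℝ) x • gradient φ x =
        ∫ x, c • (w.fst x • gradient φ x) := by
      refine integral_congr_ae ?_
      filter_upwards [Lp.coeFn_smul c w.fst] with x hx
      simp only [WithLp.smul_fst, hx, Pi.smul_apply, smul_assoc]
    have h2 : ∫ x, φ x • ((c • w).snd : Space n → Space n) x =
        ∫ x, c • (φ x • w.snd x) := by
      refine integral_congr_ae ?_
      filter_upwards [Lp.coeFn_smul c w.snd] with x hx
      simp only [WithLp.smul_snd, hx, Pi.smul_apply, smul_comm c]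
    rw [h1, h2, integral_smul, integral_smul, hw φ hφ hc, smul_neg]

/-- The Hilbert space `H¹(ℝⁿ)` as a type. -/
abbrev H1 (n : ℕ) : Type := H1Submodule n

/-- The `L²` class of an `H¹` function. -/
def H1.toL2 {n : ℕ} (w : H1 n) : L2 n := (w : WithLp 2 (L2 n × L2Field n)).fst

/-- The weak gradient of an `H¹` function. -/
def H1.grad {n : ℕ} (w : H1 n) : L2Field n := (w : WithLp 2 (L2 n × L2Field n)).snd

/-- The damping coefficient `V(x) = μ / (1 + |x|)^β`. -/
def damping {n : ℕ} (μ β : ℝ) (x : Space n) : ℝ := μ / (1 + ‖x‖) ^ β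

/-- The time derivative `u_t` of a curve `u : [0, T) → H¹`, taken in the norm of `L²`
(one sided at `t = 0`). -/
def timeDeriv {n : ℕ} (T : ℝ) (u : ℝ → H1 n) (t : ℝ) : L2 n :=
  derivWithin (fun s => (u s).toL2) (Ico 0 T) t

/-- Test functions in `C_c^∞([0, T) × ℝⁿ)`: restrictions to `t ≥ 0` of smooth functions on
`ℝ × ℝⁿ` whose support is compact and lies in `{t < T}`. -/
structure IsTestFunction {n : ℕ} (T : ℝ) (Ψ : ℝ × Space n → ℝ) : Prop where
  smooth : ContDiff ℝ ∞ Ψ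
  compact : HasCompactSupport Ψ
  support : tsupport Ψ ⊆ Iio T ×ˢ univ

/-- `u ∈ L^p_loc(ℝⁿ × (0, T))`. -/
def LocallyLp {n : ℕ} (p T : ℝ) (u : ℝ → H1 n) : Prop :=
  ∀ a b : ℝ, 0 < a → b < T → ∀ K : Set (Space n), IsCompact K →
    ∫⁻ t in Icc a b, ∫⁻ x in K, ‖(u t).toL2 x‖ₑ ^ p < ⊤

/-- `u` is an energy solution on `[0, T)` of
`u_tt - Δu + μ (1 + |x|)^{-β} u_t = |u|^p`, `u(0) = ε f`, `u_t(0) = ε g`. -/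
structure IsEnergySolution {n : ℕ} (μ β p ε : ℝ) (f : H1 n) (g : L2 n) (T : ℝ)
    (u : ℝ → H1 n) : Prop where
  /-- `u ∈ C([0, T), H¹)`. -/
  continuousOn : ContinuousOn u (Ico 0 T)
  /-- `u ∈ C¹([0, T), L²)`. -/
  contDiffOn : ContDiffOn ℝ 1 (fun t => (u t).toL2) (Ico 0 T)
  /-- `u ∈ L^p_loc(ℝⁿ × (0, T))`. -/
  locallyLp : LocallyLp p T u
  initial : u 0 = ε • f
  initial_deriv : timeDeriv T u 0 = ε • g
  /-- The nonlinear term of the weak formulation converges absolutely. -/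
  nonlinear_integrable : ∀ Ψ : ℝ × Space n → ℝ, IsTestFunction T Ψ →
    ∫⁻ t in Ioo 0 T, ∫⁻ x, ‖(u t).toL2 x‖ₑ ^ p * ‖Ψ (t, x)‖ₑ < ⊤
  /-- The weak formulation. -/
  weak : ∀ Ψ : ℝ × Space n → ℝ, IsTestFunction T Ψ →
    ε * (∫ x, g x * Ψ (0, x)) + ε * (∫ x, damping μ β x * f.toL2 x * Ψ (0, x))
      + ∫ t in Ioo 0 T, ∫ x, |(u t).toL2 x| ^ p * Ψ (t, x)
    = -(∫ t in Ioo 0 T, ∫ x, timeDeriv T u t x * deriv (fun s => Ψ (s, x)) t)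
      + (∫ t in Ioo 0 T, ∫ x, inner ℝ ((u t).grad x) (gradient (fun y => Ψ (t, y)) x))
      - ∫ t in Ioo 0 T, ∫ x, damping μ β x * (u t).toL2 x * deriv (fun s => Ψ (s, x)) t

/-- An `L²` function is supported in the closed ball of radius `R` about the origin. -/
def SupportedInBall {n : ℕ} (R : ℝ) (v : L2 n) : Prop :=
  ∀ᵐ x ∂(volume : Measure (Space n)), R < ‖x‖ → v x = 0

end DampedWave

end

/-!
The lifespan bound comes from testing the weak formulation with the solutions `e^{-λt} φ_λ(x)`,
`0 < λ ≤ 1`, of the conjugate equation `ψ_tt - Δψ - V ψ_t = 0`, where `V = μ (1 + |x|)^{-β}`,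
multiplied by a cutoff `η(t / M)` in time.

*Eigenfunctions.* The profile of `φ_λ` solves `ψ'' + (n-1) ψ' / r = (λ² + λ V) ψ`, `ψ(0) = 1`
(`profile_eq`), and is obtained by Picard iteration. Because `V = O((1 + r)^{-2})`, the damping is
harmless uniformly in `λ`: an explicit supersolution gives `1 ≤ ψ ≤ C (1 + λ r)^{-(n-1)/2} e^{λ r}`
(`one_le_profile`, `exists_profile_le`), the same bound as for the undamped wave equation.

*The cut-off inequality.* After integrating by parts (`IsEnergySolution.very_weak`), the data
contribute at least `ε ∫ g`, and `IsEnergySolution.cutoff_inequality` bounds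
`ε ∫ g + ∫∫ |u|^p η(t/M) e^{-λt} φ_λ` by an integral of `|u|` over the shell `M / 4 ≤ t ≤ M`.

*Superposition.* Set `q = (n-1)/2 - 1/p` and `Φ = ∫₀¹ λ^{q-1} e^{-λt} φ_λ dλ`, which is of size
`t^{-q}` inside the light cone. With `W(M) = ∫∫ |u|^p Φ θ(t/M)`, the mass of the shell, Hölder's
inequality turns the cut-off inequality for `λ = 1` into `ε^p ≤ C W(M)` (`exists_le_cutoffMass`) and
its superposition over `λ` into `(∫∫ |u|^p Φ η(t/M))^p ≤ C (log M)^{p-1} W(M)`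
(`exists_cutoffMass_rpow_le`). All powers of `M` cancel exactly because `p` is the Strauss exponent
(`straussExponent_scaling`); only the logarithm is left.

*Conclusion.* In the variable `s = log M`, the integral `Y` of `s ↦ W(e^s)` satisfies
`Y^p ≤ B s^{p-1} Y'` and `Y' ≥ c ε^p`, which forces `s ≤ C ε^{-p(p-1)}` (`le_of_integral_rpow_le`).
-/

noncomputable section

namespace DampedWave

open Filter Topology
open scoped Convolution

/-! ### Radial Poisson problems -/

/-- The weighted mean `s⁻ⁿ ∫₀ˢ τⁿ⁻¹ h(τ) dτ`, in a form that is also regular at `s = 0`. -/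
def radialMean (n : ℕ) (h : ℝ → ℝ) (s : ℝ) : ℝ :=
  ∫ σ in (0 : ℝ)..1, σ ^ (n - 1) * h (s * σ)

/-- The radial solution of `Δ w = h(|x|)` on `ℝⁿ` with `w(0) = 0`, as a function of `r = |x|`.
The outer integral runs over `v = |x|²`, which makes the result smooth across `x = 0`. -/
def radialPoisson (n : ℕ) (h : ℝ → ℝ) (r : ℝ) : ℝ :=
  (1 / 2) * ∫ v in (0 : ℝ)..r ^ 2, radialMean n h (√v)

theorem continuous_radialMean_param {X : Type*} [TopologicalSpace X] (n : ℕ) {h : X → ℝ → ℝ}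
    (hh : Continuous (Function.uncurry h)) :
    Continuous fun z : X × ℝ => radialMean n (h z.1) z.2 := by
  unfold radialMean
  apply intervalIntegral.continuous_parametric_intervalIntegral_of_continuous'
  have : Continuous fun z : (X × ℝ) × ℝ => Function.uncurry h (z.1.1, z.1.2 * z.2) :=
    hh.comp (by fun_prop)
  have h2 : Continuous fun z : (X × ℝ) × ℝ => z.2 ^ (n - 1) := by fun_prop
  exact h2.mul this

theorem continuous_radialMean (n : ℕ) {h : ℝ → ℝ} (hh : Continuous h) :
    Continuous (radialMean n h) := by
  have := continuous_radialMean_param (X := Unit) n (h := fun _ => h) (by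
    exact hh.comp continuous_snd)
  exact this.comp (by fun_prop : Continuous fun s : ℝ => ((), s))

theorem continuous_radialPoisson_param {X : Type*} [TopologicalSpace X] (n : ℕ) {h : X → ℝ → ℝ}
    (hh : Continuous (Function.uncurry h)) :
    Continuous fun z : X × ℝ => radialPoisson n (h z.1) z.2 := by
  unfold radialPoisson
  refine continuous_const.mul ?_
  refine intervalIntegral.continuous_parametric_intervalIntegral_of_continuous
    (f := fun (z : X × ℝ) v => radialMean n (h z.1) (√v)) ?_ (by fun_prop)
  exact (continuous_radialMean_param n hh).comp
    (by fun_prop : Continuous fun z : (X × ℝ) × ℝ => (z.1.1, √z.2))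

/-- `radialMean n h s` is the mean announced: `s⁻ⁿ ∫₀ˢ τⁿ⁻¹ h(τ) dτ`. -/
theorem pow_mul_radialMean {n : ℕ} (hn : 1 ≤ n) (h : ℝ → ℝ) (s : ℝ) :
    s ^ n * radialMean n h s = ∫ τ in (0 : ℝ)..s, τ ^ (n - 1) * h τ := by
  have h1 := intervalIntegral.smul_integral_comp_mul_left (a := 0) (b := 1)
    (fun τ => τ ^ (n - 1) * h τ) s
  simp only [mul_zero, mul_one] at h1
  rw [← h1, smul_eq_mul, radialMean]
  have h2 : ∀ x : ℝ, (s * x) ^ (n - 1) * h (s * x) = s ^ (n - 1) * (x ^ (n - 1) * h (s * x)) := by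
    intro x; ring
  simp_rw [h2]
  rw [intervalIntegral.integral_const_mul, ← mul_assoc, ← pow_succ', Nat.sub_add_cancel hn]

theorem radialMean_mono {n : ℕ} {h h' : ℝ → ℝ} (hh : Continuous h) (hh' : Continuous h')
    (hle : ∀ r, 0 ≤ r → h r ≤ h' r) {s : ℝ} (hs : 0 ≤ s) :
    radialMean n h s ≤ radialMean n h' s := by
  unfold radialMean
  refine intervalIntegral.integral_mono_on zero_le_one
    (Continuous.intervalIntegrable (by fun_prop) _ _)
    (Continuous.intervalIntegrable (by fun_prop) _ _) ?_
  intro σ hσ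
  exact mul_le_mul_of_nonneg_left (hle _ (mul_nonneg hs hσ.1)) (pow_nonneg hσ.1 _)

theorem radialPoisson_mono {n : ℕ} {h h' : ℝ → ℝ} (hh : Continuous h) (hh' : Continuous h')
    (hle : ∀ r, 0 ≤ r → h r ≤ h' r) (r : ℝ) :
    radialPoisson n h r ≤ radialPoisson n h' r := by
  unfold radialPoisson
  have c1 := continuous_radialMean n hh
  have c2 := continuous_radialMean n hh'
  refine mul_le_mul_of_nonneg_left ?_ (by norm_num)
  refine intervalIntegral.integral_mono_on (sq_nonneg r)
    (Continuous.intervalIntegrable (by fun_prop) _ _)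
    (Continuous.intervalIntegrable (by fun_prop) _ _) ?_
  intro v _
  exact radialMean_mono hh hh' hle (Real.sqrt_nonneg v)

theorem radialPoisson_nonneg {n : ℕ} {h : ℝ → ℝ} (hpos : ∀ r, 0 ≤ r → 0 ≤ h r) (r : ℝ) :
    0 ≤ radialPoisson n h r := by
  refine mul_nonneg (by norm_num) (intervalIntegral.integral_nonneg (sq_nonneg r) fun v _ => ?_)
  refine intervalIntegral.integral_nonneg zero_le_one fun σ hσ => ?_
  exact mul_nonneg (pow_nonneg hσ.1 _) (hpos _ (mul_nonneg (Real.sqrt_nonneg v) hσ.1))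

theorem hasDerivAt_radialPoisson (n : ℕ) {h : ℝ → ℝ} (hh : Continuous h) {r : ℝ} (hr : 0 ≤ r) :
    HasDerivAt (radialPoisson n h) (r * radialMean n h r) r := by
  have c : Continuous fun v : ℝ => radialMean n h (√v) :=
    (continuous_radialMean n hh).comp Real.continuous_sqrt
  have h1 := c.integral_hasStrictDerivAt 0 (r ^ 2)
  have h2 := (HasDerivAt.comp r (h := fun r : ℝ => r ^ 2) h1.hasDerivAt
    (hasDerivAt_pow 2 r)).const_mul (1 / 2 : ℝ)
  rw [Real.sqrt_sq hr] at h2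
  refine h2.congr_deriv ?_
  simp
  ring

/-- Radial comparison principle: a function `S` with `S(0) ≥ 1`, logarithmic derivative `J / r`
and `Δ S ≥ h(|x|)` dominates the solution of `Δ w = h(|x|)`, `w(0) = 1`. -/
theorem one_add_radialPoisson_le {n : ℕ} (hn : 2 ≤ n) {h S J J' : ℝ → ℝ} (hh : Continuous h)
    (hS : Continuous S) (hJ : Continuous J) (hS0 : 1 ≤ S 0) (hJ0 : J 0 = 0)
    (dS : ∀ r, 0 < r → HasDerivAt S (S r * (J r / r)) r)
    (dJ : ∀ r, 0 < r → HasDerivAt J (J' r / r) r)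
    (hsuper : ∀ r, 0 < r →
      r ^ 2 * h r ≤ S r * (((n : ℝ) - 2) * J r + J' r + J r ^ 2)) {r : ℝ} (hr : 0 ≤ r) :
    1 + radialPoisson n h r ≤ S r := by
  obtain ⟨k, rfl⟩ : ∃ k, n = k + 2 := ⟨n - 2, by omega⟩
  have cI : Continuous fun r : ℝ => ∫ τ in (0 : ℝ)..r, τ ^ (k + 2 - 1) * h τ :=
    intervalIntegral.continuous_primitive
      (fun a b => Continuous.intervalIntegrable (by fun_prop) _ _) 0
  -- the flux `rⁿ⁻¹ S'(r)` dominates the flux of the solution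
  have flux : ∀ r, 0 ≤ r → r ^ (k + 2) * radialMean (k + 2) h r ≤ r ^ k * (J r * S r) := by
    intro r hr
    have hder : ∀ r, 0 < r → HasDerivAt
        (fun r => r ^ k * (J r * S r) - ∫ τ in (0 : ℝ)..r, τ ^ (k + 2 - 1) * h τ)
        ((k * r ^ (k - 1) * (J r * S r) + r ^ k * (J' r / r * S r + J r * (S r * (J r / r))))
          - r ^ (k + 2 - 1) * h r) r := by
      intro r hr
      have c : Continuous fun τ : ℝ => τ ^ (k + 2 - 1) * h τ := by fun_prop
      have h1 := (c.integral_hasStrictDerivAt 0 r).hasDerivAt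
      have h2 := (hasDerivAt_pow k r).mul ((dJ r hr).mul (dS r hr))
      exact h2.sub h1
    have hmono : MonotoneOn
        (fun r => r ^ k * (J r * S r) - ∫ τ in (0 : ℝ)..r, τ ^ (k + 2 - 1) * h τ) (Ici 0) := by
      refine monotoneOn_of_deriv_nonneg (convex_Ici 0) ?_ ?_ ?_
      · exact Continuous.continuousOn (((continuous_id.pow k).mul (hJ.mul hS)).sub cI)
      · intro r hr
        rw [interior_Ici] at hr
        exact (hder r hr).differentiableAt.differentiableWithinAt
      · intro r hr
        rw [interior_Ici] at hr
        have hr' : 0 < r := hr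
        rw [(hder r hr).deriv]
        have hs := hsuper r hr
        push_cast at hs
        have key : r * (k * r ^ (k - 1) * (J r * S r)
            + r ^ k * (J' r / r * S r + J r * (S r * (J r / r))) - r ^ (k + 2 - 1) * h r)
            = r ^ k * (S r * (((k : ℝ) + 2 - 2) * J r + J' r + J r ^ 2) - r ^ 2 * h r) := by
          have e1 : (k : ℝ) * r ^ (k - 1) * r = k * r ^ k := by
            rcases Nat.eq_zero_or_pos k with rfl | hk
            · simp
            · rw [mul_assoc, ← pow_succ, Nat.sub_add_cancel hk]
          have e2 : r ^ (k + 2 - 1) = r ^ k * r := by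
            rw [show k + 2 - 1 = k + 1 by omega, pow_succ]
          rw [e2]
          have e3 : J' r / r * r = J' r := div_mul_cancel₀ _ hr'.ne'
          have e4 : J r / r * r = J r := div_mul_cancel₀ _ hr'.ne'
          linear_combination (J r * S r) * e1 + r ^ k * S r * e3 + r ^ k * J r * S r * e4
        have : 0 ≤ r * (k * r ^ (k - 1) * (J r * S r)
            + r ^ k * (J' r / r * S r + J r * (S r * (J r / r))) - r ^ (k + 2 - 1) * h r) := by
          rw [key]
          exact mul_nonneg (pow_nonneg hr'.le _) (sub_nonneg.2 hs)
        exact nonneg_of_mul_nonneg_right this hr'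
    have := hmono (self_mem_Ici) hr hr
    simp only [hJ0, zero_mul, mul_zero, intervalIntegral.integral_same, sub_zero] at this
    rw [pow_mul_radialMean (by omega)]
    linarith
  have hder : ∀ r, 0 < r → HasDerivAt (fun r => S r - (1 + radialPoisson (k + 2) h r))
      (S r * (J r / r) - r * radialMean (k + 2) h r) r := fun r hr =>
    (dS r hr).sub ((hasDerivAt_radialPoisson (k + 2) hh hr.le).const_add 1)
  have cP : Continuous (radialPoisson (k + 2) h) := by
    have := continuous_radialPoisson_param (X := Unit) (k + 2) (h := fun _ => h)
      (hh.comp continuous_snd)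
    exact this.comp (by fun_prop : Continuous fun s : ℝ => ((), s))
  have hmono : MonotoneOn (fun r => S r - (1 + radialPoisson (k + 2) h r)) (Ici 0) := by
    refine monotoneOn_of_deriv_nonneg (convex_Ici 0) ?_ ?_ ?_
    · exact (hS.sub (continuous_const.add cP)).continuousOn
    · intro r hr
      rw [interior_Ici] at hr
      exact (hder r hr).differentiableAt.differentiableWithinAt
    · intro r hr
      rw [interior_Ici] at hr
      have hr' : 0 < r := hr
      rw [(hder r hr).deriv]
      have hf := flux r hr'.le
      have hp : 0 < r ^ (k + 1) := pow_pos hr' _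
      have : r ^ (k + 1) * (S r * (J r / r) - r * radialMean (k + 2) h r)
          = r ^ k * (J r * S r) - r ^ (k + 2) * radialMean (k + 2) h r := by
        have e4 : J r / r * r = J r := div_mul_cancel₀ _ hr'.ne'
        linear_combination r ^ k * S r * e4
      refine nonneg_of_mul_nonneg_right ?_ hp
      rw [this]
      linarith
  have := hmono (self_mem_Ici) hr hr
  have z : radialPoisson (k + 2) h 0 = 0 := by simp [radialPoisson]
  simp only [z] at this
  linarith

/-! ### A supersolution for the radial profile -/

/-- The exponent of the barrier, as a function of `z = √(λ r)`. The first two terms reproduce the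
growth `e^{λ r} (1 + λ r)^{-m}` of the undamped profile; the bounded last term absorbs the
damping. -/
def barrierExponent (m A z : ℝ) : ℝ := z ^ 2 - m * Real.log (1 + z ^ 2 / m) + A * (z / (1 + z))

/-- `r` times the logarithmic derivative of the barrier, as a function of `z = √(λ r)`. -/
def barrierSlope (m A z : ℝ) : ℝ := z ^ 4 / (z ^ 2 + m) + A * (z / (2 * (1 + z) ^ 2))

/-- `r` times the derivative of `barrierSlope`, as a function of `z = √(λ r)`. -/
def barrierSlope' (m A z : ℝ) : ℝ :=
  z ^ 4 * (z ^ 2 + 2 * m) / (z ^ 2 + m) ^ 2 + A * (z * (1 - z) / (4 * (1 + z) ^ 3))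

theorem hasDerivAt_barrierExponent {m : ℝ} (hm : 0 < m) (A : ℝ) {z : ℝ} (hz : 0 < z) :
    HasDerivAt (barrierExponent m A) (2 / z * barrierSlope m A z) z := by
  have hzm : 0 < 1 + z ^ 2 / m := by positivity
  have h1 := (((hasDerivAt_pow 2 z).div_const m).const_add 1).log hzm.ne'
  have h2 := (hasDerivAt_id z).div ((hasDerivAt_id z).const_add 1) (by simp; positivity)
  have h3 := ((hasDerivAt_pow 2 z).sub (h1.const_mul m)).add (h2.const_mul A)
  refine h3.congr_deriv ?_
  have : 0 < z ^ 2 + m := by positivity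
  unfold barrierSlope
  simp only [id]
  field_simp
  ring

theorem hasDerivAt_barrierSlope {m : ℝ} (hm : 0 < m) (A : ℝ) {z : ℝ} (hz : 0 < z) :
    HasDerivAt (barrierSlope m A) (2 / z * barrierSlope' m A z) z := by
  have hzm : 0 < z ^ 2 + m := by positivity
  have h1 := (hasDerivAt_pow 4 z).div ((hasDerivAt_pow 2 z).add_const m) hzm.ne'
  have h0 : HasDerivAt (fun z : ℝ => 2 * (1 + z) ^ 2) (2 * (2 * (1 + z))) z := by
    have := ((((hasDerivAt_id z).const_add 1).pow 2).const_mul 2)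
    refine this.congr_deriv ?_
    simp
  have h2 := (hasDerivAt_id z).div h0 (by positivity)
  have h3 := h1.add (h2.const_mul A)
  refine h3.congr_deriv ?_
  unfold barrierSlope'
  simp only [id]
  field_simp
  ring

/-- The terms of first order in `A` gain a factor of size `(1 + z)²`, which compensates the decay
of the slope `z / (2 (1 + z)²)` of the extra factor of the barrier. -/
theorem barrier_damping_gain {m z : ℝ} (hm : 1 / 2 ≤ m) (hz : 0 ≤ z) :
    (1 + z) ^ 2 / 10 ≤ (2 * m - 1) + (1 - z) / (2 * (1 + z)) + 2 * (z ^ 4 / (z ^ 2 + m)) := by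
  -- the right-hand side is smallest at `m = 1 / 2`, i.e. for `n = 2`
  have h1 : 2 * (z ^ 4 / (z ^ 2 + 1 / 2)) ≤ (2 * m - 1) + 2 * (z ^ 4 / (z ^ 2 + m)) := by
    have a : 0 < z ^ 2 + 1 / 2 := by positivity
    have b : 0 < z ^ 2 + m := by positivity
    have : (2 * m - 1) + 2 * (z ^ 4 / (z ^ 2 + m)) - 2 * (z ^ 4 / (z ^ 2 + 1 / 2))
        = (2 * m - 1) * ((z ^ 2 + 1 / 2) * m + z ^ 2 / 2) / ((z ^ 2 + 1 / 2) * (z ^ 2 + m)) := by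
      field_simp
      ring
    have : 0 ≤ (2 * m - 1) * ((z ^ 2 + 1 / 2) * m + z ^ 2 / 2)
        / ((z ^ 2 + 1 / 2) * (z ^ 2 + m)) := by
      have : 0 ≤ 2 * m - 1 := by linarith
      positivity
    linarith
  have h2 : (1 + z) ^ 2 / 10 ≤ (1 - z) / (2 * (1 + z)) + 2 * (z ^ 4 / (z ^ 2 + 1 / 2)) := by
    have : (1 - z) / (2 * (1 + z)) + 2 * (z ^ 4 / (z ^ 2 + 1 / 2)) - (1 + z) ^ 2 / 10
        = (4 - 8 * z + 5 * z ^ 2 - 17 * z ^ 3 + 34 * z ^ 4 + 38 * z ^ 5)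
          / (10 * (1 + z) * (2 * z ^ 2 + 1)) := by
      field_simp
      ring
    have : 0 ≤ (4 - 8 * z + 5 * z ^ 2 - 17 * z ^ 3 + 34 * z ^ 4 + 38 * z ^ 5)
          / (10 * (1 + z) * (2 * z ^ 2 + 1)) := by
      refine div_nonneg ?_ (by positivity)
      have e : 4 - 8 * z + 5 * z ^ 2 - 17 * z ^ 3 + 34 * z ^ 4 + 38 * z ^ 5
          = 4 * (1 - z) ^ 2 + z ^ 2 * (1 - 17 * z + 34 * z ^ 2 + 38 * z ^ 3) := by ring
      nlinarith [sq_nonneg (1 - z), sq_nonneg (z * (3 * z - 1)), pow_nonneg hz 3, pow_nonneg hz 5,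
        mul_nonneg hz (sq_nonneg (z * (5 * z - 2))), sq_nonneg (1 - z - z ^ 2),
        sq_nonneg (z * (2 * z - 1)), mul_nonneg hz (sq_nonneg (2 * z - 1))]
    linarith
  linarith

/-- The barrier beats the coefficient `z⁴ + (A / 20) z`; by `potential_le_barrier` this is what the
profile equation demands of a supersolution. -/
theorem barrier_supersolution {m A z : ℝ} (hm : 1 / 2 ≤ m) (hA : 0 ≤ A) (hz : 0 ≤ z) :
    z ^ 4 + A / 20 * z ≤ (2 * m - 1) * barrierSlope m A z + barrierSlope' m A z
      + barrierSlope m A z ^ 2 := by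
  have hzm : 0 < z ^ 2 + m := by positivity
  set J₀ := z ^ 4 / (z ^ 2 + m) with hJ₀
  set J₁ := z / (2 * (1 + z) ^ 2) with hJ₁
  have e : barrierSlope' m A z = z ^ 4 * (z ^ 2 + 2 * m) / (z ^ 2 + m) ^ 2
      + A * (J₁ * ((1 - z) / (2 * (1 + z)))) := by
    rw [barrierSlope', hJ₁]
    congr 2
    field_simp
    ring
  have e2 : barrierSlope m A z = J₀ + A * J₁ := rfl
  have i0 : z ^ 4 ≤ (2 * m - 1) * J₀ + z ^ 4 * (z ^ 2 + 2 * m) / (z ^ 2 + m) ^ 2 + J₀ ^ 2 := by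
    have : (2 * m - 1) * J₀ + z ^ 4 * (z ^ 2 + 2 * m) / (z ^ 2 + m) ^ 2 + J₀ ^ 2 - z ^ 4
        = z ^ 4 * (m ^ 2 + m) / (z ^ 2 + m) ^ 2 := by
      rw [hJ₀]
      field_simp
      ring
    have : 0 ≤ z ^ 4 * (m ^ 2 + m) / (z ^ 2 + m) ^ 2 := by positivity
    linarith
  have i1 := mul_le_mul_of_nonneg_left (barrier_damping_gain hm hz)
    (show 0 ≤ A * J₁ by positivity)
  have i2 : A * J₁ * ((1 + z) ^ 2 / 10) = A / 20 * z := by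
    rw [hJ₁]
    field_simp
    ring
  rw [i2] at i1
  rw [e, e2]
  nlinarith [sq_nonneg (A * J₁)]

/-- A supersolution of the profile equation at frequency `l`, as a function of `r = |x|`. -/
def barrier (m A l r : ℝ) : ℝ := Real.exp (barrierExponent m A (√(l * |r|)))

/-- The zeroth order coefficient `λ² + λ μ (1 + r)^{-β}` of the profile equation. -/
def dampedPotential (μ β l r : ℝ) : ℝ := l ^ 2 + l * (μ / (1 + |r|) ^ β)

theorem continuous_dampedPotential (μ β : ℝ) :
    Continuous fun z : ℝ × ℝ => dampedPotential μ β z.1 z.2 := by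
  unfold dampedPotential
  have h : Continuous fun z : ℝ × ℝ => (1 + |z.2|) ^ β :=
    Continuous.rpow_const (by fun_prop) fun z => Or.inl (by positivity)
  have : Continuous fun z : ℝ × ℝ => μ / (1 + |z.2|) ^ β :=
    continuous_const.div h fun z => (Real.rpow_pos_of_pos (by positivity) _).ne'
  fun_prop

theorem dampedPotential_nonneg {μ β l : ℝ} (hμ : 0 < μ) (hl : 0 ≤ l) (r : ℝ) :
    0 ≤ dampedPotential μ β l r := by
  unfold dampedPotential
  positivity

theorem continuous_barrier {m : ℝ} (hm : 0 < m) (A l : ℝ) : Continuous (barrier m A l) := by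
  unfold barrier barrierExponent
  have h0 : Continuous fun r : ℝ => √(l * |r|) := by fun_prop
  have h1 : Continuous fun r : ℝ => Real.log (1 + √(l * |r|) ^ 2 / m) :=
    Continuous.log (by fun_prop) fun r => ne_of_gt (by positivity)
  have h2 : Continuous fun r : ℝ => √(l * |r|) / (1 + √(l * |r|)) :=
    h0.div (by fun_prop) fun r => by positivity
  fun_prop

theorem hasDerivAt_sqrt_mul {l r : ℝ} (hl : 0 < l) (hr : 0 < r) :
    HasDerivAt (fun r : ℝ => √(l * |r|)) (√(l * r) / (2 * r)) r := by
  have h1 : HasDerivAt (fun r : ℝ => √(l * r)) (l / (2 * √(l * r))) r := by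
    have := ((hasDerivAt_id r).const_mul l).sqrt (mul_pos hl hr).ne'
    simpa using this
  have h2 : (fun r : ℝ => √(l * |r|)) =ᶠ[𝓝 r] fun r => √(l * r) := by
    filter_upwards [lt_mem_nhds hr] with s hs
    rw [abs_of_pos hs]
  refine (h1.congr_of_eventuallyEq h2).congr_deriv ?_
  have hs : √(l * r) ^ 2 = l * r := Real.sq_sqrt (by positivity)
  have : 0 < √(l * r) := by positivity
  field_simp
  rw [hs]

theorem hasDerivAt_barrier {m A l r : ℝ} (hm : 0 < m) (hl : 0 < l) (hr : 0 < r) :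
    HasDerivAt (barrier m A l) (barrier m A l r * (barrierSlope m A (√(l * |r|)) / r)) r := by
  have hz : 0 < √(l * r) := by positivity
  have h := (hasDerivAt_sqrt_mul hl hr)
  rw [← abs_of_pos hr] at hz
  have h2 := (HasDerivAt.comp r (hasDerivAt_barrierExponent hm A hz) h).exp
  refine h2.congr_deriv ?_
  simp only [barrier, Function.comp]
  rw [abs_of_pos hr] at *
  field_simp

theorem hasDerivAt_barrierSlope_comp {m A l r : ℝ} (hm : 0 < m) (hl : 0 < l) (hr : 0 < r) :
    HasDerivAt (fun r => barrierSlope m A (√(l * |r|)))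
      (barrierSlope' m A (√(l * |r|)) / r) r := by
  have hz : 0 < √(l * r) := by positivity
  have h := (hasDerivAt_sqrt_mul hl hr)
  rw [← abs_of_pos hr] at hz
  have h2 := (HasDerivAt.comp r (hasDerivAt_barrierSlope hm A hz) h)
  refine h2.congr_deriv ?_
  rw [abs_of_pos hr] at *
  field_simp

/-- The damping contributes `r² λ V ≤ μ λ r² / (1 + r)² ≤ μ √(λ r)` to the profile equation, since
`β > 2` and `λ ≤ 1`. The barrier with `A = 20 μ` absorbs this. -/
theorem potential_le_barrier {m μ β l r : ℝ} (hm : 1 / 2 ≤ m) (hμ : 0 < μ) (hβ : 2 < β)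
    (hl : 0 < l) (hl1 : l ≤ 1) (hr : 0 < r) :
    r ^ 2 * dampedPotential μ β l r ≤ (2 * m - 1) * barrierSlope m (20 * μ) (√(l * |r|))
      + barrierSlope' m (20 * μ) (√(l * |r|)) + barrierSlope m (20 * μ) (√(l * |r|)) ^ 2 := by
  refine le_trans ?_ (barrier_supersolution hm (by positivity) (Real.sqrt_nonneg _))
  rw [abs_of_pos hr, dampedPotential, abs_of_pos hr]
  have hs : √(l * r) ^ 2 = l * r := Real.sq_sqrt (by positivity)
  have h4 : √(l * r) ^ 4 = l ^ 2 * r ^ 2 := by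
    rw [show √(l * r) ^ 4 = (√(l * r) ^ 2) ^ 2 by ring, hs]
    ring
  have hs1 : l * r / (1 + r) ≤ √(l * r) := by
    apply Real.le_sqrt_of_sq_le
    rw [div_pow, div_le_iff₀ (by positivity)]
    have : l * r ≤ (1 + r) ^ 2 := by nlinarith
    nlinarith [mul_pos hl hr]
  have hβ' : (1 + r) ^ (2 : ℝ) ≤ (1 + r) ^ β :=
    Real.rpow_le_rpow_of_exponent_le (by linarith) hβ.le
  rw [Real.rpow_two] at hβ'
  have h5 : r ^ 2 * (l * (μ / (1 + r) ^ β)) ≤ μ * √(l * r) := by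
    have : r ^ 2 * (l * (μ / (1 + r) ^ β)) ≤ r ^ 2 * (l * (μ / (1 + r) ^ 2)) := by gcongr
    refine this.trans ?_
    have e : r ^ 2 * (l * (μ / (1 + r) ^ 2)) = μ * (l * r / (1 + r)) * (r / (1 + r)) := by
      field_simp
    rw [e]
    have h6 : r / (1 + r) ≤ 1 := by
      rw [div_le_one (by positivity)]
      linarith
    calc μ * (l * r / (1 + r)) * (r / (1 + r)) ≤ μ * (l * r / (1 + r)) * 1 := by gcongr
      _ ≤ μ * √(l * r) := by rw [mul_one]; gcongr
  rw [h4]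
  linarith

theorem barrier_le {m A : ℝ} (hm : 0 < m) (hA : 0 ≤ A) :
    ∃ C : ℝ, 0 < C ∧ ∀ l r : ℝ, 0 ≤ l → 0 ≤ r →
      barrier m A l r ≤ C * ((1 + l * r) ^ (-m) * Real.exp (l * r)) := by
  refine ⟨Real.exp A * (min 1 (1 / m)) ^ (-m), by positivity, fun l r hl hr => ?_⟩
  rw [barrier, barrierExponent, abs_of_nonneg hr, Real.sq_sqrt (by positivity)]
  set x := l * r with hx
  have hx0 : 0 ≤ x := by positivity
  have h1 : Real.exp (-(m * Real.log (1 + x / m))) ≤ (min 1 (1 / m)) ^ (-m) * (1 + x) ^ (-m) := by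
    rw [← Real.mul_rpow (by positivity) (by positivity)]
    have : Real.exp (-(m * Real.log (1 + x / m))) = (1 + x / m) ^ (-m) := by
      rw [Real.rpow_def_of_pos (by positivity)]
      congr 1
      ring
    rw [this]
    apply Real.rpow_le_rpow_of_nonpos (by positivity) _ (by linarith)
    have a1 := min_le_left 1 (1 / m)
    have a2 := mul_le_mul_of_nonneg_right (min_le_right 1 (1 / m)) hx0
    have : 1 / m * x = x / m := by ring
    nlinarith
  have h2 : Real.exp (A * (√x / (1 + √x))) ≤ Real.exp A := by
    apply Real.exp_le_exp.2
    have : √x / (1 + √x) ≤ 1 := by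
      rw [div_le_one (by positivity)]
      linarith
    nlinarith
  rw [sub_eq_add_neg, Real.exp_add, Real.exp_add]
  calc Real.exp x * Real.exp (-(m * Real.log (1 + x / m))) * Real.exp (A * (√x / (1 + √x)))
      ≤ Real.exp x * ((min 1 (1 / m)) ^ (-m) * (1 + x) ^ (-m)) * Real.exp A := by gcongr
    _ = _ := by ring

/-! ### The radial profile -/

section

/-- Picard iterates for the radial equation `ψ'' + (n - 1) / r ψ' = (λ² + λ V) ψ`, `ψ(0) = 1`. -/
def profileIter (n : ℕ) (μ β : ℝ) : ℕ → ℝ → ℝ → ℝ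
  | 0 => fun _ _ => 1
  | k + 1 => fun l r =>
      1 + radialPoisson n (fun s => dampedPotential μ β l s * profileIter n μ β k l s) r

/-- The radial profile `ψ_λ(r)`: the solution of `ψ'' + (n - 1) / r ψ' = (λ² + λ V) ψ` with
`ψ(0) = 1`, as the increasing limit of the Picard iterates. Meaningful for `0 < λ ≤ 1`. -/
def profile (n : ℕ) (μ β l r : ℝ) : ℝ := ⨆ k, profileIter n μ β k l r

variable {n : ℕ} {μ β : ℝ}

theorem continuous_profileIter (k : ℕ) :
    Continuous fun z : ℝ × ℝ => profileIter n μ β k z.1 z.2 := by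
  induction k with
  | zero => exact continuous_const
  | succ k ih =>
    refine continuous_const.add ?_
    exact continuous_radialPoisson_param n
      (h := fun l s => dampedPotential μ β l s * profileIter n μ β k l s)
      ((continuous_dampedPotential μ β).mul ih)

theorem continuous_profileIter_right (k : ℕ) (l : ℝ) : Continuous (profileIter n μ β k l) :=
  (continuous_profileIter k).comp (by fun_prop : Continuous fun r : ℝ => (l, r))

theorem continuous_dampedPotential_right (μ β l : ℝ) : Continuous (dampedPotential μ β l) :=
  (continuous_dampedPotential μ β).comp (by fun_prop : Continuous fun r : ℝ => (l, r))

theorem profileIter_abs (k : ℕ) (l r : ℝ) :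
    profileIter n μ β k l |r| = profileIter n μ β k l r := by
  cases k with
  | zero => rfl
  | succ k => simp only [profileIter, radialPoisson, sq_abs]

theorem one_le_profileIter (hμ : 0 < μ) {l : ℝ} (hl : 0 ≤ l) (k : ℕ) (r : ℝ) :
    1 ≤ profileIter n μ β k l r := by
  induction k generalizing r with
  | zero => exact le_rfl
  | succ k ih =>
    have := radialPoisson_nonneg (n := n)
      (h := fun s => dampedPotential μ β l s * profileIter n μ β k l s)
      (fun s _ => mul_nonneg (dampedPotential_nonneg hμ hl s) (zero_le_one.trans (ih s))) r
    simp only [profileIter]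
    linarith

theorem profileIter_le_succ (hμ : 0 < μ) {l : ℝ} (hl : 0 ≤ l) (k : ℕ) (r : ℝ) :
    profileIter n μ β k l r ≤ profileIter n μ β (k + 1) l r := by
  induction k generalizing r with
  | zero => exact one_le_profileIter hμ hl 1 r
  | succ k ih =>
    have c := continuous_dampedPotential_right μ β l
    have := radialPoisson_mono (n := n)
      (c.mul (continuous_profileIter_right k l)) (c.mul (continuous_profileIter_right (k + 1) l))
      (fun s _ => mul_le_mul_of_nonneg_left (ih s) (dampedPotential_nonneg hμ hl s)) r
    rw [profileIter, profileIter]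
    exact add_le_add_right this 1

theorem monotone_profileIter (hμ : 0 < μ) {l : ℝ} (hl : 0 ≤ l) (r : ℝ) :
    Monotone fun k => profileIter n μ β k l r :=
  monotone_nat_of_le_succ fun k => profileIter_le_succ hμ hl k r

theorem profileIter_le_barrier (hn : 2 ≤ n) (hμ : 0 < μ) (hβ : 2 < β) {l : ℝ} (hl : 0 < l)
    (hl1 : l ≤ 1) (k : ℕ) {r : ℝ} (hr : 0 ≤ r) :
    profileIter n μ β k l r ≤ barrier (((n : ℝ) - 1) / 2) (20 * μ) l r := by
  have hn' : (2 : ℝ) ≤ n := by exact_mod_cast hn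
  have hm : 1 / 2 ≤ ((n : ℝ) - 1) / 2 := by linarith
  have hm0 : 0 < ((n : ℝ) - 1) / 2 := by linarith
  have hb0 : barrier (((n : ℝ) - 1) / 2) (20 * μ) l 0 = 1 := by
    simp [barrier, barrierExponent]
  have hQ := continuous_dampedPotential_right μ β l
  have cS := continuous_barrier hm0 (20 * μ) l
  have cJ : Continuous fun r => barrierSlope (((n : ℝ) - 1) / 2) (20 * μ) (√(l * |r|)) := by
    unfold barrierSlope
    have h0 : Continuous fun r : ℝ => √(l * |r|) := by fun_prop
    exact ((h0.pow 4).div (by fun_prop) fun r => by positivity).add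
      (continuous_const.mul (h0.div (by fun_prop) fun r => by positivity))
  have compare : ∀ h : ℝ → ℝ, Continuous h →
      (∀ r, 0 < r → h r ≤ dampedPotential μ β l r * barrier (((n : ℝ) - 1) / 2) (20 * μ) l r) →
      ∀ r, 0 ≤ r → 1 + radialPoisson n h r ≤ barrier (((n : ℝ) - 1) / 2) (20 * μ) l r := by
    intro h hc hle r hr
    refine one_add_radialPoisson_le hn hc cS cJ hb0.ge (by simp [barrierSlope])
      (fun r hr => hasDerivAt_barrier hm0 hl hr)
      (fun r hr => hasDerivAt_barrierSlope_comp hm0 hl hr) ?_ hr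
    intro r hr
    have h1 := potential_le_barrier hm hμ hβ hl hl1 hr
    have h2 : 0 < barrier (((n : ℝ) - 1) / 2) (20 * μ) l r := Real.exp_pos _
    have h3 := mul_le_mul_of_nonneg_left h1 h2.le
    have h4 := mul_le_mul_of_nonneg_left (hle r hr) (sq_nonneg r)
    have e : 2 * (((n : ℝ) - 1) / 2) - 1 = n - 2 := by ring
    rw [e] at h3
    linarith
  induction k generalizing r with
  | zero =>
    have := compare 0 continuous_const (fun r _ =>
      mul_nonneg (dampedPotential_nonneg hμ hl.le r) (Real.exp_pos _).le) r hr
    have h0 := radialPoisson_nonneg (n := n) (h := 0) (fun _ _ => le_rfl) r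
    simp only [profileIter]
    linarith
  | succ k ih =>
    exact compare _ (hQ.mul (continuous_profileIter_right k l)) (fun s hs =>
      mul_le_mul_of_nonneg_left (ih hs.le) (dampedPotential_nonneg hμ hl.le s)) r hr

/-- The bound by the barrier for all `r`, by evenness. -/
theorem profileIter_le_barrier' (hn : 2 ≤ n) (hμ : 0 < μ) (hβ : 2 < β) {l : ℝ} (hl : 0 < l)
    (hl1 : l ≤ 1) (k : ℕ) (r : ℝ) :
    profileIter n μ β k l r ≤ barrier (((n : ℝ) - 1) / 2) (20 * μ) l r := by
  have := profileIter_le_barrier hn hμ hβ hl hl1 k (abs_nonneg r)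
  rw [profileIter_abs] at this
  simpa [barrier] using this

theorem measurable_profile : Measurable fun z : ℝ × ℝ => profile n μ β z.1 z.2 :=
  Measurable.iSup fun k => (continuous_profileIter k).measurable

theorem tendsto_profileIter (hn : 2 ≤ n) (hμ : 0 < μ) (hβ : 2 < β) {l : ℝ} (hl : 0 < l)
    (hl1 : l ≤ 1) (r : ℝ) :
    Tendsto (fun k => profileIter n μ β k l r) atTop (𝓝 (profile n μ β l r)) :=
  tendsto_atTop_ciSup (monotone_profileIter hμ hl.le r)
    ⟨_, by rintro _ ⟨k, rfl⟩; exact profileIter_le_barrier' hn hμ hβ hl hl1 k r⟩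

theorem one_le_profile (hn : 2 ≤ n) (hμ : 0 < μ) (hβ : 2 < β) {l : ℝ} (hl : 0 < l)
    (hl1 : l ≤ 1) (r : ℝ) : 1 ≤ profile n μ β l r :=
  ge_of_tendsto' (tendsto_profileIter hn hμ hβ hl hl1 r)
    fun k => one_le_profileIter hμ hl.le k r

theorem profile_le_barrier (hn : 2 ≤ n) (hμ : 0 < μ) (hβ : 2 < β) {l : ℝ} (hl : 0 < l)
    (hl1 : l ≤ 1) (r : ℝ) :
    profile n μ β l r ≤ barrier (((n : ℝ) - 1) / 2) (20 * μ) l r :=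
  le_of_tendsto' (tendsto_profileIter hn hμ hβ hl hl1 r)
    fun k => profileIter_le_barrier' hn hμ hβ hl hl1 k r

/-- The profile grows at most like `(1 + λ r)^{-(n-1)/2} e^{λ r}`, uniformly in `0 < λ ≤ 1`. -/
theorem exists_profile_le (hn : 2 ≤ n) (hμ : 0 < μ) (hβ : 2 < β) :
    ∃ C : ℝ, 0 < C ∧ ∀ l r : ℝ, 0 < l → l ≤ 1 → 0 ≤ r →
      profile n μ β l r ≤ C * ((1 + l * r) ^ (-(((n : ℝ) - 1) / 2)) * Real.exp (l * r)) := by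
  have hn' : (2 : ℝ) ≤ n := by exact_mod_cast hn
  obtain ⟨C, hC, h⟩ := barrier_le (m := ((n : ℝ) - 1) / 2) (A := 20 * μ) (by linarith)
    (by positivity)
  exact ⟨C, hC, fun l r hl hl1 hr =>
    (profile_le_barrier hn hμ hβ hl hl1 r).trans (h l r hl.le hr)⟩

/-- The Picard iteration converges inside the radial mean, by dominated convergence with the
barrier as majorant. -/
theorem radialMean_tendsto (hn : 2 ≤ n) (hμ : 0 < μ) (hβ : 2 < β) {l : ℝ} (hl : 0 < l)
    (hl1 : l ≤ 1) (s : ℝ) :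
    Tendsto (fun k => radialMean n
        (fun s => dampedPotential μ β l s * profileIter n μ β k l s) s) atTop
      (𝓝 (radialMean n (fun s => dampedPotential μ β l s * profile n μ β l s) s)) := by
  have hn' : (2 : ℝ) ≤ n := by exact_mod_cast hn
  have cb := continuous_barrier (show 0 < ((n : ℝ) - 1) / 2 by linarith) (20 * μ) l
  have cQ := continuous_dampedPotential_right μ β l
  unfold radialMean
  refine intervalIntegral.tendsto_integral_filter_of_dominated_convergence
    (fun σ => σ ^ (n - 1) * (dampedPotential μ β l (s * σ)
      * barrier (((n : ℝ) - 1) / 2) (20 * μ) l (s * σ))) ?_ ?_ ?_ ?_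
  · refine Eventually.of_forall fun k => ?_
    have := continuous_profileIter_right (n := n) (μ := μ) (β := β) k l
    exact Continuous.aestronglyMeasurable (by fun_prop)
  · refine Eventually.of_forall fun k => Eventually.of_forall fun σ hσ => ?_
    rw [uIoc_of_le zero_le_one] at hσ
    have h0 := zero_le_one.trans (one_le_profileIter (n := n) (β := β) hμ hl.le k (s * σ))
    have hq := dampedPotential_nonneg (β := β) hμ hl.le (s * σ)
    have hp : 0 ≤ σ ^ (n - 1) := pow_nonneg hσ.1.le _
    rw [Real.norm_of_nonneg (by positivity)]
    exact mul_le_mul_of_nonneg_left (mul_le_mul_of_nonneg_left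
      (profileIter_le_barrier' hn hμ hβ hl hl1 k _) hq) hp
  · exact Continuous.intervalIntegrable (by fun_prop) _ _
  · refine Eventually.of_forall fun σ _ => ?_
    exact ((tendsto_profileIter hn hμ hβ hl hl1 _).const_mul _).const_mul _

theorem radialMean_le_barrier (hn : 2 ≤ n) (hμ : 0 < μ) (hβ : 2 < β) {l : ℝ} (hl : 0 < l)
    (hl1 : l ≤ 1) (k : ℕ) {s : ℝ} (hs : 0 ≤ s) :
    ‖radialMean n (fun s => dampedPotential μ β l s * profileIter n μ β k l s) s‖ ≤
      radialMean n (fun s => dampedPotential μ β l s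
        * barrier (((n : ℝ) - 1) / 2) (20 * μ) l s) s := by
  have hn' : (2 : ℝ) ≤ n := by exact_mod_cast hn
  have cb := continuous_barrier (show 0 < ((n : ℝ) - 1) / 2 by linarith) (20 * μ) l
  have cQ := continuous_dampedPotential_right μ β l
  have ck := continuous_profileIter_right (n := n) (μ := μ) (β := β) k l
  rw [Real.norm_of_nonneg]
  · exact radialMean_mono (cQ.mul ck) (cQ.mul cb) (fun r _ => mul_le_mul_of_nonneg_left
      (profileIter_le_barrier' hn hμ hβ hl hl1 k r) (dampedPotential_nonneg hμ hl.le r)) hs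
  · refine intervalIntegral.integral_nonneg zero_le_one fun σ hσ => ?_
    exact mul_nonneg (pow_nonneg hσ.1 _) (mul_nonneg (dampedPotential_nonneg hμ hl.le _)
      (zero_le_one.trans (one_le_profileIter hμ hl.le _ _)))

/-- The profile equation, in integrated form. -/
theorem profile_eq (hn : 2 ≤ n) (hμ : 0 < μ) (hβ : 2 < β) {l : ℝ} (hl : 0 < l)
    (hl1 : l ≤ 1) (r : ℝ) :
    profile n μ β l r
      = 1 + radialPoisson n (fun s => dampedPotential μ β l s * profile n μ β l s) r := by
  have hn' : (2 : ℝ) ≤ n := by exact_mod_cast hn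
  have cb := continuous_barrier (show 0 < ((n : ℝ) - 1) / 2 by linarith) (20 * μ) l
  have cQ := continuous_dampedPotential_right μ β l
  refine tendsto_nhds_unique
    ((tendsto_add_atTop_iff_nat 1).2 (tendsto_profileIter hn hμ hβ hl hl1 r)) ?_
  simp only [profileIter]
  refine Tendsto.const_add 1 (Tendsto.const_mul _ ?_)
  refine intervalIntegral.tendsto_integral_filter_of_dominated_convergence
    (fun v => radialMean n (fun s => dampedPotential μ β l s
      * barrier (((n : ℝ) - 1) / 2) (20 * μ) l s) (√v)) ?_ ?_ ?_ ?_
  · refine Eventually.of_forall fun k => ?_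
    have := continuous_profileIter_right (n := n) (μ := μ) (β := β) k l
    exact ((continuous_radialMean n (cQ.mul this)).comp
      Real.continuous_sqrt).aestronglyMeasurable
  · refine Eventually.of_forall fun k => Eventually.of_forall fun v _ => ?_
    exact radialMean_le_barrier hn hμ hβ hl hl1 k (Real.sqrt_nonneg v)
  · exact ((continuous_radialMean n (cQ.mul cb)).comp
      Real.continuous_sqrt).intervalIntegrable _ _
  · exact Eventually.of_forall fun v _ => radialMean_tendsto hn hμ hβ hl hl1 _

theorem continuous_profile (hn : 2 ≤ n) (hμ : 0 < μ) (hβ : 2 < β) {l : ℝ} (hl : 0 < l)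
    (hl1 : l ≤ 1) : Continuous (profile n μ β l) := by
  have hn' : (2 : ℝ) ≤ n := by exact_mod_cast hn
  have cb := continuous_barrier (show 0 < ((n : ℝ) - 1) / 2 by linarith) (20 * μ) l
  have cQ := continuous_dampedPotential_right μ β l
  have ck := fun k => (continuous_radialMean n (cQ.mul
    (continuous_profileIter_right (n := n) (μ := μ) (β := β) k l))).comp Real.continuous_sqrt
  have hint : ∀ a b, IntervalIntegrable (fun v => radialMean n
      (fun s => dampedPotential μ β l s * profile n μ β l s) (√v)) volume a b := by
    intro a b
    refine (((continuous_radialMean n (cQ.mul cb)).comp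
      Real.continuous_sqrt).intervalIntegrable a b).mono_fun ?_ ?_
    · exact (stronglyMeasurable_of_tendsto atTop (fun k => (ck k).stronglyMeasurable)
        (tendsto_pi_nhds.2 fun v =>
          radialMean_tendsto hn hμ hβ hl hl1 (√v))).aestronglyMeasurable
    · refine Eventually.of_forall fun v => ?_
      refine (le_of_tendsto' (radialMean_tendsto hn hμ hβ hl hl1 (√v)).norm fun k =>
        radialMean_le_barrier hn hμ hβ hl hl1 k (Real.sqrt_nonneg v)).trans ?_
      exact Real.le_norm_self _
  have h := (intervalIntegral.continuous_primitive hint 0).comp (continuous_pow 2)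
  have e : profile n μ β l = fun r => 1 + radialPoisson n
      (fun s => dampedPotential μ β l s * profile n μ β l s) r :=
    funext fun r => profile_eq hn hμ hβ hl hl1 r
  rw [e]
  exact continuous_const.add (continuous_const.mul h)

end

/-! ### Eigenfunctions of the stationary equation -/

section

/-- The divergence of a vector field on `ℝⁿ`, as the trace of its derivative. -/
def divergence {n : ℕ} (F : Space n → Space n) (x : Space n) : ℝ :=
  ∑ i, fderiv ℝ F x (EuclideanSpace.single i 1) i

/-- The gradient field of the radial function `radialPoisson n h ‖x‖`. -/
def radialField (n : ℕ) (h : ℝ → ℝ) (x : Space n) : Space n := radialMean n h ‖x‖ • x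

/-- The derivative of `radialField`; the quotient vanishes at `x = 0`. -/
def radialFieldDeriv (n : ℕ) (h : ℝ → ℝ) (x : Space n) : Space n →L[ℝ] Space n :=
  radialMean n h ‖x‖ • ContinuousLinearMap.id ℝ (Space n) +
    ((h ‖x‖ - n * radialMean n h ‖x‖) / ‖x‖ ^ 2) • (innerSL ℝ x).smulRight x

variable {n : ℕ} {h : ℝ → ℝ}

theorem hasGradientAt_radialPoisson (hh : Continuous h) (x : Space n) :
    HasGradientAt (fun x : Space n => radialPoisson n h ‖x‖) (radialField n h x) x := by
  have c : Continuous fun v : ℝ => radialMean n h (√v) :=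
    (continuous_radialMean n hh).comp Real.continuous_sqrt
  have h1 := (c.integral_hasStrictDerivAt 0 (‖x‖ ^ 2)).hasDerivAt
  have h2 := (hasStrictFDerivAt_norm_sq x).hasFDerivAt
  have h3 := (HasDerivAt.comp_hasFDerivAt x h1 h2).const_mul (1 / 2 : ℝ)
  rw [Real.sqrt_sq (norm_nonneg x)] at h3
  rw [hasGradientAt_iff_hasFDerivAt]
  refine h3.congr_fderiv ?_
  ext v
  simp [radialField]
  ring

theorem hasDerivAt_radialMean (hn : 1 ≤ n) (hh : Continuous h) {r : ℝ} (hr : 0 < r) :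
    HasDerivAt (radialMean n h) ((h r - n * radialMean n h r) / r) r := by
  have c : Continuous fun τ : ℝ => τ ^ (n - 1) * h τ := by fun_prop
  have h1 := (c.integral_hasStrictDerivAt 0 r).hasDerivAt
  have h2 := h1.div (hasDerivAt_pow n r) (pow_ne_zero n hr.ne')
  have e : radialMean n h =ᶠ[𝓝 r]
      ((fun u => ∫ τ in (0 : ℝ)..u, τ ^ (n - 1) * h τ) / fun u => u ^ n) := by
    filter_upwards [lt_mem_nhds hr] with s hs
    rw [Pi.div_apply, ← pow_mul_radialMean hn, mul_div_cancel_left₀ _ (pow_ne_zero n hs.ne')]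
  refine (h2.congr_of_eventuallyEq e).congr_deriv ?_
  rw [← pow_mul_radialMean hn]
  obtain ⟨k, rfl⟩ : ∃ k, n = k + 1 := ⟨n - 1, by omega⟩
  simp only [Nat.add_sub_cancel]
  field_simp
  ring

theorem radialMean_zero (hn : 1 ≤ n) : n * radialMean n h 0 = h 0 := by
  unfold radialMean
  simp only [zero_mul, intervalIntegral.integral_mul_const, integral_pow]
  have : (n : ℝ) ≠ 0 := by positivity
  obtain ⟨k, rfl⟩ : ∃ k, n = k + 1 := ⟨n - 1, by omega⟩
  simp only [Nat.add_sub_cancel]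
  push_cast at *
  field_simp
  simp

theorem hasFDerivAt_radialField (hn : 1 ≤ n) (hh : Continuous h) (x : Space n) :
    HasFDerivAt (radialField n h) (radialFieldDeriv n h x) x := by
  have cw := continuous_radialMean n hh
  rcases eq_or_ne x 0 with rfl | hx
  · have e : radialFieldDeriv n h 0 = radialMean n h 0 • ContinuousLinearMap.id ℝ (Space n) := by
      simp [radialFieldDeriv]
    rw [e, hasFDerivAt_iff_isLittleO_nhds_zero]
    have h0 : Tendsto (fun v : Space n => radialMean n h ‖v‖ - radialMean n h 0) (𝓝 0) (𝓝 0) := by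
      have : Continuous fun v : Space n => radialMean n h ‖v‖ - radialMean n h 0 := by fun_prop
      simpa using this.tendsto 0
    have h1 := ((Asymptotics.isLittleO_one_iff ℝ).2 h0).smul_isBigO
      (Asymptotics.isBigO_refl (fun v : Space n => v) (𝓝 0))
    simpa [radialField, sub_smul] using h1
  · have hx0 : 0 < ‖x‖ := norm_pos_iff.2 hx
    have h2 := (hasStrictFDerivAt_norm_sq x).hasFDerivAt
    have h3 : HasFDerivAt (fun x : Space n => √(‖x‖ ^ 2)) _ x :=
      h2.sqrt (pow_ne_zero 2 hx0.ne')
    have e : (fun x : Space n => √(‖x‖ ^ 2)) = fun x => ‖x‖ :=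
      funext fun x => Real.sqrt_sq (norm_nonneg x)
    rw [e, Real.sqrt_sq hx0.le] at h3
    have h4 := HasDerivAt.comp_hasFDerivAt x (hasDerivAt_radialMean hn hh hx0) h3
    have h5 := h4.smul (hasFDerivAt_id x)
    refine h5.congr_fderiv ?_
    ext v i
    simp [radialFieldDeriv]
    field_simp

theorem continuous_radialFieldDeriv (hn : 1 ≤ n) (hh : Continuous h) :
    Continuous (radialFieldDeriv n h) := by
  have cw := continuous_radialMean n hh
  have ca : Continuous fun x : Space n => h ‖x‖ - n * radialMean n h ‖x‖ := by fun_prop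
  unfold radialFieldDeriv
  refine Continuous.add (by fun_prop) ?_
  have cb : Continuous fun x : Space n => (innerSL ℝ x).smulRight x := by
    have : Continuous fun x : Space n => ContinuousLinearMap.smulRightL ℝ (Space n) (Space n)
      (innerSL ℝ x) x := by fun_prop
    exact this
  rw [continuous_iff_continuousAt]
  intro x
  rcases eq_or_ne x 0 with rfl | hx
  · rw [ContinuousAt]
    have e : ((h ‖(0 : Space n)‖ - n * radialMean n h ‖(0 : Space n)‖) / ‖(0 : Space n)‖ ^ 2) •
        (innerSL ℝ (0 : Space n)).smulRight (0 : Space n) = 0 := by simp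
    rw [e]
    refine squeeze_zero_norm (a := fun x : Space n => |h ‖x‖ - n * radialMean n h ‖x‖|) ?_ ?_
    · intro x
      rw [norm_smul, ContinuousLinearMap.norm_smulRight_apply, innerSL_apply_norm, norm_div,
        norm_pow, norm_norm, Real.norm_eq_abs]
      rcases eq_or_ne x 0 with rfl | hx
      · simp
      · have : 0 < ‖x‖ := norm_pos_iff.2 hx
        apply le_of_eq
        field_simp
    · have := (continuous_abs.comp ca).tendsto 0
      simpa [radialMean_zero hn, Function.comp_def] using this
  · exact (ca.continuousAt.div (by fun_prop) (pow_ne_zero 2 (norm_ne_zero_iff.2 hx))).smul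
      cb.continuousAt

theorem contDiff_radialField (hn : 1 ≤ n) (hh : Continuous h) :
    ContDiff ℝ 1 (radialField n h) := by
  rw [contDiff_one_iff_fderiv]
  refine ⟨fun x => (hasFDerivAt_radialField hn hh x).differentiableAt, ?_⟩
  have : fderiv ℝ (radialField n h) = radialFieldDeriv n h :=
    funext fun x => (hasFDerivAt_radialField hn hh x).fderiv
  rw [this]
  exact continuous_radialFieldDeriv hn hh

theorem divergence_radialField (hn : 1 ≤ n) (hh : Continuous h) (x : Space n) :
    divergence (radialField n h) x = h ‖x‖ := by
  unfold divergence
  rw [(hasFDerivAt_radialField hn hh x).fderiv]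
  have hsq : ∑ i, x i * x i = ‖x‖ ^ 2 := by
    rw [EuclideanSpace.norm_sq_eq]
    simp [sq]
  have e : ∀ i : Fin n, radialFieldDeriv n h x (EuclideanSpace.single i 1) i
      = radialMean n h ‖x‖ + (h ‖x‖ - n * radialMean n h ‖x‖) / ‖x‖ ^ 2 * (x i * x i) := by
    intro i
    simp [radialFieldDeriv, EuclideanSpace.inner_single_right]
  rw [Finset.sum_congr rfl fun i _ => e i, Finset.sum_add_distrib, ← Finset.mul_sum, hsq]
  rcases eq_or_ne x 0 with rfl | hx
  · simp [radialMean_zero hn]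
  · have : 0 < ‖x‖ := norm_pos_iff.2 hx
    simp
    field_simp
    ring

theorem gradient_radialPoisson (hh : Continuous h) :
    gradient (fun x : Space n => radialPoisson n h ‖x‖) = radialField n h :=
  funext fun x => (hasGradientAt_radialPoisson hh x).gradient

theorem contDiff_two_of_hasGradientAt {f : Space n → ℝ} {F : Space n → Space n}
    (hf : ∀ x, HasGradientAt f (F x) x) (hF : ContDiff ℝ 1 F) : ContDiff ℝ 2 f := by
  rw [show (2 : WithTop ℕ∞) = 1 + 1 by norm_num, contDiff_succ_iff_fderiv]
  refine ⟨fun x => (hf x).differentiableAt, by simp, ?_⟩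
  have : fderiv ℝ f = fun x => InnerProductSpace.toDual ℝ (Space n) (F x) :=
    funext fun x => (hf x).hasFDerivAt.fderiv
  rw [this]
  exact (InnerProductSpace.toDual ℝ (Space n)).contDiff.comp hF

/-- The eigenfunction `φ_λ(x) = ψ_λ(|x|)` of the damped problem. -/
def eigenfunction (n : ℕ) (μ β l : ℝ) (x : Space n) : ℝ := profile n μ β l ‖x‖

variable {μ β : ℝ}

theorem contDiff_eigenfunction (hn : 2 ≤ n) (hμ : 0 < μ) (hβ : 2 < β) {l : ℝ} (hl : 0 < l)
    (hl1 : l ≤ 1) : ContDiff ℝ 2 (eigenfunction n μ β l) := by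
  have c : Continuous fun s => dampedPotential μ β l s * profile n μ β l s :=
    (continuous_dampedPotential_right μ β l).mul (continuous_profile hn hμ hβ hl hl1)
  have e : eigenfunction n μ β l = fun x => 1 + radialPoisson n
      (fun s => dampedPotential μ β l s * profile n μ β l s) ‖x‖ :=
    funext fun x => profile_eq hn hμ hβ hl hl1 _
  rw [e]
  exact contDiff_const.add (contDiff_two_of_hasGradientAt (hasGradientAt_radialPoisson c)
    (contDiff_radialField (by omega) c))

/-- `Δ φ_λ = (λ² + λ V) φ_λ`. -/
theorem divergence_gradient_eigenfunction (hn : 2 ≤ n) (hμ : 0 < μ) (hβ : 2 < β) {l : ℝ}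
    (hl : 0 < l) (hl1 : l ≤ 1) (x : Space n) :
    divergence (gradient (eigenfunction n μ β l)) x
      = (l ^ 2 + l * damping μ β x) * eigenfunction n μ β l x := by
  have c : Continuous fun s => dampedPotential μ β l s * profile n μ β l s :=
    (continuous_dampedPotential_right μ β l).mul (continuous_profile hn hμ hβ hl hl1)
  have e : eigenfunction n μ β l = fun x => 1 + radialPoisson n
      (fun s => dampedPotential μ β l s * profile n μ β l s) ‖x‖ :=
    funext fun x => profile_eq hn hμ hβ hl hl1 _
  have e2 : gradient (eigenfunction n μ β l) = radialField n
      (fun s => dampedPotential μ β l s * profile n μ β l s) := by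
    rw [e, ← gradient_radialPoisson c]
    funext x
    unfold gradient
    rw [fderiv_const_add]
  rw [e2, divergence_radialField (by omega) c]
  simp [dampedPotential, damping, eigenfunction]

end

/-! ### Mollification and test functions of finite smoothness -/

section

variable {n : ℕ}

theorem continuous_gradient_one {b : Space n → ℝ} (hb : ContDiff ℝ 1 b) :
    Continuous (gradient b) :=
  (InnerProductSpace.toDual ℝ (Space n)).symm.continuous.comp (hb.continuous_fderiv (by simp))

/-- A compactly supported `C¹` function is a `C¹`-uniform limit of smooth functions supported in a
fixed ball. -/
theorem exists_smooth_approx {b : Space n → ℝ} (hb : ContDiff ℝ 1 b) (hc : HasCompactSupport b) :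
    ∃ R : ℝ, (∀ x, R < ‖x‖ → b x = 0) ∧ ∃ B : ℕ → Space n → ℝ,
      (∀ k, ContDiff ℝ ∞ (B k)) ∧ (∀ k x, R < ‖x‖ → B k x = 0) ∧
      (∀ k x, ‖B k x - b x‖ ≤ 1 / ((k : ℝ) + 1)) ∧
      (∀ k x, ‖gradient (B k) x - gradient b x‖ ≤ 1 / ((k : ℝ) + 1)) := by
  obtain ⟨R, hR⟩ := hc.isCompact.isBounded.subset_closedBall (0 : Space n)
  have hb0 : ∀ x, R < ‖x‖ → b x = 0 := by
    intro x hx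
    by_contra hne
    have := hR (subset_tsupport b hne)
    rw [mem_closedBall_zero_iff] at this
    linarith
  have u1 := hc.uniformContinuous_of_continuous hb.continuous
  have u2 := (hc.fderiv (𝕜 := ℝ)).uniformContinuous_of_continuous
    (hb.continuous_fderiv (by simp))
  have step : ∀ δ : ℝ, 0 < δ → ∃ B : Space n → ℝ, ContDiff ℝ ∞ B ∧
      (∀ x, R + 1 < ‖x‖ → B x = 0) ∧ (∀ x, ‖B x - b x‖ ≤ δ) ∧
      (∀ x, ‖gradient B x - gradient b x‖ ≤ δ) := by
    intro δ hδ
    obtain ⟨r1, hr1, h1⟩ := Metric.uniformContinuous_iff.1 u1 δ hδ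
    obtain ⟨r2, hr2, h2⟩ := Metric.uniformContinuous_iff.1 u2 δ hδ
    set r := min (min r1 r2) 1 with hr
    have hr0 : 0 < r := by positivity
    have rle1 : r ≤ r1 := (min_le_left _ _).trans (min_le_left _ _)
    have rle2 : r ≤ r2 := (min_le_left _ _).trans (min_le_right _ _)
    have rle3 : r ≤ 1 := min_le_right _ _
    let φ : ContDiffBump (0 : Space n) := ⟨r / 2, r, by positivity, by linarith⟩
    have hφr : φ.rOut = r := rfl
    refine ⟨φ.normed volume ⋆[ContinuousLinearMap.lsmul ℝ ℝ, volume] b, ?_, ?_, ?_, ?_⟩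
    · exact φ.hasCompactSupport_normed.contDiff_convolution_left _ φ.contDiff_normed
        hb.continuous.locallyIntegrable
    · intro x hx
      unfold convolution
      refine integral_eq_zero_of_ae (Eventually.of_forall fun t => ?_)
      by_cases ht : t ∈ Metric.ball (0 : Space n) r
      · have : R < ‖x - t‖ := by
          have := norm_sub_norm_le x t
          rw [mem_ball_zero_iff] at ht
          linarith
        simp [hb0 _ this]
      · have : φ.normed volume t = 0 := by
          by_contra hne
          apply ht
          have := Function.mem_support.2 hne
          rwa [φ.support_normed_eq] at this
        simp [this]
    · intro x
      rw [← dist_eq_norm]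
      refine ContDiffBump.dist_normed_convolution_le hb.continuous.aestronglyMeasurable ?_
      intro y hy
      exact (h1 (lt_of_lt_of_le hy (hφr ▸ rle1))).le
    · intro x
      have h3 := hc.hasFDerivAt_convolution_right (μ := volume) (ContinuousLinearMap.lsmul ℝ ℝ)
        (φ.integrable_normed.locallyIntegrable) hb x
      have h4 : (φ.normed volume ⋆[ContinuousLinearMap.precompR (Space n)
          (ContinuousLinearMap.lsmul ℝ ℝ), volume] fderiv ℝ b) x
          = (φ.normed volume ⋆[ContinuousLinearMap.lsmul ℝ ℝ, volume] fderiv ℝ b) x := by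
        unfold convolution
        refine integral_congr_ae (Eventually.of_forall fun t => ?_)
        ext v
        simp [ContinuousLinearMap.precompR_apply]
      unfold gradient
      rw [← map_sub, LinearIsometryEquiv.norm_map, h3.fderiv, h4, ← dist_eq_norm]
      refine ContDiffBump.dist_normed_convolution_le
        (hb.continuous_fderiv (by simp)).aestronglyMeasurable ?_
      intro y hy
      exact (h2 (lt_of_lt_of_le hy (hφr ▸ rle2))).le
  choose B hB using fun k : ℕ => step (1 / ((k : ℝ) + 1)) (by positivity)
  exact ⟨R + 1, fun x hx => hb0 x (by linarith), B, fun k => (hB k).1, fun k => (hB k).2.1,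
    fun k => (hB k).2.2.1, fun k => (hB k).2.2.2⟩

theorem gradient_eq_zero_of_lt_norm {b : Space n → ℝ} {R : ℝ} (h0 : ∀ x, R < ‖x‖ → b x = 0)
    {x : Space n} (hx : R < ‖x‖) : gradient b x = 0 := by
  have : b =ᶠ[𝓝 x] fun _ => 0 := by
    filter_upwards [(isOpen_lt continuous_const continuous_norm).mem_nhds hx] with y hy
    exact h0 y hy
  unfold gradient
  rw [this.fderiv_eq]
  simp

theorem hasCompactSupport_of_lt_norm {E : Type*} [Zero E] {F : Space n → E} {R : ℝ}
    (h0 : ∀ x, R < ‖x‖ → F x = 0) : HasCompactSupport F :=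
  HasCompactSupport.intro (isCompact_closedBall (0 : Space n) R) fun x hx => h0 x (by
    rwa [mem_closedBall_zero_iff, not_le] at hx)

/-- Pairings with a locally integrable function pass to uniform limits supported in a fixed ball. -/
theorem tendsto_integral_bilin {E E' G : Type*} [NormedAddCommGroup E] [NormedSpace ℝ E]
    [NormedAddCommGroup E'] [NormedSpace ℝ E'] [NormedAddCommGroup G] [NormedSpace ℝ G]
    (L : E →L[ℝ] E' →L[ℝ] G) {f : Space n → E} (hf : LocallyIntegrable f volume)
    {F : Space n → E'} {B : ℕ → Space n → E'} {R : ℝ} (hF : Continuous F)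
    (hB : ∀ k, Continuous (B k)) (hF0 : ∀ x, R < ‖x‖ → F x = 0)
    (hB0 : ∀ k x, R < ‖x‖ → B k x = 0) {δ : ℕ → ℝ} (hδ0 : Tendsto δ atTop (𝓝 0))
    (hδ : ∀ k x, ‖B k x - F x‖ ≤ δ k) :
    Tendsto (fun k => ∫ x, L (f x) (B k x)) atTop (𝓝 (∫ x, L (f x) (F x))) := by
  obtain ⟨C, hC⟩ := (hasCompactSupport_of_lt_norm hF0).exists_bound_of_continuous hF
  obtain ⟨D, hD⟩ := hδ0.bddAbove_range
  have hK : IsCompact (Metric.closedBall (0 : Space n) R) := isCompact_closedBall _ _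
  refine tendsto_integral_of_dominated_convergence
    (fun x => ‖L‖ * (C + D) * (Metric.closedBall (0 : Space n) R).indicator (fun x => ‖f x‖) x)
    (fun k => L.aestronglyMeasurable_comp₂ hf.aestronglyMeasurable
      (hB k).aestronglyMeasurable) ?_ (fun k => Eventually.of_forall fun x => ?_)
    (Eventually.of_forall fun x => ?_)
  · refine Integrable.const_mul ?_ _
    exact (integrable_indicator_iff hK.measurableSet).2 (hf.integrableOn_isCompact hK).norm
  · by_cases hx : x ∈ Metric.closedBall (0 : Space n) R
    · rw [indicator_of_mem hx]
      have h1 : ‖B k x‖ ≤ C + D := by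
        have h2 := hδ k x
        have h3 : δ k ≤ D := hD (mem_range_self k)
        have h4 := norm_le_norm_add_norm_sub' (B k x) (F x)
        linarith [hC x]
      calc ‖L (f x) (B k x)‖ ≤ ‖L‖ * ‖f x‖ * ‖B k x‖ := L.le_opNorm₂ _ _
        _ ≤ ‖L‖ * ‖f x‖ * (C + D) := by gcongr
        _ = _ := by ring
    · rw [indicator_of_notMem hx]
      rw [mem_closedBall_zero_iff, not_le] at hx
      simp [hB0 k x hx]
  · refine ((L (f x)).continuous.tendsto (F x)).comp ?_
    rw [tendsto_iff_norm_sub_tendsto_zero]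
    exact squeeze_zero (fun k => norm_nonneg _) (fun k => hδ k x) hδ0

/-- A weak gradient may be tested against `C¹` functions of compact support. -/
theorem IsWeakGradient.of_contDiff_one {f : L2 n} {F : L2Field n}
    (h : IsWeakGradient (f : Space n → ℝ) (F : Space n → Space n)) {b : Space n → ℝ}
    (hb : ContDiff ℝ 1 b) (hc : HasCompactSupport b) :
    ∫ x, f x • gradient b x = -∫ x, b x • F x := by
  obtain ⟨R, hR, B, hB, hBR, hδ, hδ'⟩ := exists_smooth_approx hb hc
  have h1 := tendsto_integral_bilin (ContinuousLinearMap.lsmul ℝ ℝ)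
    ((Lp.memLp f).locallyIntegrable (by norm_num)) (continuous_gradient_one hb)
    (fun k => continuous_gradient (hB k)) (fun x hx => gradient_eq_zero_of_lt_norm hR hx)
    (fun k x hx => gradient_eq_zero_of_lt_norm (hBR k) hx)
    tendsto_one_div_add_atTop_nhds_zero_nat hδ'
  have h2 := tendsto_integral_bilin (ContinuousLinearMap.lsmul ℝ ℝ).flip
    ((Lp.memLp F).locallyIntegrable (by norm_num)) hb.continuous
    (fun k => (hB k).continuous) hR hBR
    tendsto_one_div_add_atTop_nhds_zero_nat hδ
  simp only [ContinuousLinearMap.flip_apply, ContinuousLinearMap.lsmul_apply] at h1 h2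
  refine tendsto_nhds_unique h1 ?_
  refine h2.neg.congr fun k => ?_
  rw [h (B k) (hB k) (hasCompactSupport_of_lt_norm (hBR k))]

theorem contDiff_gradient {b : Space n → ℝ} (hb : ContDiff ℝ 2 b) :
    ContDiff ℝ 1 (gradient b) :=
  (InnerProductSpace.toDual ℝ (Space n)).symm.contDiff.comp
    (hb.fderiv_right (by norm_num))

theorem hasCompactSupport_gradient' {b : Space n → ℝ} (hc : HasCompactSupport b) :
    HasCompactSupport (gradient b) :=
  (hc.fderiv (𝕜 := ℝ)).comp_left (map_zero (InnerProductSpace.toDual ℝ (Space n)).symm)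

/-- Green's identity `∫ ∇v · ∇b = -∫ v Δb` for `v ∈ H¹` and compactly supported `b ∈ C²`. -/
theorem H1.integral_inner_gradient (v : H1 n) {b : Space n → ℝ} (hb : ContDiff ℝ 2 b)
    (hc : HasCompactSupport b) :
    ∫ x, inner ℝ (v.grad x) (gradient b x) = -∫ x, v.toL2 x * divergence (gradient b) x := by
  have hv : IsWeakGradient (v.toL2 : Space n → ℝ) (v.grad : Space n → Space n) := v.2
  have hG := contDiff_gradient hb
  have hGc := hasCompactSupport_gradient' hc
  have hi : ∀ i : Fin n, ContDiff ℝ 1 fun x => gradient b x i := fun i =>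
    (EuclideanSpace.proj (𝕜 := ℝ) i).contDiff.comp hG
  have hic : ∀ i : Fin n, HasCompactSupport fun x => gradient b x i := fun i =>
    hGc.comp_left (g := fun v : Space n => v i) rfl
  have lf := (Lp.memLp v.toL2).locallyIntegrable (by norm_num)
  have lF := (Lp.memLp v.grad).locallyIntegrable (by norm_num)
  have I1 : ∀ i : Fin n, Integrable fun x => v.toL2 x • gradient (fun x => gradient b x i) x :=
    fun i => lf.integrable_smul_right_of_hasCompactSupport (continuous_gradient_one (hi i))
      (hasCompactSupport_gradient' (hic i))
  have I2 : ∀ i : Fin n, Integrable fun x => gradient b x i • v.grad x :=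
    fun i => lF.integrable_smul_left_of_hasCompactSupport (hi i).continuous (hic i)
  have comp : ∀ i : Fin n, ∫ x, v.toL2 x * fderiv ℝ (gradient b) x (EuclideanSpace.single i 1) i
      = -∫ x, gradient b x i * v.grad x i := by
    intro i
    have h1 := congrArg (EuclideanSpace.proj (𝕜 := ℝ) i) (hv.of_contDiff_one (hi i) (hic i))
    rw [map_neg, ← ContinuousLinearMap.integral_comp_comm _ (I1 i),
      ← ContinuousLinearMap.integral_comp_comm _ (I2 i)] at h1
    simp only [map_smul, PiLp.proj_apply, smul_eq_mul] at h1
    rw [← h1]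
    congr 1
    funext x
    congr 1
    have d : HasFDerivAt (fun x => gradient b x i)
        ((EuclideanSpace.proj (𝕜 := ℝ) i).comp (fderiv ℝ (gradient b) x)) x :=
      (EuclideanSpace.proj (𝕜 := ℝ) i).hasFDerivAt.comp x
        (hG.differentiable (by simp) x).hasFDerivAt
    have e : gradient (fun x => gradient b x i) x i
        = inner ℝ (gradient (fun x => gradient b x i) x) (EuclideanSpace.single i (1 : ℝ)) := by
      rw [EuclideanSpace.inner_single_right]
      simp
    rw [e, inner_gradient_left, d.fderiv]
    rfl
  have J1 : ∀ i : Fin n, Integrable fun x =>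
      v.toL2 x * fderiv ℝ (gradient b) x (EuclideanSpace.single i 1) i := by
    intro i
    have c : Continuous fun x => fderiv ℝ (gradient b) x (EuclideanSpace.single i 1) i := by
      have := (hG.continuous_fderiv (by simp)).clm_apply
        (continuous_const (y := EuclideanSpace.single i (1 : ℝ)))
      exact (EuclideanSpace.proj (𝕜 := ℝ) i).continuous.comp this
    have cs : HasCompactSupport fun x =>
        fderiv ℝ (gradient b) x (EuclideanSpace.single i 1) i :=
      (hGc.fderiv (𝕜 := ℝ)).comp_left
        (g := fun A : Space n →L[ℝ] Space n => A (EuclideanSpace.single i 1) i) rfl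
    simpa using lf.integrable_smul_right_of_hasCompactSupport c cs
  have J2 : ∀ i : Fin n, Integrable fun x => gradient b x i * v.grad x i := by
    intro i
    simpa using (EuclideanSpace.proj (𝕜 := ℝ) i).integrable_comp (I2 i)
  have e1 : ∀ x, inner ℝ (v.grad x) (gradient b x) = ∑ i, gradient b x i * v.grad x i := by
    intro x
    rw [PiLp.inner_apply]
    simp
  simp_rw [e1, divergence, Finset.mul_sum]
  rw [integral_finsetSum _ fun i _ => J2 i, integral_finsetSum _ fun i _ => J1 i,
    ← Finset.sum_neg_distrib]
  exact Finset.sum_congr rfl fun i _ => by rw [comp i, neg_neg]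

end

/-! ### Jointly measurable representatives of curves in `L²` -/

section

variable {n : ℕ}

/-- A continuous curve in `L²` has a representative that is jointly measurable in time and
space. -/
theorem exists_measurable_representative {U : ℝ → L2 n} {M : ℝ}
    (hU : ContinuousOn U (Icc 0 M)) :
    ∃ w : ℝ × Space n → ℝ, Measurable w ∧ ∀ t ∈ Icc 0 M, ∀ᵐ x, w (t, x) = U t x := by
  have uc := isCompact_Icc.uniformContinuousOn_of_continuous hU
  rw [Metric.uniformContinuousOn_iff] at uc
  choose δ hδ huc using fun k : ℕ => uc ((1 / 2 : ℝ) ^ k) (by positivity)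
  -- freeze time at the left end points of a grid of mesh `δ k / 2`
  let s : ℕ → ℝ → ℝ := fun k t => δ k / 2 * ⌊t / (δ k / 2)⌋
  have hs : ∀ k, ∀ t ∈ Icc 0 M, s k t ∈ Icc 0 M ∧ dist (s k t) t < δ k := by
    intro k t ht
    have hd : 0 < δ k / 2 := half_pos (hδ k)
    have h1 := Int.floor_le (t / (δ k / 2))
    have h2 := Int.lt_floor_add_one (t / (δ k / 2))
    rw [le_div_iff₀ hd] at h1
    rw [div_lt_iff₀ hd] at h2
    have h3 : (0 : ℝ) ≤ ⌊t / (δ k / 2)⌋ := by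
      exact_mod_cast Int.floor_nonneg.2 (div_nonneg ht.1 hd.le)
    have h4 : 0 ≤ s k t := mul_nonneg hd.le h3
    have h5 : s k t ≤ t := by simp only [s]; linarith
    have h6 : t < s k t + δ k := by simp only [s]; linarith
    refine ⟨⟨h4, h5.trans ht.2⟩, ?_⟩
    rw [Real.dist_eq, abs_lt]
    constructor <;> linarith
  let wk : ℕ → ℝ × Space n → ℝ := fun k z => U (s k z.1) z.2
  have hwk : ∀ k, Measurable (wk k) := by
    intro k
    have h1 : Measurable fun z : ℤ × Space n => (U (δ k / 2 * z.1) : Space n → ℝ) z.2 :=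
      measurable_from_prod_countable_right fun j =>
        (Lp.stronglyMeasurable (U (δ k / 2 * j))).measurable
    have h2 : Measurable fun z : ℝ × Space n => (⌊z.1 / (δ k / 2)⌋, z.2) :=
      (Int.measurable_floor.comp (measurable_fst.div_const _)).prodMk measurable_snd
    exact h1.comp h2
  -- the limit superior is defined everywhere and measurable; the geometric rate makes it an
  -- a.e. limit at every fixed time
  refine ⟨fun z => limsup (fun k => wk k z) atTop, Measurable.limsup hwk, fun t ht => ?_⟩
  have hclose : ∀ k, dist (U (s k t)) (U t) < (1 / 2) ^ k := fun k =>
    huc k _ (hs k t ht).1 t ht (hs k t ht).2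
  have hcau : ∀ᵐ x, ∃ l, Tendsto (fun k => U (s k t) x) atTop (𝓝 l) := by
    refine Lp.ae_tendsto_of_cauchy_eLpNorm (p := 2) (B := fun k => 2 * (2⁻¹) ^ k)
      (fun k => Lp.aestronglyMeasurable _) (by norm_num) ?_ ?_
    · rw [ENNReal.tsum_mul_left, ENNReal.tsum_geometric]
      norm_num
    · intro N i j hi hj
      have e : (2 : ENNReal) * 2⁻¹ ^ N = ENNReal.ofReal (2 * (1 / 2) ^ N) := by
        rw [ENNReal.ofReal_mul (by norm_num), ENNReal.ofReal_pow (by norm_num)]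
        rw [one_div, ENNReal.ofReal_inv_of_pos (by norm_num), ENNReal.ofReal_ofNat]
      rw [← Lp.edist_def, edist_dist, e]
      refine (ENNReal.ofReal_lt_ofReal_iff (by positivity)).2 ?_
      have h1 := hclose i
      have h2 := hclose j
      have h3 : ((1 : ℝ) / 2) ^ i ≤ (1 / 2) ^ N :=
        pow_le_pow_of_le_one (by norm_num) (by norm_num) hi
      have h4 : ((1 : ℝ) / 2) ^ j ≤ (1 / 2) ^ N :=
        pow_le_pow_of_le_one (by norm_num) (by norm_num) hj
      linarith [dist_triangle_right (U (s i t)) (U (s j t)) (U t)]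
  have htend : Tendsto (fun k => U (s k t)) atTop (𝓝 (U t)) := by
    rw [tendsto_iff_dist_tendsto_zero]
    exact squeeze_zero (fun k => dist_nonneg) (fun k => (hclose k).le)
      (tendsto_pow_atTop_nhds_zero_of_lt_one (by norm_num) (by norm_num))
  obtain ⟨ns, hns, hae⟩ := (tendstoInMeasure_of_tendsto_Lp htend).exists_seq_tendsto_ae
  filter_upwards [hcau, hae] with x hx1 hx2
  obtain ⟨l, hl⟩ := hx1
  have : l = U t x := tendsto_nhds_unique (hl.comp hns.tendsto_atTop) hx2
  rw [← this]
  exact hl.limsup_eq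

end

/-! ### The weak formulation for products -/

section

variable {n : ℕ}

theorem isTestFunction_mul {T : ℝ} {a : ℝ → ℝ} {b : Space n → ℝ} (ha : ContDiff ℝ ∞ a)
    (hac : HasCompactSupport a) (haT : tsupport a ⊆ Iio T) (hb : ContDiff ℝ ∞ b)
    (hbc : HasCompactSupport b) : IsTestFunction T fun z : ℝ × Space n => a z.1 * b z.2 := by
  have hsub : tsupport (fun z : ℝ × Space n => a z.1 * b z.2) ⊆ tsupport a ×ˢ tsupport b := by
    refine closure_minimal ?_ ((isClosed_tsupport a).prod (isClosed_tsupport b))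
    intro z hz
    rw [Function.mem_support] at hz
    exact ⟨subset_tsupport a (left_ne_zero_of_mul hz), subset_tsupport b (right_ne_zero_of_mul hz)⟩
  refine ⟨(ha.comp contDiff_fst).mul (hb.comp contDiff_snd), ?_,
    fun z hz => ⟨haT (hsub hz).1, trivial⟩⟩
  exact (hac.isCompact.prod hbc.isCompact).of_isClosed_subset (isClosed_tsupport _) hsub

theorem continuous_damping (μ β : ℝ) : Continuous (damping μ β : Space n → ℝ) := by
  unfold damping
  have h : Continuous fun x : Space n => (1 + ‖x‖) ^ β :=
    Continuous.rpow_const (by fun_prop) fun z => Or.inl (by positivity)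
  exact continuous_const.div h fun z => (Real.rpow_pos_of_pos (by positivity) _).ne'

theorem damping_nonneg {μ β : ℝ} (hμ : 0 ≤ μ) (x : Space n) : 0 ≤ damping μ β x := by
  unfold damping
  positivity

/-- The damping coefficient decays at least like `1 / (1 + |x|)`. -/
theorem damping_le_inv {μ β : ℝ} (hμ : 0 ≤ μ) (hβ : 1 ≤ β) (x : Space n) :
    damping μ β x ≤ μ * (1 + ‖x‖)⁻¹ := by
  unfold damping
  rw [div_eq_mul_inv]
  gcongr
  have := Real.rpow_le_rpow_of_exponent_le (show 1 ≤ 1 + ‖x‖ by linarith [norm_nonneg x]) hβ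
  rwa [Real.rpow_one] at this

theorem damping_le {μ β : ℝ} (hμ : 0 ≤ μ) (hβ : 1 ≤ β) (x : Space n) : damping μ β x ≤ μ := by
  refine (damping_le_inv hμ hβ x).trans ?_
  have : (1 + ‖x‖)⁻¹ ≤ 1 := inv_le_one_of_one_le₀ (by linarith [norm_nonneg x])
  nlinarith

/-- A curve that is continuous on `[0, T)` only becomes integrable once multiplied by a factor that
vanishes before `T`. -/
theorem integrableOn_smul_of_vanishing {E : Type*} [NormedAddCommGroup E] [NormedSpace ℝ E]
    {c : ℝ → ℝ} {W : ℝ → E} {M T : ℝ} (hMT : M < T) (hc : Continuous c)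
    (hc0 : ∀ t, M < t → c t = 0) (hW : ContinuousOn W (Ico 0 T)) :
    IntegrableOn (fun t => c t • W t) (Ioo 0 T) := by
  have h1 : IntegrableOn (fun t => c t • W t) (Icc 0 M) :=
    (hc.continuousOn.smul (hW.mono fun t ht => ⟨ht.1, ht.2.trans_lt hMT⟩)).integrableOn_Icc
  refine h1.of_forall_sdiff_eq_zero measurableSet_Ioo fun t ht => ?_
  have : M < t := by
    by_contra h
    exact ht.2 ⟨ht.1.1.le, not_lt.1 h⟩
  simp [hc0 t this]

/-- Testing a Bochner integral of an `L²` valued curve against a square integrable function. -/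
theorem exists_integral_pairing {E : Type*} [NormedAddCommGroup E] [InnerProductSpace ℝ E]
    [CompleteSpace E] {T : ℝ} {c : ℝ → ℝ} {W : ℝ → Lp E 2 (volume : Measure (Space n))}
    (hi : IntegrableOn (fun t => c t • W t) (Ioo 0 T)) :
    ∃ X : Lp E 2 (volume : Measure (Space n)), ∀ b : Space n → E, Continuous b →
      HasCompactSupport b →
      ∫ t in Ioo 0 T, c t * ∫ x, inner ℝ (W t x) (b x) = ∫ x, inner ℝ (X x) (b x) := by
  refine ⟨∫ t in Ioo 0 T, c t • W t, fun b hb hbc => ?_⟩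
  have hb2 : MemLp b 2 volume := hb.memLp_of_hasCompactSupport hbc
  have h : ∀ V : Lp E 2 (volume : Measure (Space n)),
      ∫ x, inner ℝ (V x) (b x) = inner ℝ hb2.toLp V := by
    intro V
    rw [L2.inner_def]
    refine integral_congr_ae ?_
    filter_upwards [hb2.coeFn_toLp] with x hx
    rw [hx, real_inner_comm]
  simp_rw [h]
  rw [← integral_inner hi]
  refine integral_congr_ae (Eventually.of_forall fun t => ?_)
  simp [inner_smul_right]

variable {μ β p ε T M : ℝ} {f : H1 n} {g : L2 n} {u : ℝ → H1 n}

theorem IsEnergySolution.continuousOn_toL2 (hs : IsEnergySolution μ β p ε f g T u) :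
    ContinuousOn (fun t => (u t).toL2) (Ico 0 T) := hs.contDiffOn.continuousOn

theorem H1.continuous_grad : Continuous (H1.grad : H1 n → L2Field n) := by
  unfold H1.grad
  exact (WithLp.prod_continuous_ofLp 2 _ _).snd.comp continuous_subtype_val

theorem IsEnergySolution.continuousOn_grad (hs : IsEnergySolution μ β p ε f g T u) :
    ContinuousOn (fun t => (u t).grad) (Ico 0 T) :=
  H1.continuous_grad.comp_continuousOn hs.continuousOn

theorem IsEnergySolution.continuousOn_timeDeriv (hs : IsEnergySolution μ β p ε f g T u) :
    ContinuousOn (timeDeriv T u) (Ico 0 T) :=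
  hs.contDiffOn.continuousOn_derivWithin (uniqueDiffOn_Ico 0 T) le_rfl

theorem IsEnergySolution.hasDerivAt (hs : IsEnergySolution μ β p ε f g T u) {t : ℝ}
    (ht : t ∈ Ioo 0 T) : HasDerivAt (fun t => (u t).toL2) (timeDeriv T u t) t := by
  have h := ((hs.contDiffOn.differentiableOn (by norm_num)) t
    (Ioo_subset_Ico_self ht)).hasDerivWithinAt
  exact h.hasDerivAt (Ico_mem_nhds ht.1 ht.2)

/-- `|u|^p` is integrable up to the initial time, unlike in `LocallyLp`: the weak formulation makes
`|u|^p Ψ` integrable for test functions `Ψ` that equal `1` on `[0, M] × B_R`. -/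
theorem IsEnergySolution.lintegral_lt_top (hs : IsEnergySolution μ β p ε f g T u)
    (hM : 0 < M) (hMT : M < T) (R : ℝ) :
    ∫⁻ t in Ioc 0 M, ∫⁻ x in Metric.closedBall 0 R, ‖(u t).toL2 x‖ₑ ^ p < ⊤ := by
  let a : ContDiffBump (0 : ℝ) := ⟨M, (M + T) / 2, hM, by linarith⟩
  let b : ContDiffBump (0 : Space n) := ⟨max R 1, max R 1 + 1, by positivity, by linarith⟩
  have ht : tsupport a ⊆ Iio T := by
    rw [a.tsupport_eq]
    intro t ht
    rw [mem_closedBall_zero_iff, Real.norm_eq_abs] at ht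
    have h1 : |t| ≤ (M + T) / 2 := ht
    have h2 := le_abs_self t
    simp only [mem_Iio]
    linarith
  have htest := isTestFunction_mul a.contDiff a.hasCompactSupport ht b.contDiff
    b.hasCompactSupport
  refine lt_of_le_of_lt ?_ (hs.nonlinear_integrable _ htest)
  calc ∫⁻ t in Ioc 0 M, ∫⁻ x in Metric.closedBall 0 R, ‖(u t).toL2 x‖ₑ ^ p
      ≤ ∫⁻ t in Ioc 0 M, ∫⁻ x, ‖(u t).toL2 x‖ₑ ^ p * ‖a t * b x‖ₑ := by
        refine setLIntegral_mono' measurableSet_Ioc fun t ht => ?_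
        have ha1 : a t = 1 := by
          apply a.one_of_mem_closedBall
          rw [mem_closedBall_zero_iff, Real.norm_eq_abs, abs_of_pos ht.1]
          exact ht.2
        refine le_trans (le_of_eq ?_) (setLIntegral_le_lintegral (Metric.closedBall 0 R) _)
        refine setLIntegral_congr_fun Metric.isClosed_closedBall.measurableSet fun x hx => ?_
        have hb1 : b x = 1 := by
          apply b.one_of_mem_closedBall
          exact Metric.closedBall_subset_closedBall (le_max_left R 1) hx
        simp [ha1, hb1]
    _ ≤ ∫⁻ t in Ioo 0 T, ∫⁻ x, ‖(u t).toL2 x‖ₑ ^ p * ‖a t * b x‖ₑ :=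
        lintegral_mono_set fun t ht => ⟨ht.1, ht.2.trans_lt hMT⟩

/-- The weak formulation for a smooth tensor product test function. -/
theorem IsEnergySolution.weak_tensor (hs : IsEnergySolution μ β p ε f g T u) {a : ℝ → ℝ}
    {b : Space n → ℝ} (ha : ContDiff ℝ ∞ a) (hac : HasCompactSupport a)
    (haT : tsupport a ⊆ Iio T) (hb : ContDiff ℝ ∞ b) (hbc : HasCompactSupport b) :
    ε * (a 0 * ∫ x, g x * b x) + ε * (a 0 * ∫ x, f.toL2 x * (damping μ β x * b x))
      + ∫ t in Ioo 0 T, ∫ x, |(u t).toL2 x| ^ p * (a t * b x)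
    = -(∫ t in Ioo 0 T, deriv a t * ∫ x, timeDeriv T u t x * b x)
      + (∫ t in Ioo 0 T, a t * ∫ x, inner ℝ ((u t).grad x) (gradient b x))
      - ∫ t in Ioo 0 T, deriv a t * ∫ x, (u t).toL2 x * (damping μ β x * b x) := by
  have h := hs.weak _ (isTestFunction_mul ha hac haT hb hbc)
  simp only at h
  have hd : ∀ t x, deriv (fun s => a s * b x) t = deriv a t * b x := fun t x => by
    rw [deriv_mul_const (ha.differentiable (by simp) t)]
  have hg : ∀ t x, gradient (fun y => a t * b y) x = a t • gradient b x := by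
    intro t x
    unfold gradient
    rw [fderiv_const_mul (hb.differentiable (by simp) x), map_smul]
  simp_rw [hd, hg, inner_smul_right] at h
  simp_rw [← integral_const_mul]
  have r1 : ∀ x, a 0 * (g x * b x) = g x * (a 0 * b x) := fun x => by ring
  have r2 : ∀ x, a 0 * (f.toL2 x * (damping μ β x * b x))
      = damping μ β x * f.toL2 x * (a 0 * b x) := fun x => by ring
  have r3 : ∀ t x, deriv a t * (timeDeriv T u t x * b x)
      = timeDeriv T u t x * (deriv a t * b x) := fun t x => by ring
  have r4 : ∀ t x, deriv a t * ((u t).toL2 x * (damping μ β x * b x))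
      = damping μ β x * (u t).toL2 x * (deriv a t * b x) := fun t x => by ring
  simp_rw [r1, r2, r3, r4]
  simp_rw [integral_const_mul ε]
  exact h

/-- Joint integrability of `|w|^p` on bounded parts of space-time, for a jointly measurable
representative `w` of the solution. -/
theorem integrable_nonlinear (hs : IsEnergySolution μ β p ε f g T u) (hp : 0 ≤ p) (hM : 0 < M)
    (hMT : M < T) {w : ℝ × Space n → ℝ} (hw : Measurable w)
    (hwu : ∀ t ∈ Icc 0 M, ∀ᵐ x, w (t, x) = (u t).toL2 x) (R : ℝ) :
    Integrable (fun z : ℝ × Space n => |w z| ^ p * (Metric.closedBall 0 R).indicator 1 z.2)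
      ((volume.restrict (Ioc 0 M)).prod volume) := by
  have hB : MeasurableSet (Metric.closedBall (0 : Space n) R) :=
    Metric.isClosed_closedBall.measurableSet
  have hm : Measurable fun z : ℝ × Space n =>
      |w z| ^ p * (Metric.closedBall (0 : Space n) R).indicator 1 z.2 :=
    (hw.abs.pow_const p).mul ((measurable_one.indicator hB).comp measurable_snd)
  refine ⟨hm.aestronglyMeasurable, ?_⟩
  rw [hasFiniteIntegral_iff_enorm, lintegral_prod _ hm.enorm.aemeasurable]
  refine lt_of_eq_of_lt ?_ (hs.lintegral_lt_top hM hMT R)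
  refine setLIntegral_congr_fun measurableSet_Ioc fun t ht => ?_
  rw [← lintegral_indicator hB]
  refine lintegral_congr_ae ?_
  filter_upwards [hwu t (Ioc_subset_Icc_self ht)] with x hx
  by_cases hxB : x ∈ Metric.closedBall (0 : Space n) R
  · simp only [indicator_of_mem hxB, Pi.one_apply, mul_one, hx]
    rw [Real.enorm_rpow_of_nonneg (abs_nonneg _) hp, Real.enorm_abs]
  · simp [indicator_of_notMem hxB]

/-- The nonlinear term against a tensor product test function, as one integral over space-time. -/
theorem integral_nonlinear_eq (hs : IsEnergySolution μ β p ε f g T u) (hp : 0 ≤ p) (hM : 0 < M)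
    (hMT : M < T) {w : ℝ × Space n → ℝ} (hw : Measurable w)
    (hwu : ∀ t ∈ Icc 0 M, ∀ᵐ x, w (t, x) = (u t).toL2 x) {a : ℝ → ℝ} {b : Space n → ℝ} {R : ℝ}
    (ha : Continuous a) (ha0 : ∀ t, M < t → a t = 0) (hb : Continuous b)
    (hb0 : ∀ x, R < ‖x‖ → b x = 0) :
    Integrable (fun z : ℝ × Space n => |w z| ^ p * (a z.1 * b z.2))
      ((volume.restrict (Ioc 0 M)).prod volume) ∧
    ∫ t in Ioo 0 T, ∫ x, |(u t).toL2 x| ^ p * (a t * b x) =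
      ∫ z, |w z| ^ p * (a z.1 * b z.2) ∂((volume.restrict (Ioc 0 M)).prod volume) := by
  have hi : Integrable (fun z : ℝ × Space n => |w z| ^ p * (a z.1 * b z.2))
      ((volume.restrict (Ioc 0 M)).prod volume) := by
    obtain ⟨Ca, hCa⟩ := (isCompact_Icc (a := 0) (b := M)).exists_bound_of_continuousOn
      ha.continuousOn
    obtain ⟨Cb, hCb⟩ := (hasCompactSupport_of_lt_norm hb0).exists_bound_of_continuous hb
    have hmem : ∀ᵐ z : ℝ × Space n ∂((volume.restrict (Ioc 0 M)).prod volume),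
        z.1 ∈ Ioc 0 M :=
      Measure.quasiMeasurePreserving_fst.ae (ae_restrict_mem measurableSet_Ioc)
    refine ((integrable_nonlinear hs hp hM hMT hw hwu R).mul_const (Ca * Cb)).mono'
      ?_ ?_
    · exact ((hw.abs.pow_const p).mul ((ha.measurable.comp measurable_fst).mul
        (hb.measurable.comp measurable_snd))).aestronglyMeasurable
    · filter_upwards [hmem] with z hz
      have h1 : 0 ≤ |w z| ^ p := Real.rpow_nonneg (abs_nonneg _) p
      by_cases hx : z.2 ∈ Metric.closedBall (0 : Space n) R
      · rw [norm_mul, norm_mul, Real.norm_of_nonneg h1, indicator_of_mem hx, Pi.one_apply, mul_one]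
        have h2 := hCa z.1 (Ioc_subset_Icc_self hz)
        have h3 := hCb z.2
        have h4 := (norm_nonneg _).trans h2
        gcongr
      · rw [indicator_of_notMem hx]
        rw [mem_closedBall_zero_iff, not_le] at hx
        simp [hb0 _ hx]
  refine ⟨hi, ?_⟩
  rw [integral_prod _ hi]
  have hsub : Ioc 0 M ⊆ Ioo 0 T := fun t ht => ⟨ht.1, ht.2.trans_lt hMT⟩
  rw [setIntegral_eq_of_subset_of_forall_sdiff_eq_zero measurableSet_Ioo hsub]
  · refine setIntegral_congr_fun measurableSet_Ioc fun t ht => ?_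
    refine integral_congr_ae ?_
    filter_upwards [hwu t (Ioc_subset_Icc_self ht)] with x hx
    rw [hx]
  · intro t ht
    have : M < t := by
      by_contra h
      exact ht.2 ⟨ht.1.1, not_lt.1 h⟩
    simp [ha0 t this]

/-- The weak formulation for test functions `a(t) b(x)` with `b` only of class `C¹`. -/
theorem IsEnergySolution.weak_tensor_C1 (hs : IsEnergySolution μ β p ε f g T u) (hp : 0 ≤ p)
    (hμ : 0 ≤ μ) (hβ : 1 ≤ β)
    (hM : 0 < M) (hMT : M < T) {w : ℝ × Space n → ℝ} (hw : Measurable w)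
    (hwu : ∀ t ∈ Icc 0 M, ∀ᵐ x, w (t, x) = (u t).toL2 x) {a : ℝ → ℝ} {b : Space n → ℝ}
    (ha : ContDiff ℝ ∞ a) (hac : HasCompactSupport a) (haM : tsupport a ⊆ Iic M)
    (hb : ContDiff ℝ 1 b) (hbc : HasCompactSupport b) :
    ε * (a 0 * ∫ x, g x * b x) + ε * (a 0 * ∫ x, f.toL2 x * (damping μ β x * b x))
      + ∫ z, |w z| ^ p * (a z.1 * b z.2) ∂((volume.restrict (Ioc 0 M)).prod volume)
    = -(∫ t in Ioo 0 T, deriv a t * ∫ x, timeDeriv T u t x * b x)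
      + (∫ t in Ioo 0 T, a t * ∫ x, inner ℝ ((u t).grad x) (gradient b x))
      - ∫ t in Ioo 0 T, deriv a t * ∫ x, (u t).toL2 x * (damping μ β x * b x) := by
  have ha0 : ∀ t, M < t → a t = 0 := fun t ht => by
    by_contra h
    exact absurd (haM (subset_tsupport a h)) (not_le.2 ht)
  have ha1 : ∀ t, M < t → deriv a t = 0 := fun t ht => by
    by_contra h
    exact absurd (haM (support_deriv_subset h)) (not_le.2 ht)
  have haT : tsupport a ⊆ Iio T := fun t ht => (haM ht).trans_lt hMT
  have cda : Continuous (deriv a) := ha.continuous_deriv (by simp)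
  have cV := continuous_damping (n := n) μ β
  have im : ∀ r s : ℝ, r * s = inner ℝ r s := fun r s => by simp [mul_comm]
  -- move the time integrals onto fixed `L²` elements `Xᵢ`, so that only `b` has to be approximated
  obtain ⟨X₁, p1⟩ := exists_integral_pairing (W := timeDeriv T u)
    (integrableOn_smul_of_vanishing hMT cda ha1 hs.continuousOn_timeDeriv)
  obtain ⟨X₂, p2⟩ := exists_integral_pairing (W := fun t => (u t).grad)
    (integrableOn_smul_of_vanishing hMT ha.continuous ha0 hs.continuousOn_grad)
  obtain ⟨X₃, p3⟩ := exists_integral_pairing (W := fun t => (u t).toL2)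
    (integrableOn_smul_of_vanishing hMT cda ha1 hs.continuousOn_toL2)
  simp only [← im] at p1 p3
  have cVb : ∀ {b : Space n → ℝ}, Continuous b → Continuous fun x => damping μ β x * b x :=
    fun h => cV.mul h
  rw [p1 b hb.continuous hbc, p2 _ (continuous_gradient_one hb) (hasCompactSupport_gradient' hbc),
    p3 _ (cVb hb.continuous) (hbc.mul_left)]
  obtain ⟨R, hR, B, hB, hBR, hδ, hδ'⟩ := exists_smooth_approx hb hbc
  have hδ0 := tendsto_one_div_add_atTop_nhds_zero_nat (𝕜 := ℝ)
  have hδV : ∀ k x, ‖damping μ β x * B k x - damping μ β x * b x‖ ≤ μ * (1 / ((k : ℝ) + 1)) := by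
    intro k x
    rw [← mul_sub, norm_mul, Real.norm_of_nonneg (damping_nonneg hμ x)]
    exact mul_le_mul (damping_le hμ hβ x) (hδ k x) (norm_nonneg _) hμ
  have hδ0V : Tendsto (fun k : ℕ => μ * (1 / ((k : ℝ) + 1))) atTop (𝓝 0) := by
    simpa using hδ0.const_mul μ
  have lim : ∀ v : L2 n, Tendsto (fun k => ∫ x, v x * B k x) atTop (𝓝 (∫ x, v x * b x)) :=
    fun v => tendsto_integral_bilin (ContinuousLinearMap.mul ℝ ℝ)
      ((Lp.memLp v).locallyIntegrable (by norm_num)) hb.continuous (fun k => (hB k).continuous)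
      hR hBR hδ0 hδ
  have limV : ∀ v : L2 n, Tendsto (fun k => ∫ x, v x * (damping μ β x * B k x)) atTop
      (𝓝 (∫ x, v x * (damping μ β x * b x))) :=
    fun v => tendsto_integral_bilin (R := R) (ContinuousLinearMap.mul ℝ ℝ)
      ((Lp.memLp v).locallyIntegrable (by norm_num)) (cVb hb.continuous)
      (fun k => cVb (hB k).continuous) (fun x hx => by simp [hR x hx])
      (fun k x hx => by simp [hBR k x hx]) hδ0V hδV
  have limG : Tendsto (fun k => ∫ x, inner ℝ (X₂ x) (gradient (B k) x)) atTop
      (𝓝 (∫ x, inner ℝ (X₂ x) (gradient b x))) := by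
    exact tendsto_integral_bilin (innerSL ℝ)
      ((Lp.memLp X₂).locallyIntegrable (by norm_num)) (continuous_gradient_one hb)
      (fun k => continuous_gradient (hB k)) (fun x hx => gradient_eq_zero_of_lt_norm hR hx)
      (fun k x hx => gradient_eq_zero_of_lt_norm (hBR k) hx) hδ0 hδ'
  have limN : Tendsto (fun k => ∫ z, |w z| ^ p * (a z.1 * B k z.2)
        ∂((volume.restrict (Ioc 0 M)).prod volume)) atTop
      (𝓝 (∫ z, |w z| ^ p * (a z.1 * b z.2) ∂((volume.restrict (Ioc 0 M)).prod volume))) := by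
    obtain ⟨Cb, hCb⟩ := hbc.exists_bound_of_continuous hb.continuous
    obtain ⟨Ca, hCa⟩ := hac.exists_bound_of_continuous ha.continuous
    have hCa0 : 0 ≤ Ca := (norm_nonneg _).trans (hCa 0)
    refine tendsto_integral_of_dominated_convergence
      (fun z => (|w z| ^ p * (Metric.closedBall (0 : Space n) R).indicator 1 z.2)
        * (Ca * (Cb + 1)))
      (fun k => (integral_nonlinear_eq hs hp hM hMT hw hwu ha.continuous ha0
        (hB k).continuous (hBR k)).1.1)
      ((integrable_nonlinear hs hp hM hMT hw hwu R).mul_const _)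
      (fun k => Eventually.of_forall fun z => ?_) (Eventually.of_forall fun z => ?_)
    · have h1 : 0 ≤ |w z| ^ p := Real.rpow_nonneg (abs_nonneg _) p
      by_cases hx : z.2 ∈ Metric.closedBall (0 : Space n) R
      · rw [norm_mul, norm_mul, Real.norm_of_nonneg h1, indicator_of_mem hx, Pi.one_apply, mul_one]
        have h2 := hCa z.1
        have h3 : ‖B k z.2‖ ≤ Cb + 1 := by
          have h2 := hδ k z.2
          have h3 : 1 / ((k : ℝ) + 1) ≤ 1 := by
            rw [div_le_one (by positivity)]
            linarith [k.cast_nonneg (α := ℝ)]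
          have h4 := norm_le_norm_add_norm_sub' (B k z.2) (b z.2)
          linarith [hCb z.2]
        gcongr
      · rw [indicator_of_notMem hx]
        rw [mem_closedBall_zero_iff, not_le] at hx
        simp [hBR k _ hx]
    · refine Tendsto.const_mul _ (Tendsto.const_mul _ ?_)
      rw [tendsto_iff_norm_sub_tendsto_zero]
      exact squeeze_zero (fun k => norm_nonneg _) (fun k => hδ k z.2) hδ0
  have L := (((lim g).const_mul (a 0)).const_mul ε).add
    (((limV f.toL2).const_mul (a 0)).const_mul ε) |>.add limN
  have Rr := ((lim X₁).neg.add limG).sub (limV X₃)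
  refine tendsto_nhds_unique L (Rr.congr fun k => ?_)
  have hBc := hasCompactSupport_of_lt_norm (hBR k)
  have h := hs.weak_tensor ha hac haT (hB k) hBc
  rw [p1 _ (hB k).continuous hBc, p2 _ (continuous_gradient (hB k))
    (hasCompactSupport_gradient hBc), p3 _ (cVb (hB k).continuous) (hBc.mul_left),
    (integral_nonlinear_eq hs hp hM hMT hw hwu ha.continuous ha0
        (hB k).continuous (hBR k)).2] at h
  exact h.symm

end

/-! ### The very weak formulation -/

section

variable {n : ℕ} {μ β p ε T M : ℝ} {f : H1 n} {g : L2 n} {u : ℝ → H1 n}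

theorem integral_sub_sub {α : Type*} [MeasurableSpace α] {ν : Measure α} {F G H : α → ℝ}
    (hF : Integrable F ν) (hG : Integrable G ν) (hH : Integrable H ν) :
    ∫ x, (F x - G x - H x) ∂ν = ∫ x, F x ∂ν - ∫ x, G x ∂ν - ∫ x, H x ∂ν := by
  rw [← integral_sub hF hG]
  exact integral_sub (hF.sub hG) hH

/-- Pairing with a continuous function of compact support is a bounded functional on `L²`. -/
theorem exists_pairing_functional {b : Space n → ℝ} (hb : Continuous b)
    (hbc : HasCompactSupport b) :
    ∃ ℓ : L2 n →L[ℝ] ℝ, ∀ v : L2 n, ∫ x, v x * b x = ℓ v := by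
  have hb2 : MemLp b 2 volume := hb.memLp_of_hasCompactSupport hbc
  refine ⟨innerSL ℝ hb2.toLp, fun v => ?_⟩
  rw [innerSL_apply_apply, L2.inner_def]
  refine integral_congr_ae ?_
  filter_upwards [hb2.coeFn_toLp] with x hx
  simp [hx, mul_comm]

theorem continuousOn_pairing {b : Space n → ℝ} (hb : Continuous b) (hbc : HasCompactSupport b)
    {W : ℝ → L2 n} {s : Set ℝ} (hW : ContinuousOn W s) :
    ContinuousOn (fun t => ∫ x, W t x * b x) s := by
  obtain ⟨ℓ, hℓ⟩ := exists_pairing_functional hb hbc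
  simp_rw [hℓ]
  exact ℓ.continuous.comp_continuousOn hW

theorem H1.toL2_smul (c : ℝ) (v : H1 n) : (c • v).toL2 = c • v.toL2 := rfl

/-- Integration by parts in time. -/
theorem IsEnergySolution.integral_timeDeriv (hs : IsEnergySolution μ β p ε f g T u)
    (hM : 0 < M) (hMT : M < T) {a : ℝ → ℝ} {b : Space n → ℝ}
    (ha : ContDiff ℝ ∞ a) (haM : tsupport a ⊆ Iic M) (hb : Continuous b)
    (hbc : HasCompactSupport b) :
    ∫ t in Ioo 0 T, deriv a t * ∫ x, timeDeriv T u t x * b x =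
      -(deriv a 0 * (ε * ∫ x, f.toL2 x * b x))
        - ∫ t in Ioc 0 M, deriv (deriv a) t * ∫ x, (u t).toL2 x * b x := by
  have ha1 : ∀ t, M < t → deriv a t = 0 := fun t ht => by
    by_contra h
    exact absurd (haM (support_deriv_subset h)) (not_le.2 ht)
  have cda : ContDiff ℝ ∞ (deriv a) := (contDiff_infty_iff_deriv.1 ha).2
  have ha1M : deriv a M = 0 := by
    have h : Tendsto (deriv a) (𝓝[>] M) (𝓝 (deriv a M)) :=
      (cda.continuous.tendsto M).mono_left nhdsWithin_le_nhds
    refine tendsto_nhds_unique h (tendsto_const_nhds.congr' ?_)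
    filter_upwards [self_mem_nhdsWithin] with t ht
    exact (ha1 t ht).symm
  obtain ⟨ℓ, hℓ⟩ := exists_pairing_functional hb hbc
  simp_rw [hℓ]
  have hsub : Ioc 0 M ⊆ Ioo 0 T := fun t ht => ⟨ht.1, ht.2.trans_lt hMT⟩
  have hsub' : Icc 0 M ⊆ Ico 0 T := fun t ht => ⟨ht.1, ht.2.trans_lt hMT⟩
  rw [setIntegral_eq_of_subset_of_forall_sdiff_eq_zero measurableSet_Ioo hsub]
  · rw [← intervalIntegral.integral_of_le hM.le, ← intervalIntegral.integral_of_le hM.le]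
    have c1 : ContinuousOn (fun t => ℓ (u t).toL2) (uIcc 0 M) := by
      rw [uIcc_of_le hM.le]
      exact ℓ.continuous.comp_continuousOn (hs.continuousOn_toL2.mono hsub')
    have c2 : ContinuousOn (fun t => ℓ (timeDeriv T u t)) (uIcc 0 M) := by
      rw [uIcc_of_le hM.le]
      exact ℓ.continuous.comp_continuousOn (hs.continuousOn_timeDeriv.mono hsub')
    rw [intervalIntegral.integral_mul_deriv_eq_deriv_mul_of_hasDeriv_right
      (u' := deriv (deriv a)) (v := fun t => ℓ (u t).toL2)
      cda.continuous.continuousOn c1]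
    · rw [ha1M, hs.initial, H1.toL2_smul, map_smul, smul_eq_mul]
      ring
    · intro t _
      exact (cda.differentiable (by simp) t).hasDerivAt.hasDerivWithinAt
    · intro t ht
      rw [min_eq_left hM.le, max_eq_right hM.le] at ht
      exact (ℓ.hasFDerivAt.comp_hasDerivAt t
        (hs.hasDerivAt ⟨ht.1, ht.2.trans hMT⟩)).hasDerivWithinAt
    · exact (cda.continuous_deriv (by simp)).intervalIntegrable _ _
    · exact c2.intervalIntegrable
  · intro t ht
    have : M < t := by
      by_contra h
      exact ht.2 ⟨ht.1.1, not_lt.1 h⟩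
    simp [ha1 t this]

/-- The very weak formulation, with all derivatives on the test function `a(t) b(x)`. -/
theorem IsEnergySolution.very_weak (hs : IsEnergySolution μ β p ε f g T u) (hp : 0 ≤ p)
    (hμ : 0 ≤ μ) (hβ : 1 ≤ β)
    (hM : 0 < M) (hMT : M < T) {w : ℝ × Space n → ℝ} (hw : Measurable w)
    (hwu : ∀ t ∈ Icc 0 M, ∀ᵐ x, w (t, x) = (u t).toL2 x) {a : ℝ → ℝ} {b : Space n → ℝ}
    (ha : ContDiff ℝ ∞ a) (hac : HasCompactSupport a) (haM : tsupport a ⊆ Iic M)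
    (hb : ContDiff ℝ 2 b) (hbc : HasCompactSupport b) :
    ε * (a 0 * (∫ x, g x * b x) + a 0 * (∫ x, f.toL2 x * (damping μ β x * b x))
        - deriv a 0 * ∫ x, f.toL2 x * b x)
      + ∫ z, |w z| ^ p * (a z.1 * b z.2) ∂((volume.restrict (Ioc 0 M)).prod volume)
    = ∫ t in Ioc 0 M, ∫ x, w (t, x) * (deriv (deriv a) t * b x
        - a t * divergence (gradient b) x - deriv a t * (damping μ β x * b x)) := by
  have ha0 : ∀ t, M < t → a t = 0 := fun t ht => by
    by_contra h
    exact absurd (haM (subset_tsupport a h)) (not_le.2 ht)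
  have ha1 : ∀ t, M < t → deriv a t = 0 := fun t ht => by
    by_contra h
    exact absurd (haM (support_deriv_subset h)) (not_le.2 ht)
  have cda : ContDiff ℝ ∞ (deriv a) := (contDiff_infty_iff_deriv.1 ha).2
  have cdda : Continuous (deriv (deriv a)) := cda.continuous_deriv (by simp)
  have hb1 : ContDiff ℝ 1 b := hb.of_le (by norm_num)
  have cV := continuous_damping (n := n) μ β
  have cVb : Continuous fun x => damping μ β x * b x := cV.mul hb.continuous
  have cVc : HasCompactSupport fun x => damping μ β x * b x := hbc.mul_left
  have cL : Continuous (divergence (gradient b)) := by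
    unfold divergence
    refine continuous_finsetSum _ fun i _ => ?_
    exact (EuclideanSpace.proj (𝕜 := ℝ) i).continuous.comp
      (((contDiff_gradient hb).continuous_fderiv (by simp)).clm_apply continuous_const)
  have cLc : HasCompactSupport (divergence (gradient b)) :=
    ((hasCompactSupport_gradient' hbc).fderiv (𝕜 := ℝ)).comp_left
      (g := fun A : Space n →L[ℝ] Space n => ∑ i, A (EuclideanSpace.single i 1) i) (by simp)
  have h := hs.weak_tensor_C1 hp hμ hβ hM hMT hw hwu ha hac haM hb1 hbc
  rw [hs.integral_timeDeriv hM hMT ha haM hb.continuous hbc] at h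
  simp_rw [fun t => (u t).integral_inner_gradient hb hbc] at h
  have hsub : Ioc 0 M ⊆ Ioo 0 T := fun t ht => ⟨ht.1, ht.2.trans_lt hMT⟩
  have hsub' : Icc 0 M ⊆ Ico 0 T := fun t ht => ⟨ht.1, ht.2.trans_lt hMT⟩
  have shrink : ∀ F : ℝ → ℝ, (∀ t, M < t → F t = 0) →
      ∫ t in Ioo 0 T, F t = ∫ t in Ioc 0 M, F t := by
    intro F hF
    refine setIntegral_eq_of_subset_of_forall_sdiff_eq_zero measurableSet_Ioo hsub fun t ht => ?_
    apply hF
    by_contra h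
    exact ht.2 ⟨ht.1.1, not_lt.1 h⟩
  rw [shrink _ (fun t ht => by simp [ha0 t ht]), shrink _ (fun t ht => by simp [ha1 t ht])] at h
  have int : ∀ {c : ℝ → ℝ} {b : Space n → ℝ}, Continuous c → Continuous b → HasCompactSupport b →
      IntegrableOn (fun t => c t * ∫ x, (u t).toL2 x * b x) (Ioc 0 M) := by
    intro c b hc hb hbc
    exact ((hc.continuousOn.mul (continuousOn_pairing hb hbc
      (hs.continuousOn_toL2.mono hsub'))).integrableOn_Icc).mono_set Ioc_subset_Icc_self
  have e : ∫ t in Ioc 0 M, ∫ x, w (t, x) * (deriv (deriv a) t * b x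
        - a t * divergence (gradient b) x - deriv a t * (damping μ β x * b x))
      = ∫ t in Ioc 0 M, (deriv (deriv a) t * (∫ x, (u t).toL2 x * b x)
        - a t * (∫ x, (u t).toL2 x * divergence (gradient b) x)
        - deriv a t * (∫ x, (u t).toL2 x * (damping μ β x * b x))) := by
    refine setIntegral_congr_fun measurableSet_Ioc fun t ht => ?_
    have I : ∀ {b : Space n → ℝ}, Continuous b → HasCompactSupport b → ∀ c : ℝ,
        Integrable fun x => c * ((u t).toL2 x * b x) := fun hb hbc c =>
      (((Lp.memLp (u t).toL2).locallyIntegrable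
        (by norm_num)).integrable_smul_right_of_hasCompactSupport hb hbc).const_mul c
    have e1 : ∫ x, w (t, x) * (deriv (deriv a) t * b x
        - a t * divergence (gradient b) x - deriv a t * (damping μ β x * b x))
        = ∫ x, (deriv (deriv a) t * ((u t).toL2 x * b x)
          - a t * ((u t).toL2 x * divergence (gradient b) x)
          - deriv a t * ((u t).toL2 x * (damping μ β x * b x))) := by
      refine integral_congr_ae ?_
      filter_upwards [hwu t (Ioc_subset_Icc_self ht)] with x hx
      rw [hx]
      ring
    rw [e1, integral_sub_sub (I hb.continuous hbc _) (I cL cLc _) (I cVb cVc _),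
      integral_const_mul, integral_const_mul, integral_const_mul]
  rw [e, integral_sub_sub (int cdda hb.continuous hbc) (int ha.continuous cL cLc)
    (int cda.continuous cVb cVc)]
  simp only [mul_neg, integral_neg] at h
  linarith

end

/-! ### Temporal cutoffs -/

/-- A smooth nonincreasing cut-off `η` in time, equal to `1` on `s ≤ 1/2` and to `0` on `s ≥ 1`,
whose derivatives up to order two are dominated by the power `1/p` of a continuous weight
`θ ≤ η` that lives on `[1/4, 1]`. -/
structure IsCutoffPair (p C : ℝ) (η θ : ℝ → ℝ) : Prop where
  contDiff : ContDiff ℝ ∞ η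
  antitone : Antitone η
  eq_one : ∀ s, s ≤ 1 / 2 → η s = 1
  eq_zero : ∀ s, 1 ≤ s → η s = 0
  continuous : Continuous θ
  nonneg : ∀ s, 0 ≤ θ s
  le : ∀ s, θ s ≤ η s
  weight_eq_zero : ∀ s, s ≤ 1 / 4 → θ s = 0
  abs_deriv_le : ∀ s, |deriv η s| ≤ C * θ s ^ (1 / p)
  abs_deriv_deriv_le : ∀ s, |deriv (deriv η) s| ≤ C * θ s ^ (1 / p)

theorem IsCutoffPair.le_one {p C : ℝ} {η θ : ℝ → ℝ} (h : IsCutoffPair p C η θ) (s : ℝ) :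
    η s ≤ 1 := by
  rw [← h.eq_one (min s (1 / 2)) (min_le_right _ _)]
  exact h.antitone (min_le_left _ _)

theorem IsCutoffPair.cutoff_nonneg {p C : ℝ} {η θ : ℝ → ℝ} (h : IsCutoffPair p C η θ) (s : ℝ) :
    0 ≤ η s := (h.nonneg s).trans (h.le s)

/-- Such a pair exists: take a large power of any smooth cut-off, since derivatives of `χᵏ` carry
the factor `χᵏ⁻²`. -/
theorem exists_isCutoffPair {p : ℝ} (hp : 1 < p) :
    ∃ C : ℝ, 0 < C ∧ ∃ η θ : ℝ → ℝ, IsCutoffPair p C η θ := by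
  let χ : ℝ → ℝ := fun s => Real.smoothTransition (2 - 2 * s)
  have hχ : ContDiff ℝ ∞ χ := Real.smoothTransition.contDiff.comp (by fun_prop)
  have hχ' : ContDiff ℝ ∞ (deriv χ) := (contDiff_infty_iff_deriv.1 hχ).2
  have χ0 : ∀ s, 0 ≤ χ s := fun s => Real.smoothTransition.nonneg _
  have χ1 : ∀ s, χ s ≤ 1 := fun s => Real.smoothTransition.le_one _
  have χz : ∀ s, 1 ≤ s → χ s = 0 := fun s hs =>
    Real.smoothTransition.zero_of_nonpos (by linarith)
  have χo : ∀ s, s ≤ 1 / 2 → χ s = 1 := fun s hs =>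
    Real.smoothTransition.one_of_one_le (by linarith)
  have χa : Antitone χ := fun s t hst => Real.smoothTransition.monotone (by linarith)
  obtain ⟨C₁, hC₁⟩ := (isCompact_Icc (a := (1 / 2 : ℝ)) (b := 1)).exists_bound_of_continuousOn
    hχ'.continuous.continuousOn
  obtain ⟨C₂, hC₂⟩ := (isCompact_Icc (a := (1 / 2 : ℝ)) (b := 1)).exists_bound_of_continuousOn
    (hχ'.continuous_deriv (by simp)).continuousOn
  have C₁0 : 0 ≤ C₁ := (norm_nonneg _).trans (hC₁ 1 (by norm_num))
  have C₂0 : 0 ≤ C₂ := (norm_nonneg _).trans (hC₂ 1 (by norm_num))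
  -- the exponent `k = j + 2` satisfies `k / p ≤ k - 2`, so that `χ^(k-2) ≤ (χ^k)^(1/p)`
  obtain ⟨j, hj1, hj⟩ : ∃ j : ℕ, 1 ≤ j ∧ ((j : ℝ) + 2) / p ≤ j := by
    refine ⟨⌈2 / (p - 1)⌉₊ + 1, by omega, ?_⟩
    have h1 := Nat.le_ceil (2 / (p - 1))
    rw [div_le_iff₀ (by linarith)] at h1
    rw [div_le_iff₀ (by linarith)]
    push_cast
    nlinarith
  set D : ℝ := (j + 2) * ((j + 1) * (C₁ * C₁) + C₂) + (j + 2) * C₁ + 1 with hD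
  refine ⟨D, by positivity, fun s => χ s ^ (j + 2),
    fun s => χ s ^ (j + 2) * Real.smoothTransition (4 * s - 1), ?_⟩
  have d1 : ∀ s, HasDerivAt (fun s => χ s ^ (j + 2)) ((j + 2) * χ s ^ (j + 1) * deriv χ s) s := by
    intro s
    refine ((hχ.differentiable (by simp) s).hasDerivAt.pow (j + 2)).congr_deriv ?_
    push_cast
    rfl
  have e1 : deriv (fun s => χ s ^ (j + 2)) = fun s => (j + 2) * χ s ^ (j + 1) * deriv χ s :=
    funext fun s => (d1 s).deriv
  have d2 : ∀ s, HasDerivAt (fun s => (j + 2) * χ s ^ (j + 1) * deriv χ s)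
      ((j + 2) * ((j + 1) * χ s ^ j * deriv χ s) * deriv χ s
        + (j + 2) * χ s ^ (j + 1) * deriv (deriv χ) s) s := by
    intro s
    have := (((hχ.differentiable (by simp) s).hasDerivAt.pow (j + 1)).const_mul
      ((j : ℝ) + 2)).mul (hχ'.differentiable (by simp) s).hasDerivAt
    refine this.congr_deriv ?_
    push_cast
    rfl
  have small : ∀ s, s < 1 / 2 → deriv χ s = 0 ∧ deriv (deriv χ) s = 0 := by
    intro s hs
    have h1 : χ =ᶠ[𝓝 s] fun _ => 1 := by
      filter_upwards [gt_mem_nhds hs] with t ht using χo t ht.le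
    have h2 := h1.deriv
    refine ⟨by simpa using h2.eq_of_nhds, ?_⟩
    simpa using h2.deriv.eq_of_nhds
  have wle : ∀ s, 1 / 2 ≤ s →
      χ s ^ j ≤ (χ s ^ (j + 2) * Real.smoothTransition (4 * s - 1)) ^ (1 / p) := by
    intro s hs
    rw [Real.smoothTransition.one_of_one_le (by linarith), mul_one, ← Real.rpow_natCast,
      ← Real.rpow_natCast, ← Real.rpow_mul (χ0 s)]
    rcases (χ0 s).eq_or_lt with h | h
    · rw [← h, Real.zero_rpow (by positivity)]
      positivity
    · refine Real.rpow_le_rpow_of_exponent_ge h (χ1 s) ?_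
      push_cast
      rw [mul_one_div]
      exact hj
  have W0 : ∀ s, 0 ≤ (χ s ^ (j + 2) * Real.smoothTransition (4 * s - 1)) ^ (1 / p) := fun s =>
    Real.rpow_nonneg (mul_nonneg (pow_nonneg (χ0 s) _) (Real.smoothTransition.nonneg _)) _
  have D0 : 0 ≤ D := by positivity
  refine ⟨hχ.pow _, ?_, ?_, ?_, ?_, ?_, ?_, ?_, ?_, ?_⟩
  · exact fun s t hst => pow_le_pow_left₀ (χ0 t) (χa hst) _
  · intro s hs
    simp [χo s hs]
  · intro s hs
    simp [χz s hs]
  · exact (hχ.continuous.pow _).mul (Real.smoothTransition.continuous.comp (by fun_prop))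
  · exact fun s => mul_nonneg (pow_nonneg (χ0 s) _) (Real.smoothTransition.nonneg _)
  · exact fun s => mul_le_of_le_one_right (pow_nonneg (χ0 s) _) (Real.smoothTransition.le_one _)
  · intro s hs
    rw [Real.smoothTransition.zero_of_nonpos (by linarith), mul_zero]
  · intro s
    rw [(d1 s).deriv]
    rcases lt_or_ge s (1 / 2) with hs | hs
    · rw [(small s hs).1, mul_zero, abs_zero]
      exact mul_nonneg D0 (W0 s)
    rcases le_or_gt s 1 with hs1 | hs1
    · have h1 := hC₁ s ⟨hs, hs1⟩
      rw [Real.norm_eq_abs] at h1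
      have hpow : χ s ^ (j + 1) ≤ χ s ^ j := pow_le_pow_of_le_one (χ0 s) (χ1 s) (by omega)
      rw [abs_mul, abs_of_nonneg (mul_nonneg (by positivity) (pow_nonneg (χ0 s) _))]
      calc (j + 2) * χ s ^ (j + 1) * |deriv χ s| ≤ (j + 2) * χ s ^ j * C₁ := by
            have := pow_nonneg (χ0 s) j
            gcongr
        _ = ((j + 2) * C₁) * χ s ^ j := by ring
        _ ≤ D * (χ s ^ (j + 2) * Real.smoothTransition (4 * s - 1)) ^ (1 / p) := by
            refine mul_le_mul ?_ (wle s hs) (pow_nonneg (χ0 s) j) D0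
            have : 0 ≤ ((j : ℝ) + 2) * ((j + 1) * (C₁ * C₁) + C₂) := by positivity
            linarith
    · have e : (j + 2) * χ s ^ (j + 1) * deriv χ s = 0 := by
        rw [χz s hs1.le, zero_pow (Nat.succ_ne_zero j), mul_zero, zero_mul]
      rw [e, abs_zero]
      exact mul_nonneg D0 (W0 s)
  · intro s
    rw [e1, (d2 s).deriv]
    rcases lt_or_ge s (1 / 2) with hs | hs
    · rw [(small s hs).1, (small s hs).2, mul_zero, mul_zero, add_zero, abs_zero]
      exact mul_nonneg D0 (W0 s)
    rcases le_or_gt s 1 with hs1 | hs1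
    · have h1 := hC₁ s ⟨hs, hs1⟩
      have h2 := hC₂ s ⟨hs, hs1⟩
      rw [Real.norm_eq_abs] at h1 h2
      have hpow : χ s ^ (j + 1) ≤ χ s ^ j := pow_le_pow_of_le_one (χ0 s) (χ1 s) (by omega)
      have hj0 := pow_nonneg (χ0 s) j
      have hj1 := pow_nonneg (χ0 s) (j + 1)
      have t1 : |(j + 2) * ((j + 1) * χ s ^ j * deriv χ s) * deriv χ s|
          ≤ (j + 2) * ((j + 1) * χ s ^ j * C₁) * C₁ := by
        rw [abs_mul, abs_mul, abs_mul, abs_of_nonneg (show (0 : ℝ) ≤ j + 2 by positivity),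
          abs_of_nonneg (show (0 : ℝ) ≤ (j + 1) * χ s ^ j by positivity)]
        gcongr
      have t2 : |(j + 2) * χ s ^ (j + 1) * deriv (deriv χ) s| ≤ (j + 2) * χ s ^ j * C₂ := by
        rw [abs_mul, abs_of_nonneg (show (0 : ℝ) ≤ (j + 2) * χ s ^ (j + 1) by positivity)]
        gcongr
      calc _ ≤ _ := abs_add_le _ _
        _ ≤ _ := add_le_add t1 t2
        _ = ((j + 2) * ((j + 1) * (C₁ * C₁) + C₂)) * χ s ^ j := by ring
        _ ≤ D * (χ s ^ (j + 2) * Real.smoothTransition (4 * s - 1)) ^ (1 / p) := by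
            refine mul_le_mul ?_ (wle s hs) (pow_nonneg (χ0 s) j) D0
            have : 0 ≤ ((j : ℝ) + 2) * C₁ := by positivity
            linarith
    · have hj' : j ≠ 0 := by omega
      have e : (j + 2) * ((j + 1) * χ s ^ j * deriv χ s) * deriv χ s
          + (j + 2) * χ s ^ (j + 1) * deriv (deriv χ) s = 0 := by
        rw [χz s hs1.le, zero_pow hj', zero_pow (Nat.succ_ne_zero j)]
        ring
      rw [e, abs_zero]
      exact mul_nonneg D0 (W0 s)

/-! ### Conjugate waves and the cut-off inequality -/

section

variable {n : ℕ} {μ β p ε T M : ℝ} {f : H1 n} {g : L2 n} {u : ℝ → H1 n}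

/-- The positive solution `e^{-λ t} φ_λ(x)` of the conjugate damped wave equation. -/
def conjugateWave (n : ℕ) (μ β l : ℝ) (z : ℝ × Space n) : ℝ :=
  Real.exp (-(l * z.1)) * eigenfunction n μ β l z.2

/-- The time factor `η(t / M) e^{-λ t}`, cut off smoothly for `t ≤ -1` to have compact support. -/
def timeFactor (η : ℝ → ℝ) (M l t : ℝ) : ℝ :=
  Real.smoothTransition (t + 2) * (η (t / M) * Real.exp (-(l * t)))

section timeFactor

variable {C l : ℝ} {η θ : ℝ → ℝ}

theorem contDiff_timeFactor (h : IsCutoffPair p C η θ) (M l : ℝ) :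
    ContDiff ℝ ∞ (timeFactor η M l) := by
  unfold timeFactor
  have h1 : ContDiff ℝ ∞ fun t : ℝ => η (t / M) := h.contDiff.comp (by fun_prop)
  have h2 : ContDiff ℝ ∞ fun t : ℝ => Real.smoothTransition (t + 2) :=
    Real.smoothTransition.contDiff.comp (by fun_prop)
  have h3 : ContDiff ℝ ∞ fun t : ℝ => Real.exp (-(l * t)) := by fun_prop
  exact h2.mul (h1.mul h3)

theorem tsupport_timeFactor_subset (h : IsCutoffPair p C η θ) (hM : 0 < M) (l : ℝ) :
    tsupport (timeFactor η M l) ⊆ Icc (-2) M := by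
  refine closure_minimal (fun t ht => ?_) isClosed_Icc
  rw [Function.mem_support] at ht
  constructor
  · by_contra hlt
    apply ht
    rw [timeFactor, Real.smoothTransition.zero_of_nonpos (by linarith), zero_mul]
  · by_contra hlt
    apply ht
    rw [timeFactor, h.eq_zero _ (by rw [le_div_iff₀ hM]; linarith), zero_mul, mul_zero]

theorem timeFactor_of_neg_one_le {t : ℝ} (ht : -1 ≤ t) :
    timeFactor η M l t = η (t / M) * Real.exp (-(l * t)) := by
  rw [timeFactor, Real.smoothTransition.one_of_one_le (by linarith), one_mul]

theorem deriv_timeFactor (h : IsCutoffPair p C η θ) {t : ℝ} (ht : -1 < t) :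
    deriv (timeFactor η M l) t
      = (deriv η (t / M) / M - l * η (t / M)) * Real.exp (-(l * t)) := by
  have e : timeFactor η M l =ᶠ[𝓝 t] fun t => η (t / M) * Real.exp (-(l * t)) := by
    filter_upwards [lt_mem_nhds ht] with s hs using timeFactor_of_neg_one_le hs.le
  rw [e.deriv_eq]
  have h1 := HasDerivAt.comp t (h := fun t : ℝ => t / M)
    (h.contDiff.differentiable (by simp) (t / M)).hasDerivAt ((hasDerivAt_id t).div_const M)
  have h2 := (((hasDerivAt_id t).const_mul l).neg).exp
  refine (h1.mul h2).deriv.trans ?_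
  simp
  ring

theorem deriv_deriv_timeFactor (h : IsCutoffPair p C η θ) {t : ℝ} (ht : -1 < t) :
    deriv (deriv (timeFactor η M l)) t
      = (deriv (deriv η) (t / M) / M ^ 2 - 2 * l * (deriv η (t / M) / M) + l ^ 2 * η (t / M))
        * Real.exp (-(l * t)) := by
  have e : deriv (timeFactor η M l) =ᶠ[𝓝 t]
      fun t => (deriv η (t / M) / M - l * η (t / M)) * Real.exp (-(l * t)) := by
    filter_upwards [lt_mem_nhds ht] with s hs using deriv_timeFactor h hs
  rw [e.deriv_eq]
  have d := (contDiff_infty_iff_deriv.1 h.contDiff).2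
  have h0 := (hasDerivAt_id t).div_const M
  have h1 := HasDerivAt.comp t (h := fun t : ℝ => t / M)
    (h.contDiff.differentiable (by simp) (t / M)).hasDerivAt h0
  have h1' := HasDerivAt.comp t (h := fun t : ℝ => t / M)
    (d.differentiable (by simp) (t / M)).hasDerivAt h0
  have h2 := (((hasDerivAt_id t).const_mul l).neg).exp
  refine (((h1'.div_const M).sub (h1.const_mul l)).mul h2).deriv.trans ?_
  simp
  ring

end timeFactor

theorem gradient_congr {a b : Space n → ℝ} {x : Space n} (h : a =ᶠ[𝓝 x] b) :
    gradient a =ᶠ[𝓝 x] gradient b := by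
  filter_upwards [h.fderiv (𝕜 := ℝ)] with y hy
  unfold gradient
  rw [hy]

theorem divergence_congr {A B : Space n → Space n} {x : Space n} (h : A =ᶠ[𝓝 x] B) :
    divergence A x = divergence B x := by
  unfold divergence
  rw [h.fderiv_eq]

/-- The support condition, transferred to a jointly measurable representative. -/
theorem ae_support_prod (hMT : M < T)
    (hsupp : ∀ t ∈ Set.Ico 0 T, SupportedInBall (t + 1) (u t).toL2)
    {w : ℝ × Space n → ℝ} (hw : Measurable w)
    (hwu : ∀ t ∈ Icc 0 M, ∀ᵐ x, w (t, x) = (u t).toL2 x) :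
    ∀ᵐ z : ℝ × Space n ∂((volume.restrict (Ioc 0 M)).prod volume),
      z.1 ∈ Ioc 0 M ∧ (z.1 + 1 < ‖z.2‖ → w z = 0) := by
  have hmem : ∀ᵐ z : ℝ × Space n ∂((volume.restrict (Ioc 0 M)).prod volume), z.1 ∈ Ioc 0 M :=
    Measure.quasiMeasurePreserving_fst.ae (ae_restrict_mem measurableSet_Ioc)
  have hs : MeasurableSet {z : ℝ × Space n | z.1 + 1 < ‖z.2‖ → w z = 0} := by
    have h1 : MeasurableSet {z : ℝ × Space n | z.1 + 1 < ‖z.2‖} :=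
      measurableSet_lt (by fun_prop) (by fun_prop)
    have h2 : MeasurableSet {z : ℝ × Space n | w z = 0} := hw (measurableSet_singleton 0)
    exact h1.imp h2
  have h : ∀ᵐ z : ℝ × Space n ∂((volume.restrict (Ioc 0 M)).prod volume),
      z ∈ {z : ℝ × Space n | z.1 + 1 < ‖z.2‖ → w z = 0} := by
    rw [Measure.ae_prod_mem_iff_ae_ae_mem hs]
    filter_upwards [ae_restrict_mem measurableSet_Ioc] with t ht
    filter_upwards [hwu t (Ioc_subset_Icc_self ht),
      hsupp t ⟨ht.1.le, ht.2.trans_lt hMT⟩] with x h1 h2 h3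
    rw [h1]
    exact h2 h3
  filter_upwards [hmem, h] with z h1 h2 using ⟨h1, h2⟩

/-- The basic inequality: testing with a cut-off conjugate wave `η(t/M) e^{-λ t} φ_λ(x)`, only
terms with a derivative on the cut-off survive on the right. -/
theorem IsEnergySolution.cutoff_inequality (hs : IsEnergySolution μ β p ε f g T u) (hn : 2 ≤ n)
    (hp : 0 < p) (hμ : 0 < μ) (hβ : 2 < β) (hε : 0 < ε)
    (hf0 : 0 ≤ f.toL2) (hg0 : 0 ≤ g) (hg1 : SupportedInBall 1 g)
    (hsupp : ∀ t ∈ Set.Ico 0 T, SupportedInBall (t + 1) (u t).toL2)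
    {M₁ : ℝ} (hM : 0 < M) (hMM : M ≤ M₁) (hMT : M₁ < T)
    {w : ℝ × Space n → ℝ} (hw : Measurable w)
    (hwu : ∀ t ∈ Icc 0 M₁, ∀ᵐ x, w (t, x) = (u t).toL2 x)
    {C l : ℝ} {η θ : ℝ → ℝ} (hη : IsCutoffPair p C η θ) (hl : 0 < l) (hl1 : l ≤ 1) :
    ENNReal.ofReal (ε * ∫ x, g x)
      + ∫⁻ z, ENNReal.ofReal (|w z| ^ p * (η (z.1 / M) * conjugateWave n μ β l z))
          ∂((volume.restrict (Ioc 0 M₁)).prod volume)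
      ≤ ∫⁻ z, ENNReal.ofReal (|w z| * (C * θ (z.1 / M) ^ (1 / p)
          * ((1 / M ^ 2 + 2 * l / M + damping μ β z.2 / M) * conjugateWave n μ β l z)))
          ∂((volume.restrict (Ioc 0 M₁)).prod volume) := by
  have hM₁ : 0 < M₁ := hM.trans_le hMM
  set ν := (volume.restrict (Ioc 0 M₁)).prod (volume : Measure (Space n)) with hν
  let χ : ContDiffBump (0 : Space n) := ⟨M₁ + 2, M₁ + 3, by linarith, by linarith⟩
  let φ : Space n → ℝ := eigenfunction n μ β l
  let b : Space n → ℝ := fun x => χ x * φ x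
  let a : ℝ → ℝ := timeFactor η M l
  have φ1 : ∀ x, 1 ≤ φ x := fun x => one_le_profile hn hμ hβ hl hl1 _
  have φc : ContDiff ℝ 2 φ := contDiff_eigenfunction hn hμ hβ hl hl1
  have hb : ContDiff ℝ 2 b := χ.contDiff.mul φc
  have hbc : HasCompactSupport b := χ.hasCompactSupport.mul_right
  have ha : ContDiff ℝ ∞ a := contDiff_timeFactor hη M l
  have hat := tsupport_timeFactor_subset hη hM l
  have hac : HasCompactSupport a :=
    isCompact_Icc.of_isClosed_subset (isClosed_tsupport _) hat
  have haM : tsupport a ⊆ Iic M₁ := fun t ht => (hat ht).2.trans hMM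
  have bφ : ∀ x, ‖x‖ < M₁ + 2 → b =ᶠ[𝓝 x] φ := by
    intro x hx
    filter_upwards [(isOpen_lt continuous_norm continuous_const).mem_nhds hx] with y hy
    have : χ y = 1 := χ.one_of_mem_closedBall (by
      rw [mem_closedBall_zero_iff]
      exact le_of_lt hy)
    simp [b, this]
  have b0 : ∀ x, 0 ≤ b x := fun x => mul_nonneg χ.nonneg (zero_le_one.trans (φ1 x))
  have bf : ∀ x, ‖x‖ ≤ 1 → b x = φ x := fun x hx => (bφ x (by linarith)).eq_of_nhds
  have key := hs.very_weak hp.le hμ.le (by linarith) hM₁ hMT hw hwu ha hac haM hb hbc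
  -- the data terms
  have hf0' : 0 ≤ᵐ[volume] (f.toL2 : Space n → ℝ) := (Lp.coeFn_nonneg _).2 hf0
  have hg0' : 0 ≤ᵐ[volume] (g : Space n → ℝ) := (Lp.coeFn_nonneg _).2 hg0
  have a0 : a 0 = 1 := by
    simp only [a]
    rw [timeFactor_of_neg_one_le (by norm_num)]
    simp [hη.eq_one 0 (by norm_num)]
  have a1 : deriv a 0 = -l := by
    have hd : deriv η 0 = 0 := by
      have : η =ᶠ[𝓝 0] fun _ => 1 := by
        filter_upwards [gt_mem_nhds (show (0 : ℝ) < 1 / 2 by norm_num)] with t ht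
          using hη.eq_one t ht.le
      simpa using this.deriv_eq
    simp only [a]
    rw [deriv_timeFactor hη (by norm_num)]
    simp [hη.eq_one 0 (by norm_num), hd]
  have dg : ∫ x, g x ≤ ∫ x, g x * b x := by
    have i2 : Integrable fun x => g x * b x :=
      ((Lp.memLp g).locallyIntegrable
        (by norm_num)).integrable_smul_right_of_hasCompactSupport hb.continuous hbc
    refine integral_mono_of_nonneg hg0' i2 ?_
    filter_upwards [hg0', hg1] with x h1 h2
    by_cases hx : 1 < ‖x‖
    · simp [h2 hx]
    · rw [bf x (not_lt.1 hx)]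
      exact le_mul_of_one_le_right h1 (φ1 x)
  have df : 0 ≤ ∫ x, f.toL2 x * b x := by
    refine integral_nonneg_of_ae ?_
    filter_upwards [hf0'] with x h1 using mul_nonneg h1 (b0 x)
  have dV : 0 ≤ ∫ x, f.toL2 x * (damping μ β x * b x) := by
    refine integral_nonneg_of_ae ?_
    filter_upwards [hf0'] with x h1 using
      mul_nonneg h1 (mul_nonneg (damping_nonneg hμ.le x) (b0 x))
  rw [a0, a1] at key
  have hle : ε * (∫ x, g x) + ∫ z, |w z| ^ p * (a z.1 * b z.2) ∂ν ≤
      ‖∫ t in Ioc 0 M₁, ∫ x, w (t, x) * (deriv (deriv a) t * b x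
        - a t * divergence (gradient b) x - deriv a t * (damping μ β x * b x))‖ := by
    refine le_trans ?_ (Real.le_norm_self _)
    rw [← key]
    have : ε * (∫ x, g x) ≤ ε * (1 * (∫ x, g x * b x)
        + 1 * (∫ x, f.toL2 x * (damping μ β x * b x)) - -l * ∫ x, f.toL2 x * b x) := by
      refine mul_le_mul_of_nonneg_left ?_ hε.le
      nlinarith
    linarith
  -- pass to lower integrals
  have hae := ae_support_prod (M := M₁) hMT hsupp hw hwu
  have hb0 : ∀ x, M₁ + 3 < ‖x‖ → b x = 0 := by
    intro x hx
    have : χ x = 0 := χ.zero_of_le_dist (by rw [dist_zero_right]; exact hx.le)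
    simp [b, this]
  have ha0 : ∀ t, M₁ < t → a t = 0 := fun t ht => by
    by_contra h
    exact absurd (haM (subset_tsupport a h)) (not_le.2 ht)
  have hint := (integral_nonlinear_eq hs hp.le hM₁ hMT hw hwu ha.continuous ha0
    hb.continuous hb0).1
  have anon : ∀ t, 0 ≤ a t := fun t => mul_nonneg (Real.smoothTransition.nonneg _)
    (mul_nonneg (hη.cutoff_nonneg _) (Real.exp_pos _).le)
  have hN : ∫⁻ z, ENNReal.ofReal (|w z| ^ p * (η (z.1 / M) * conjugateWave n μ β l z)) ∂ν
      = ENNReal.ofReal (∫ z, |w z| ^ p * (a z.1 * b z.2) ∂ν) := by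
    rw [ofReal_integral_eq_lintegral_ofReal hint (Eventually.of_forall fun z =>
      mul_nonneg (Real.rpow_nonneg (abs_nonneg _) _) (mul_nonneg (anon _) (b0 _)))]
    refine lintegral_congr_ae ?_
    filter_upwards [hae] with z hz
    by_cases hx : z.1 + 1 < ‖z.2‖
    · rw [hz.2 hx, abs_zero, Real.zero_rpow hp.ne', zero_mul, zero_mul]
    · have h1 : b z.2 = φ z.2 := (bφ z.2 (by linarith [hz.1.2, not_lt.1 hx])).eq_of_nhds
      simp only [a]
      rw [h1, timeFactor_of_neg_one_le (by linarith [hz.1.1]), conjugateWave, mul_assoc]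
  rw [hN, ← ENNReal.ofReal_add (mul_nonneg hε.le (integral_nonneg_of_ae hg0'))
    (integral_nonneg fun z => mul_nonneg (Real.rpow_nonneg (abs_nonneg _) _)
      (mul_nonneg (anon _) (b0 _)))]
  refine (ENNReal.ofReal_le_ofReal hle).trans ?_
  rw [ofReal_norm]
  have cdda : Continuous (deriv (deriv a)) :=
    (contDiff_infty_iff_deriv.1 ha).2.continuous_deriv (by simp)
  have cL : Continuous (divergence (gradient b)) := by
    unfold divergence
    refine continuous_finsetSum _ fun i _ => ?_
    exact (EuclideanSpace.proj (𝕜 := ℝ) i).continuous.comp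
      (((contDiff_gradient hb).continuous_fderiv (by simp)).clm_apply continuous_const)
  have cb := hb.continuous
  have ca := ha.continuous
  have cda : Continuous (deriv a) := ha.continuous_deriv (by simp)
  have cV := continuous_damping (n := n) μ β
  have hG : Measurable fun z : ℝ × Space n => w z * (deriv (deriv a) z.1 * b z.2
      - a z.1 * divergence (gradient b) z.2 - deriv a z.1 * (damping μ β z.2 * b z.2)) := by
    refine hw.mul (Continuous.measurable ?_)
    fun_prop
  calc _ ≤ ∫⁻ t in Ioc 0 M₁, ‖∫ x, w (t, x) * (deriv (deriv a) t * b x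
        - a t * divergence (gradient b) x - deriv a t * (damping μ β x * b x))‖ₑ :=
        enorm_integral_le_lintegral_enorm _
    _ ≤ ∫⁻ t in Ioc 0 M₁, ∫⁻ x, ‖w (t, x) * (deriv (deriv a) t * b x
        - a t * divergence (gradient b) x - deriv a t * (damping μ β x * b x))‖ₑ :=
        lintegral_mono fun t => enorm_integral_le_lintegral_enorm _
    _ = ∫⁻ z, ‖w z * (deriv (deriv a) z.1 * b z.2
        - a z.1 * divergence (gradient b) z.2 - deriv a z.1 * (damping μ β z.2 * b z.2))‖ₑ ∂ν :=
        (lintegral_prod _ hG.enorm.aemeasurable).symm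
    _ ≤ _ := by
        refine lintegral_mono_ae ?_
        filter_upwards [hae] with z hz
        by_cases hx : z.1 + 1 < ‖z.2‖
        · simp [hz.2 hx]
        have hnear := bφ z.2 (by linarith [hz.1.2, not_lt.1 hx])
        have hLφ : divergence (gradient b) z.2 = (l ^ 2 + l * damping μ β z.2) * φ z.2 := by
          rw [divergence_congr (gradient_congr hnear)]
          exact divergence_gradient_eigenfunction hn hμ hβ hl hl1 z.2
        have ht : -1 < z.1 := by linarith [hz.1.1]
        rw [← ofReal_norm, norm_mul, Real.norm_eq_abs]
        refine ENNReal.ofReal_le_ofReal (mul_le_mul_of_nonneg_left ?_ (abs_nonneg _))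
        simp only [a]
        rw [hLφ, hnear.eq_of_nhds, deriv_deriv_timeFactor hη ht, deriv_timeFactor hη ht,
          timeFactor_of_neg_one_le ht.le, conjugateWave]
        -- the conjugate equation removes all terms without a derivative of the cut-off
        have e : (deriv (deriv η) (z.1 / M) / M ^ 2 - 2 * l * (deriv η (z.1 / M) / M)
              + l ^ 2 * η (z.1 / M)) * Real.exp (-(l * z.1)) * φ z.2
            - η (z.1 / M) * Real.exp (-(l * z.1)) * ((l ^ 2 + l * damping μ β z.2) * φ z.2)
            - (deriv η (z.1 / M) / M - l * η (z.1 / M)) * Real.exp (-(l * z.1))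
              * (damping μ β z.2 * φ z.2)
            = (deriv (deriv η) (z.1 / M) / M ^ 2 - 2 * l / M * deriv η (z.1 / M)
              - damping μ β z.2 / M * deriv η (z.1 / M)) * (Real.exp (-(l * z.1)) * φ z.2) := by
          ring
        rw [e, norm_mul, Real.norm_eq_abs, Real.norm_of_nonneg
          (mul_nonneg (Real.exp_pos _).le (zero_le_one.trans (φ1 _)))]
        have hV := damping_nonneg (β := β) hμ.le z.2
        have h1 := hη.abs_deriv_le (z.1 / M)
        have h2 := hη.abs_deriv_deriv_le (z.1 / M)
        set W := C * θ (z.1 / M) ^ (1 / p)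
        rw [← mul_assoc W]
        refine mul_le_mul_of_nonneg_right ?_
          (mul_nonneg (Real.exp_pos _).le (zero_le_one.trans (φ1 _)))
        calc _ ≤ |deriv (deriv η) (z.1 / M) / M ^ 2| + |2 * l / M * deriv η (z.1 / M)|
              + |damping μ β z.2 / M * deriv η (z.1 / M)| :=
              (abs_sub _ _).trans (add_le_add_left (abs_sub _ _) _)
          _ = |deriv (deriv η) (z.1 / M)| / M ^ 2 + 2 * l / M * |deriv η (z.1 / M)|
              + damping μ β z.2 / M * |deriv η (z.1 / M)| := by
              rw [abs_div, abs_mul, abs_mul, abs_of_pos (show 0 < M ^ 2 by positivity),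
                abs_of_pos (show 0 < 2 * l / M by positivity),
                abs_of_nonneg (show 0 ≤ damping μ β z.2 / M by positivity)]
          _ ≤ W / M ^ 2 + 2 * l / M * W + damping μ β z.2 / M * W := by gcongr
          _ = W * (1 / M ^ 2 + 2 * l / M + damping μ β z.2 / M) := by ring

end

/-! ### Superpositions of conjugate waves -/

section

variable {n : ℕ} {μ β p : ℝ}

/-- The superposition `∫₀¹ λ^{s-1} e^{-λ t} φ_λ(x) dλ` of conjugate waves. -/
def waveSuperposition (n : ℕ) (μ β s : ℝ) (z : ℝ × Space n) : ENNReal :=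
  ∫⁻ l in Ioc (0 : ℝ) 1, ENNReal.ofReal (l ^ (s - 1) * conjugateWave n μ β l z)

theorem measurable_conjugateWave :
    Measurable fun y : ℝ × (ℝ × Space n) => conjugateWave n μ β y.1 y.2 := by
  unfold conjugateWave eigenfunction
  have h1 : Measurable fun y : ℝ × (ℝ × Space n) => Real.exp (-(y.1 * y.2.1)) := by fun_prop
  have h2 : Measurable fun y : ℝ × (ℝ × Space n) => (y.1, ‖y.2.2‖) := by fun_prop
  exact h1.mul (measurable_profile.comp h2)

theorem measurable_superposition_integrand (s : ℝ) :
    Measurable fun y : ℝ × (ℝ × Space n) =>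
      ENNReal.ofReal (y.1 ^ (s - 1) * conjugateWave n μ β y.1 y.2) :=
  ((measurable_fst.pow_const _).mul measurable_conjugateWave).ennreal_ofReal

theorem measurable_waveSuperposition (s : ℝ) :
    Measurable (waveSuperposition n μ β s) :=
  ((measurable_superposition_integrand s).comp measurable_swap).lintegral_prod_right'

theorem one_add_rpow_le_exp {m y : ℝ} (hm : 1 / 2 ≤ m) (hy : 0 ≤ y) :
    (1 + y) ^ m ≤ (2 * m) ^ m * Real.exp (y / 2) := by
  have h1 : 1 + y ≤ 2 * m * Real.exp (y / (2 * m)) := by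
    have h2 := Real.add_one_le_exp (y / (2 * m))
    have h3 : 2 * m * (y / (2 * m)) = y := mul_div_cancel₀ _ (by positivity)
    nlinarith
  calc (1 + y) ^ m ≤ (2 * m * Real.exp (y / (2 * m))) ^ m :=
        Real.rpow_le_rpow (by positivity) h1 (by linarith)
    _ = (2 * m) ^ m * Real.exp (y / 2) := by
        rw [Real.mul_rpow (by positivity) (Real.exp_pos _).le, ← Real.exp_mul]
        congr 2
        field_simp

/-- Inside the light cone, with distance `d = t + 2 - |x|` to its boundary, the conjugate wave is
at most of size `(1 + λ t)^{-(n-1)/2} e^{-λ d / 2}`. -/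
theorem exists_conjugateWave_le (hn : 2 ≤ n) (hμ : 0 < μ) (hβ : 2 < β) :
    ∃ C : ℝ, 0 < C ∧ ∀ (l : ℝ) (z : ℝ × Space n), 0 < l → l ≤ 1 → 0 ≤ z.1 → ‖z.2‖ ≤ z.1 + 1 →
      conjugateWave n μ β l z
        ≤ C * ((1 + l * z.1) ^ (-(((n : ℝ) - 1) / 2))
          * Real.exp (-(l * (z.1 + 2 - ‖z.2‖) / 2))) := by
  have hn' : (2 : ℝ) ≤ n := by exact_mod_cast hn
  set m := ((n : ℝ) - 1) / 2 with hm
  have hm2 : 1 / 2 ≤ m := by rw [hm]; linarith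
  obtain ⟨C, hC, h⟩ := exists_profile_le (n := n) hn hμ hβ
  refine ⟨C * (2 * m) ^ m * Real.exp 2, by positivity, ?_⟩
  rintro l ⟨t, x⟩ hl hl1 ht hx
  simp only at ht hx ⊢
  set r := ‖x‖
  have hr : 0 ≤ r := norm_nonneg x
  set d := t + 2 - r with hd
  have hd1 : 1 ≤ d := by linarith
  have h1 := h l r hl hl1 hr
  have h2 : (1 + l * r) ^ (-m) ≤ (1 + l * t) ^ (-m) * (1 + l * d) ^ m := by
    -- trade the decay in `r` for decay in `t`, at the price of a power of `1 + λ d`, which half of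
    -- `e^{-λ d}` pays for
    have h3 : 1 + l * t ≤ (1 + l * r) * (1 + l * d) := by
      have : 0 ≤ (l * r) * (l * d) := by positivity
      have : l * t ≤ l * r + l * d := by rw [hd]; nlinarith
      nlinarith
    have h4 : ((1 + l * r) * (1 + l * d)) ^ (-m) ≤ (1 + l * t) ^ (-m) :=
      Real.rpow_le_rpow_of_nonpos (by positivity) h3 (by linarith)
    rw [Real.mul_rpow (by positivity) (by positivity)] at h4
    calc (1 + l * r) ^ (-m) = (1 + l * r) ^ (-m) * (1 + l * d) ^ (-m) * (1 + l * d) ^ m := by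
          rw [mul_assoc, ← Real.rpow_add (by positivity), neg_add_cancel, Real.rpow_zero, mul_one]
      _ ≤ _ := by gcongr
  have h5 := one_add_rpow_le_exp hm2 (show 0 ≤ l * d by positivity)
  have h6 : Real.exp (-(l * t)) * Real.exp (l * r) ≤ Real.exp 2 * Real.exp (-(l * d)) := by
    rw [← Real.exp_add, ← Real.exp_add]
    apply Real.exp_le_exp.2
    rw [hd]
    nlinarith
  have h7 : Real.exp (-(l * d)) * Real.exp (l * d / 2) = Real.exp (-(l * d / 2)) := by
    rw [← Real.exp_add]
    congr 1
    ring
  unfold conjugateWave eigenfunction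
  simp only
  calc Real.exp (-(l * t)) * profile n μ β l r
      ≤ Real.exp (-(l * t)) * (C * ((1 + l * r) ^ (-m) * Real.exp (l * r))) := by gcongr
    _ = C * (1 + l * r) ^ (-m) * (Real.exp (-(l * t)) * Real.exp (l * r)) := by ring
    _ ≤ C * ((1 + l * t) ^ (-m) * ((2 * m) ^ m * Real.exp (l * d / 2)))
          * (Real.exp 2 * Real.exp (-(l * d))) := by
        gcongr
        exact h2.trans (by gcongr)
    _ = C * (2 * m) ^ m * Real.exp 2 * ((1 + l * t) ^ (-m)
          * (Real.exp (-(l * d)) * Real.exp (l * d / 2))) := by ring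
    _ = _ := by rw [h7]

/-- A Gamma integral, truncated to `0 < λ ≤ 1`. -/
theorem lintegral_rpow_mul_exp_le {r d : ℝ} (hr : 0 < r) (hd : 0 < d) :
    ∫⁻ l in Ioc (0 : ℝ) 1, ENNReal.ofReal (l ^ (r - 1) * Real.exp (-(l * d / 2)))
      ≤ ENNReal.ofReal (2 ^ r * Real.Gamma r * d ^ (-r)) := by
  have h := Real.integral_rpow_mul_exp_neg_mul_Ioi hr (half_pos hd)
  have hG := Real.Gamma_pos_of_pos hr
  have hpos : 0 < (1 / (d / 2)) ^ r * Real.Gamma r := by positivity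
  have hint : IntegrableOn (fun l : ℝ => l ^ (r - 1) * Real.exp (-(d / 2 * l))) (Ioi 0) := by
    by_contra hni
    rw [integral_undef hni] at h
    exact hpos.ne h
  have h2 := ofReal_integral_eq_lintegral_ofReal hint (by
    filter_upwards [ae_restrict_mem measurableSet_Ioi] with l hl
    exact mul_nonneg (Real.rpow_nonneg (le_of_lt hl) _) (Real.exp_pos _).le)
  rw [h] at h2
  have e : 2 ^ r * Real.Gamma r * d ^ (-r) = (1 / (d / 2)) ^ r * Real.Gamma r := by
    rw [one_div_div, Real.div_rpow (by norm_num) hd.le, Real.rpow_neg hd.le]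
    ring
  rw [e, h2]
  refine (lintegral_mono_set Ioc_subset_Ioi_self).trans (le_of_eq ?_)
  refine lintegral_congr fun l => ?_
  congr 3
  ring

/-- Bound for the superposition of order above `(n - 1) / 2`: it decays in the distance to the
light cone. -/
theorem exists_waveSuperposition_succ_le (hn : 2 ≤ n) (hμ : 0 < μ) (hβ : 2 < β) (hp : 1 < p) :
    ∃ C : ℝ, 0 < C ∧ ∀ z : ℝ × Space n, 0 < z.1 → ‖z.2‖ ≤ z.1 + 1 →
      waveSuperposition n μ β (((n : ℝ) - 1) / 2 - 1 / p + 1) z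
        ≤ ENNReal.ofReal (C * (z.1 ^ (-(((n : ℝ) - 1) / 2))
            * (z.1 + 2 - ‖z.2‖) ^ (-(1 - 1 / p)))) := by
  have hn' : (2 : ℝ) ≤ n := by exact_mod_cast hn
  have hr : 0 < 1 - 1 / p := by
    have : 1 / p < 1 := by rw [div_lt_one (by linarith)]; exact hp
    linarith
  obtain ⟨C, hC, h⟩ := exists_conjugateWave_le (n := n) hn hμ hβ
  have hG := Real.Gamma_pos_of_pos hr
  refine ⟨C * (2 ^ (1 - 1 / p) * Real.Gamma (1 - 1 / p)), by positivity, ?_⟩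
  intro z ht hx
  set m := ((n : ℝ) - 1) / 2 with hm
  have hd : 0 < z.1 + 2 - ‖z.2‖ := by linarith
  calc waveSuperposition n μ β (m - 1 / p + 1) z
      ≤ ∫⁻ l in Ioc (0 : ℝ) 1, ENNReal.ofReal (C * z.1 ^ (-m))
          * ENNReal.ofReal (l ^ ((1 - 1 / p) - 1)
            * Real.exp (-(l * (z.1 + 2 - ‖z.2‖) / 2))) := by
        refine setLIntegral_mono' measurableSet_Ioc fun l hl => ?_
        rw [← ENNReal.ofReal_mul (by positivity)]
        refine ENNReal.ofReal_le_ofReal ?_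
        have h1 := h l z hl.1 hl.2 ht.le hx
        have h2 : (1 + l * z.1) ^ (-m) ≤ l ^ (-m) * z.1 ^ (-m) := by
          rw [← Real.mul_rpow hl.1.le ht.le]
          exact Real.rpow_le_rpow_of_nonpos (mul_pos hl.1 ht) (by linarith)
            (by rw [hm]; linarith)
        have h3 : 0 ≤ l ^ (m - 1 / p + 1 - 1) := Real.rpow_nonneg hl.1.le _
        have h4 : l ^ (m - 1 / p + 1 - 1) * l ^ (-m) = l ^ ((1 - 1 / p) - 1) := by
          rw [← Real.rpow_add hl.1]
          congr 1
          ring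
        calc l ^ (m - 1 / p + 1 - 1) * conjugateWave n μ β l z
            ≤ l ^ (m - 1 / p + 1 - 1) * (C * ((l ^ (-m) * z.1 ^ (-m))
              * Real.exp (-(l * (z.1 + 2 - ‖z.2‖) / 2)))) := by
              refine mul_le_mul_of_nonneg_left (h1.trans ?_) h3
              gcongr
          _ = C * z.1 ^ (-m) * ((l ^ (m - 1 / p + 1 - 1) * l ^ (-m))
              * Real.exp (-(l * (z.1 + 2 - ‖z.2‖) / 2))) := by ring
          _ = _ := by rw [h4]
    _ = ENNReal.ofReal (C * z.1 ^ (-m)) * ∫⁻ l in Ioc (0 : ℝ) 1,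
          ENNReal.ofReal (l ^ ((1 - 1 / p) - 1)
            * Real.exp (-(l * (z.1 + 2 - ‖z.2‖) / 2))) :=
        lintegral_const_mul' _ _ ENNReal.ofReal_ne_top
    _ ≤ ENNReal.ofReal (C * z.1 ^ (-m)) * ENNReal.ofReal (2 ^ (1 - 1 / p)
          * Real.Gamma (1 - 1 / p) * (z.1 + 2 - ‖z.2‖) ^ (-(1 - 1 / p))) := by
        gcongr
        exact lintegral_rpow_mul_exp_le hr hd
    _ = _ := by
        rw [← ENNReal.ofReal_mul (by positivity)]
        congr 1
        ring

theorem lintegral_rpow_Ioc {a T : ℝ} (ha : 0 < a) (hT : 0 ≤ T) :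
    ∫⁻ l in Ioc 0 T, ENNReal.ofReal (l ^ (a - 1)) = ENNReal.ofReal (T ^ a / a) := by
  have h1 : IntervalIntegrable (fun l : ℝ => l ^ (a - 1)) volume 0 T :=
    intervalIntegral.intervalIntegrable_rpow' (by linarith)
  rw [← ofReal_integral_eq_lintegral_ofReal
    ((intervalIntegrable_iff_integrableOn_Ioc_of_le hT).1 h1) (by
      filter_upwards [ae_restrict_mem measurableSet_Ioc] with l hl
      exact Real.rpow_nonneg hl.1.le _), ← intervalIntegral.integral_of_le hT,
    integral_rpow (Or.inl (by linarith))]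
  simp [Real.zero_rpow ha.ne']

/-- Bound for the superposition of order `s < (n - 1) / 2`: it is of size `t^{-s}`. -/
theorem exists_waveSuperposition_le (hn : 2 ≤ n) (hμ : 0 < μ) (hβ : 2 < β) {s : ℝ} (hs : 0 < s)
    (hsm : s < ((n : ℝ) - 1) / 2) :
    ∃ C : ℝ, 0 < C ∧ ∀ z : ℝ × Space n, 0 < z.1 → ‖z.2‖ ≤ z.1 + 1 →
      waveSuperposition n μ β s z ≤ ENNReal.ofReal (C * z.1 ^ (-s)) := by
  obtain ⟨C, hC, h⟩ := exists_conjugateWave_le (n := n) hn hμ hβ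
  set m := ((n : ℝ) - 1) / 2 with hm
  have hms : 0 < m - s := by linarith
  refine ⟨C * (1 / s + 1 / (m - s)), by positivity, ?_⟩
  intro z ht hx
  set t := z.1
  have hd : 0 < t + 2 - ‖z.2‖ := by linarith
  have base : ∀ l ∈ Ioc (0 : ℝ) 1, l ^ (s - 1) * conjugateWave n μ β l z
      ≤ C * (l ^ (s - 1) * (1 + l * t) ^ (-m)) := by
    intro l hl
    have h1 := h l z hl.1 hl.2 ht.le hx
    have h2 : Real.exp (-(l * (z.1 + 2 - ‖z.2‖) / 2)) ≤ 1 := by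
      rw [Real.exp_le_one_iff]
      have := mul_pos hl.1 hd
      linarith
    have h3 : 0 ≤ l ^ (s - 1) := Real.rpow_nonneg hl.1.le _
    have h4 : 0 ≤ (1 + l * t) ^ (-m) :=
      Real.rpow_nonneg (by have := mul_pos hl.1 ht; linarith) _
    calc l ^ (s - 1) * conjugateWave n μ β l z
        ≤ l ^ (s - 1) * (C * ((1 + l * t) ^ (-m) * 1)) := by
          refine mul_le_mul_of_nonneg_left (h1.trans ?_) h3
          gcongr
      _ = _ := by ring
  -- frequencies below and above `1 / t`
  have low : ∫⁻ l in Ioc 0 t⁻¹, ENNReal.ofReal (l ^ (s - 1) * (1 + l * t) ^ (-m))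
      ≤ ENNReal.ofReal (t ^ (-s) / s) := by
    have e := lintegral_rpow_Ioc hs (inv_pos.2 ht).le
    rw [Real.inv_rpow ht.le, ← Real.rpow_neg ht.le] at e
    rw [← e]
    refine setLIntegral_mono' measurableSet_Ioc fun l hl => ENNReal.ofReal_le_ofReal ?_
    refine mul_le_of_le_one_right (Real.rpow_nonneg hl.1.le _) ?_
    exact Real.rpow_le_one_of_one_le_of_nonpos (by have := mul_pos hl.1 ht; linarith)
      (by linarith)
  have high : ∫⁻ l in Ioi t⁻¹, ENNReal.ofReal (l ^ (s - 1) * (1 + l * t) ^ (-m))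
      ≤ ENNReal.ofReal (t ^ (-s) / (m - s)) := by
    have hti := inv_pos.2 ht
    have hlt : s - 1 - m < -1 := by linarith
    have e := ofReal_integral_eq_lintegral_ofReal (integrableOn_Ioi_rpow_of_lt hlt hti) (by
      filter_upwards [ae_restrict_mem measurableSet_Ioi] with l hl
      exact Real.rpow_nonneg (hti.trans hl).le _)
    rw [integral_Ioi_rpow_of_lt hlt hti] at e
    calc ∫⁻ l in Ioi t⁻¹, ENNReal.ofReal (l ^ (s - 1) * (1 + l * t) ^ (-m))
        ≤ ∫⁻ l in Ioi t⁻¹, ENNReal.ofReal (t ^ (-m)) * ENNReal.ofReal (l ^ (s - 1 - m)) := by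
          refine setLIntegral_mono' measurableSet_Ioi fun l hl => ?_
          have hl0 : 0 < l := hti.trans hl
          rw [← ENNReal.ofReal_mul (by positivity)]
          refine ENNReal.ofReal_le_ofReal ?_
          have h2 : (1 + l * t) ^ (-m) ≤ l ^ (-m) * t ^ (-m) := by
            rw [← Real.mul_rpow hl0.le ht.le]
            exact Real.rpow_le_rpow_of_nonpos (mul_pos hl0 ht) (by linarith) (by linarith)
          calc l ^ (s - 1) * (1 + l * t) ^ (-m) ≤ l ^ (s - 1) * (l ^ (-m) * t ^ (-m)) := by gcongr
            _ = t ^ (-m) * (l ^ (s - 1) * l ^ (-m)) := by ring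
            _ = _ := by rw [← Real.rpow_add hl0, ← sub_eq_add_neg]
      _ = ENNReal.ofReal (t ^ (-m)) * ∫⁻ l in Ioi t⁻¹, ENNReal.ofReal (l ^ (s - 1 - m)) :=
          lintegral_const_mul' _ _ ENNReal.ofReal_ne_top
      _ = ENNReal.ofReal (t ^ (-s) / (m - s)) := by
          rw [← e, ← ENNReal.ofReal_mul (by positivity)]
          congr 1
          rw [Real.inv_rpow ht.le, ← Real.rpow_neg ht.le,
            show -(s - 1 - m + 1) = m - s by ring, show s - 1 - m + 1 = -(m - s) by ring,
            neg_div_neg_eq, ← mul_div_assoc, ← Real.rpow_add ht]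
          congr 2
          ring
      _ ≤ _ := le_rfl
  calc waveSuperposition n μ β s z
      ≤ ∫⁻ l in Ioc (0 : ℝ) 1, ENNReal.ofReal C
          * ENNReal.ofReal (l ^ (s - 1) * (1 + l * t) ^ (-m)) := by
        refine setLIntegral_mono' measurableSet_Ioc fun l hl => ?_
        rw [← ENNReal.ofReal_mul hC.le]
        exact ENNReal.ofReal_le_ofReal (base l hl)
    _ = ENNReal.ofReal C * ∫⁻ l in Ioc (0 : ℝ) 1,
          ENNReal.ofReal (l ^ (s - 1) * (1 + l * t) ^ (-m)) :=
        lintegral_const_mul' _ _ ENNReal.ofReal_ne_top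
    _ ≤ ENNReal.ofReal C * (ENNReal.ofReal (t ^ (-s) / s)
          + ENNReal.ofReal (t ^ (-s) / (m - s))) := by
        gcongr
        have hsub : Ioc (0 : ℝ) 1 ⊆ Ioc 0 t⁻¹ ∪ Ioi t⁻¹ := fun l hl => by
          rcases le_or_gt l t⁻¹ with h | h
          · exact Or.inl ⟨hl.1, h⟩
          · exact Or.inr h
        exact (lintegral_mono_set hsub).trans ((lintegral_union_le _ _ _).trans
          (add_le_add low high))
    _ = _ := by
        rw [← ENNReal.ofReal_add (by positivity) (by positivity), ← ENNReal.ofReal_mul hC.le]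
        congr 1
        ring

/-- Lower bound for the superposition, from the frequencies `λ ∼ 1 / M`. -/
theorem exists_le_waveSuperposition (hn : 2 ≤ n) (hμ : 0 < μ) (hβ : 2 < β) {s : ℝ} (hs : 0 < s) :
    ∃ c : ℝ, 0 < c ∧ ∀ (M : ℝ) (z : ℝ × Space n), 1 ≤ M → z.1 ≤ M →
      ENNReal.ofReal (c * M ^ (-s)) ≤ waveSuperposition n μ β s z := by
  refine ⟨Real.exp (-1) * 2 ^ (-s) / 2, by positivity, ?_⟩
  intro M z hM hz
  have hM0 : 0 < M := by linarith
  -- on these frequencies `λ t ≤ 1`, so the conjugate wave is at least `e^{-1}`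
  have hsub : Ioc (1 / (2 * M)) (1 / M) ⊆ Ioc (0 : ℝ) 1 := fun l hl =>
    ⟨lt_trans (by positivity) hl.1, hl.2.trans (by rw [div_le_one hM0]; exact hM)⟩
  refine le_trans ?_ (lintegral_mono_set hsub)
  calc ENNReal.ofReal (Real.exp (-1) * 2 ^ (-s) / 2 * M ^ (-s))
      = ENNReal.ofReal ((1 / (2 * M)) ^ s * M * Real.exp (-1))
          * volume (Ioc (1 / (2 * M)) (1 / M)) := by
        rw [Real.volume_Ioc, ← ENNReal.ofReal_mul (by positivity)]
        congr 1
        rw [one_div, Real.inv_rpow (by positivity), Real.mul_rpow (by norm_num) hM0.le,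
          Real.rpow_neg (by norm_num), Real.rpow_neg hM0.le]
        field_simp
        norm_num
    _ = ∫⁻ l in Ioc (1 / (2 * M)) (1 / M),
          ENNReal.ofReal ((1 / (2 * M)) ^ s * M * Real.exp (-1)) := (setLIntegral_const _ _).symm
    _ ≤ _ := by
        refine setLIntegral_mono' measurableSet_Ioc fun l hl => ENNReal.ofReal_le_ofReal ?_
        have hl0 := (hsub hl).1
        have h1 : (1 / (2 * M)) ^ s * M ≤ l ^ (s - 1) := by
          rw [Real.rpow_sub_one hl0.ne']
          have a1 : (1 / (2 * M)) ^ s ≤ l ^ s :=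
            Real.rpow_le_rpow (by positivity) hl.1.le hs.le
          have a2 : M ≤ l⁻¹ := by
            rw [le_inv_comm₀ hM0 hl0, ← one_div]
            exact hl.2
          rw [div_eq_mul_inv (l ^ s)]
          exact mul_le_mul a1 a2 hM0.le (Real.rpow_nonneg hl0.le _)
        have h2 : Real.exp (-1) ≤ conjugateWave n μ β l z := by
          unfold conjugateWave
          have h3 := one_le_profile hn hμ hβ hl0 (hsub hl).2 ‖z.2‖
          have h4 : Real.exp (-1) ≤ Real.exp (-(l * z.1)) := by
            apply Real.exp_le_exp.2
            have h5 : l * M ≤ 1 := by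
              have := hl.2
              rwa [le_div_iff₀ hM0] at this
            nlinarith
          exact h4.trans (le_mul_of_one_le_right (Real.exp_pos _).le h3)
        exact mul_le_mul h1 h2 (Real.exp_pos _).le (Real.rpow_nonneg hl0.le _)

end

/-! ### Integrals over slabs of the light cone -/

section

variable {n : ℕ} {μ β p : ℝ}

/-- Polar coordinates for a radial function with values in `[0, ∞]`. -/
theorem lintegral_fun_norm (hn : 2 ≤ n) {F : ℝ → ENNReal} (hF : Measurable F) :
    ∫⁻ x : Space n, F ‖x‖ = (volume : Measure (Space n)).toSphere univ
      * ∫⁻ r in Ioi (0 : ℝ), ENNReal.ofReal (r ^ (n - 1)) * F r := by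
  have : Nontrivial (Space n) := by
    have : Nonempty (Fin n) := ⟨⟨0, by omega⟩⟩
    infer_instance
  have hdim : Module.finrank ℝ (Space n) = n := finrank_euclideanSpace_fin
  calc ∫⁻ x : Space n, F ‖x‖
      = ∫⁻ x : ({(0)}ᶜ : Set (Space n)), F ‖x.1‖ ∂(volume.comap Subtype.val) := by
        rw [lintegral_subtype_comap (measurableSet_singleton _).compl fun x : Space n => F ‖x‖,
          restrict_compl_singleton]
    _ = ∫⁻ x, F x.2 ∂(volume : Measure (Space n)).toSphere.prod (.volumeIoiPow (n - 1)) := by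
        have h := (volume : Measure (Space n)).measurePreserving_homeomorphUnitSphereProd
        rw [hdim] at h
        rw [← h.lintegral_comp_emb (Homeomorph.measurableEmbedding _)
          (fun y : Metric.sphere (0 : Space n) 1 × Ioi (0 : ℝ) => F y.2)]
        simp
    _ = (volume : Measure (Space n)).toSphere univ
          * ∫⁻ x : Ioi (0 : ℝ), F x ∂.volumeIoiPow (n - 1) := by
        have hm : Measurable fun x : Ioi (0 : ℝ) => F x := hF.comp measurable_subtype_coe
        have hm2 : AEMeasurable
            (fun x : Metric.sphere (0 : Space n) 1 × Ioi (0 : ℝ) => F x.2)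
            ((volume : Measure (Space n)).toSphere.prod (.volumeIoiPow (n - 1))) :=
          (hm.comp measurable_snd).aemeasurable
        rw [lintegral_prod _ hm2]
        dsimp only
        rw [lintegral_const, mul_comm]
    _ = _ := by
        have hm : Measurable fun x : Ioi (0 : ℝ) => F x := hF.comp measurable_subtype_coe
        rw [Measure.volumeIoiPow, lintegral_withDensity_eq_lintegral_mul _
          (by fun_prop) hm]
        congr 1
        exact lintegral_subtype_comap measurableSet_Ioi
          fun r : ℝ => ENNReal.ofReal (r ^ (n - 1)) * F r

/-- The part of the forward cone `|x| ≤ t + 1` in the time slab `M / 4 ≤ t ≤ M`. -/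
def coneSlab (n : ℕ) (M : ℝ) : Set (ℝ × Space n) :=
  {z | z.1 ∈ Icc (M / 4) M ∧ ‖z.2‖ ≤ z.1 + 1}

theorem measurableSet_coneSlab (M : ℝ) : MeasurableSet (coneSlab n M) := by
  apply MeasurableSet.inter
  · exact measurable_fst measurableSet_Icc
  · exact measurableSet_le (measurable_snd.norm) (measurable_fst.add_const 1)

/-- A bound for the integrals of a radial function over the time slices of the cone gives a bound
for its integral over a slab. -/
theorem lintegral_coneSlab_le (hn : 2 ≤ n) {G : ℝ → ℝ → ℝ}
    (hG : Measurable (Function.uncurry G)) {M K : ℝ} (M₁ : ℝ) (hM : 0 < M)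
    (h : ∀ t ∈ Icc (M / 4) M,
      ∫⁻ r in Ioc 0 (t + 1), ENNReal.ofReal (r ^ (n - 1) * G t r) ≤ ENNReal.ofReal K) :
    ∫⁻ z in coneSlab n M, ENNReal.ofReal (G z.1 ‖z.2‖)
        ∂((volume.restrict (Ioc 0 M₁)).prod volume)
      ≤ ENNReal.ofReal (((volume : Measure (Space n)).toSphere univ).toReal * K * M) := by
  set σ := (volume : Measure (Space n)).toSphere univ with hσ
  have hσt : σ ≠ ⊤ := measure_ne_top _ _
  have hGm : Measurable fun z : ℝ × Space n => ENNReal.ofReal (G z.1 ‖z.2‖) := by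
    have : Measurable fun z : ℝ × Space n => (z.1, ‖z.2‖) := by fun_prop
    exact (hG.comp this).ennreal_ofReal
  have slice : ∀ t ∈ Icc (M / 4) M,
      ∫⁻ x, (coneSlab n M).indicator (fun z => ENNReal.ofReal (G z.1 ‖z.2‖)) (t, x)
        ≤ σ * ENNReal.ofReal K := by
    intro t ht
    have hGt : Measurable fun r => ENNReal.ofReal (G t r) := by
      have : Measurable fun r : ℝ => (t, r) := by fun_prop
      exact (hG.comp this).ennreal_ofReal
    have e1 : ∀ x : Space n,
        (coneSlab n M).indicator (fun z => ENNReal.ofReal (G z.1 ‖z.2‖)) (t, x)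
          = (Iic (t + 1)).indicator (fun r => ENNReal.ofReal (G t r)) ‖x‖ := by
      intro x
      by_cases hx : ‖x‖ ≤ t + 1
      · rw [indicator_of_mem (show (t, x) ∈ coneSlab n M from ⟨ht, hx⟩),
          indicator_of_mem (show ‖x‖ ∈ Iic (t + 1) from hx)]
      · rw [indicator_of_notMem (fun hz : (t, x) ∈ coneSlab n M => hx hz.2),
          indicator_of_notMem (fun hz : ‖x‖ ∈ Iic (t + 1) => hx hz)]
    simp_rw [e1]
    rw [lintegral_fun_norm hn (hGt.indicator measurableSet_Iic)]
    refine mul_le_mul_right ?_ _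
    calc ∫⁻ r in Ioi (0 : ℝ), ENNReal.ofReal (r ^ (n - 1))
          * (Iic (t + 1)).indicator (fun r => ENNReal.ofReal (G t r)) r
        = ∫⁻ r in Ioi (0 : ℝ), (Iic (t + 1)).indicator
            (fun r => ENNReal.ofReal (r ^ (n - 1)) * ENNReal.ofReal (G t r)) r := by
          refine lintegral_congr fun r => ?_
          by_cases hr : r ∈ Iic (t + 1) <;> simp [hr]
      _ = ∫⁻ r in Ioc 0 (t + 1), ENNReal.ofReal (r ^ (n - 1)) * ENNReal.ofReal (G t r) := by
          rw [lintegral_indicator measurableSet_Iic, Measure.restrict_restrict measurableSet_Iic,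
            inter_comm, Ioi_inter_Iic]
      _ = ∫⁻ r in Ioc 0 (t + 1), ENNReal.ofReal (r ^ (n - 1) * G t r) := by
          refine setLIntegral_congr_fun measurableSet_Ioc fun r hr => ?_
          exact (ENNReal.ofReal_mul (pow_nonneg hr.1.le _)).symm
      _ ≤ _ := h t ht
  calc ∫⁻ z in coneSlab n M, ENNReal.ofReal (G z.1 ‖z.2‖)
        ∂((volume.restrict (Ioc 0 M₁)).prod volume)
      = ∫⁻ t in Ioc 0 M₁, ∫⁻ x,
          (coneSlab n M).indicator (fun z => ENNReal.ofReal (G z.1 ‖z.2‖)) (t, x) := by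
        rw [← lintegral_indicator (measurableSet_coneSlab M),
          lintegral_prod _ (hGm.indicator (measurableSet_coneSlab M)).aemeasurable]
    _ ≤ ∫⁻ t in Ioc 0 M₁, (Icc (M / 4) M).indicator (fun _ => σ * ENNReal.ofReal K) t := by
        refine lintegral_mono fun t => ?_
        by_cases ht : t ∈ Icc (M / 4) M
        · rw [indicator_of_mem ht]
          exact slice t ht
        · rw [indicator_of_notMem ht]
          refine le_of_eq (lintegral_eq_zero_of_ae_eq_zero (Eventually.of_forall fun x => ?_))
          exact indicator_of_notMem (fun hz : (t, x) ∈ coneSlab n M => ht hz.1) _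
    _ ≤ ∫⁻ t, (Icc (M / 4) M).indicator (fun _ => σ * ENNReal.ofReal K) t :=
        setLIntegral_le_lintegral _ _
    _ = σ * ENNReal.ofReal K * ENNReal.ofReal (M - M / 4) := by
        rw [lintegral_indicator measurableSet_Icc, setLIntegral_const, Real.volume_Icc]
    _ ≤ σ * ENNReal.ofReal K * ENNReal.ofReal M := by
        gcongr
        linarith
    _ = _ := by
        rw [ENNReal.ofReal_mul' hM.le, ENNReal.ofReal_mul ENNReal.toReal_nonneg,
          ENNReal.ofReal_toReal hσt]

/-- The fundamental theorem of calculus for a nonnegative integrand, as a lower integral. -/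
theorem lintegral_Ioc_eq_sub {F G : ℝ → ℝ} {R : ℝ} (hR : 0 ≤ R)
    (hF : ∀ r ∈ Icc 0 R, HasDerivAt F (G r) r) (hG : ContinuousOn G (Icc 0 R))
    (hG0 : ∀ r ∈ Icc 0 R, 0 ≤ G r) :
    ∫⁻ r in Ioc 0 R, ENNReal.ofReal (G r) = ENNReal.ofReal (F R - F 0) := by
  have hi : IntervalIntegrable G volume 0 R :=
    ContinuousOn.intervalIntegrable (by rwa [uIcc_of_le hR])
  rw [← ofReal_integral_eq_lintegral_ofReal hi.1, ← intervalIntegral.integral_of_le hR,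
    intervalIntegral.integral_eq_sub_of_hasDerivAt (by rwa [uIcc_of_le hR]) hi]
  exact (ae_restrict_iff' measurableSet_Ioc).2
    (Eventually.of_forall fun r hr => hG0 r (Ioc_subset_Icc_self hr))

/-- `∫_E d⁻¹ ≲ M^n log M` over the slab `E`, where `d = t + 2 - |x|`. -/
theorem exists_lintegral_inv_dist_le (hn : 2 ≤ n) :
    ∃ C : ℝ, 0 < C ∧ ∀ M M₁ : ℝ, 4 ≤ M →
      ∫⁻ z in coneSlab n M, ENNReal.ofReal ((z.1 + 2 - ‖z.2‖)⁻¹)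
          ∂((volume.restrict (Ioc 0 M₁)).prod volume)
        ≤ ENNReal.ofReal (C * (M ^ n * Real.log M)) := by
  set σ := ((volume : Measure (Space n)).toSphere univ).toReal
  have hσ : 0 ≤ σ := ENNReal.toReal_nonneg
  refine ⟨σ * (2 ^ (n - 1) * 2) + 1, by positivity, fun M M₁ hM => ?_⟩
  have hM0 : 0 < M := by linarith
  have hlog : 0 < Real.log M := Real.log_pos (by linarith)
  refine (lintegral_coneSlab_le (K := (2 * M) ^ (n - 1) * (2 * Real.log M)) hn
    (G := fun t r => (t + 2 - r)⁻¹) (by unfold Function.uncurry; fun_prop) M₁ hM0 ?_).trans ?_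
  · rintro t ⟨ht1, ht2⟩
    have ht : 0 < t := by linarith
    have h1 : ∫⁻ r in Ioc 0 (t + 1), ENNReal.ofReal ((t + 2 - r)⁻¹)
        = ENNReal.ofReal (-Real.log (t + 2 - (t + 1)) - -Real.log (t + 2 - 0)) := by
      refine lintegral_Ioc_eq_sub (F := fun r => -Real.log (t + 2 - r)) (by linarith) ?_ ?_ ?_
      · rintro r ⟨hr0, hr⟩
        have h2 : HasDerivAt (fun r => t + 2 - r) (-1) r := by
          simpa using (hasDerivAt_id r).const_sub (t + 2)
        have h3 := (h2.log (by linarith)).neg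
        rwa [← neg_div, neg_neg, one_div] at h3
      · exact ContinuousOn.inv₀ (by fun_prop) fun r hr => by have := hr.2; linarith
      · rintro r ⟨hr0, hr⟩
        have : 0 < t + 2 - r := by linarith
        positivity
    calc ∫⁻ r in Ioc 0 (t + 1), ENNReal.ofReal (r ^ (n - 1) * (t + 2 - r)⁻¹)
        ≤ ∫⁻ r in Ioc 0 (t + 1), ENNReal.ofReal ((2 * M) ^ (n - 1))
            * ENNReal.ofReal ((t + 2 - r)⁻¹) := by
          refine setLIntegral_mono' measurableSet_Ioc fun r hr => ?_
          rw [← ENNReal.ofReal_mul (by positivity)]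
          have h4 : 0 < t + 2 - r := by have := hr.2; linarith
          have h5 : r ≤ 2 * M := by have := hr.2; linarith
          have h6 := hr.1.le
          gcongr
      _ = ENNReal.ofReal ((2 * M) ^ (n - 1) * Real.log (t + 2)) := by
          rw [lintegral_const_mul _ (by fun_prop), h1, ← ENNReal.ofReal_mul (by positivity)]
          congr 2
          have : t + 2 - (t + 1) = 1 := by ring
          rw [this, Real.log_one]
          ring_nf
      _ ≤ _ := by
          refine ENNReal.ofReal_le_ofReal (mul_le_mul_of_nonneg_left ?_ (by positivity))
          calc Real.log (t + 2) ≤ Real.log (M ^ 2) :=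
                Real.log_le_log (by linarith) (by nlinarith)
            _ = 2 * Real.log M := by rw [Real.log_pow]; norm_num
  · refine ENNReal.ofReal_le_ofReal ?_
    have e : M ^ n = M ^ (n - 1) * M := by
      rw [← pow_succ]
      congr 1
      omega
    rw [e, mul_pow]
    have : 0 ≤ M ^ (n - 1) * M * Real.log M := by positivity
    nlinarith

/-- `∫_E M^{1/(p-1)} (1 + |x|)^{-p'} ≲ M^n log M` over the slab `E`, where `p' = p / (p - 1) ≤ n`
is the exponent conjugate to `p`. -/
theorem exists_lintegral_inv_norm_le (hn : 2 ≤ n) (hp : 1 < p) (hpn : p / (p - 1) ≤ n) :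
    ∃ C : ℝ, 0 < C ∧ ∀ M M₁ : ℝ, 4 ≤ M →
      ∫⁻ z in coneSlab n M, ENNReal.ofReal
          (M ^ (1 / (p - 1)) * (1 + ‖z.2‖) ^ (-(p / (p - 1))))
          ∂((volume.restrict (Ioc 0 M₁)).prod volume)
        ≤ ENNReal.ofReal (C * (M ^ n * Real.log M)) := by
  set σ := ((volume : Measure (Space n)).toSphere univ).toReal
  have hσ : 0 ≤ σ := ENNReal.toReal_nonneg
  refine ⟨σ * (2 ^ ((n : ℝ) - p / (p - 1)) * 2) + 1, by positivity, fun M M₁ hM => ?_⟩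
  have hM0 : 0 < M := by linarith
  have hp1 : 0 < p - 1 := by linarith
  have hlog : 0 < Real.log M := Real.log_pos (by linarith)
  refine (lintegral_coneSlab_le
    (K := M ^ (1 / (p - 1)) * (2 * M) ^ ((n : ℝ) - p / (p - 1)) * (2 * Real.log M)) hn
    (G := fun _ r => M ^ (1 / (p - 1)) * (1 + r) ^ (-(p / (p - 1))))
    (by unfold Function.uncurry; fun_prop) M₁ hM0 ?_).trans ?_
  · rintro t ⟨ht1, ht2⟩
    have ht : 0 < t := by linarith
    have h1 : ∫⁻ r in Ioc 0 (t + 1), ENNReal.ofReal ((1 + r)⁻¹)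
        = ENNReal.ofReal (Real.log (1 + (t + 1)) - Real.log (1 + 0)) := by
      refine lintegral_Ioc_eq_sub (F := fun r => Real.log (1 + r)) (by linarith) ?_ ?_ ?_
      · rintro r ⟨hr0, hr⟩
        have h2 : HasDerivAt (fun r => 1 + r) 1 r := by
          simpa using (hasDerivAt_id r).const_add 1
        have h3 := h2.log (by linarith)
        convert h3 using 1
        field_simp
      · exact ContinuousOn.inv₀ (by fun_prop) fun r hr => by have := hr.1; linarith
      · rintro r ⟨hr0, hr⟩
        positivity
    calc ∫⁻ r in Ioc 0 (t + 1), ENNReal.ofReal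
          (r ^ (n - 1) * (M ^ (1 / (p - 1)) * (1 + r) ^ (-(p / (p - 1)))))
        ≤ ∫⁻ r in Ioc 0 (t + 1),
            ENNReal.ofReal (M ^ (1 / (p - 1)) * (2 * M) ^ ((n : ℝ) - p / (p - 1)))
            * ENNReal.ofReal ((1 + r)⁻¹) := by
          refine setLIntegral_mono' measurableSet_Ioc fun r hr => ?_
          rw [← ENNReal.ofReal_mul (by positivity)]
          have h6 := hr.1.le
          have h5 : 1 + r ≤ 2 * M := by have := hr.2; linarith
          refine ENNReal.ofReal_le_ofReal ?_
          have h7 : r ^ (n - 1) ≤ (1 + r) ^ ((n : ℝ) - 1) := by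
            have e : ((n : ℝ) - 1) = ((n - 1 : ℕ) : ℝ) := by
              rw [Nat.cast_sub (by omega)]
              norm_num
            rw [e, Real.rpow_natCast]
            gcongr
            linarith
          have h8 : (1 + r) ^ ((n : ℝ) - p / (p - 1)) ≤ (2 * M) ^ ((n : ℝ) - p / (p - 1)) :=
            Real.rpow_le_rpow (by positivity) h5 (by linarith)
          calc r ^ (n - 1) * (M ^ (1 / (p - 1)) * (1 + r) ^ (-(p / (p - 1))))
              ≤ (1 + r) ^ ((n : ℝ) - 1) * (M ^ (1 / (p - 1)) * (1 + r) ^ (-(p / (p - 1)))) := by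
                gcongr
            _ = M ^ (1 / (p - 1)) * (1 + r) ^ ((n : ℝ) - p / (p - 1)) * (1 + r)⁻¹ := by
                have e : (1 + r) ^ ((n : ℝ) - 1) * (1 + r) ^ (-(p / (p - 1)))
                    = (1 + r) ^ ((n : ℝ) - p / (p - 1)) * (1 + r)⁻¹ := by
                  rw [← Real.rpow_neg_one, ← Real.rpow_add (by positivity),
                    ← Real.rpow_add (by positivity)]
                  congr 1
                  ring
                linear_combination M ^ (1 / (p - 1)) * e
            _ ≤ _ := by gcongr
      _ = ENNReal.ofReal (M ^ (1 / (p - 1)) * (2 * M) ^ ((n : ℝ) - p / (p - 1))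
            * Real.log (t + 2)) := by
          rw [lintegral_const_mul _ (by fun_prop), h1, ← ENNReal.ofReal_mul (by positivity)]
          congr 2
          have : 1 + (t + 1) = t + 2 := by ring
          rw [this, add_zero, Real.log_one, sub_zero]
      _ ≤ _ := by
          refine ENNReal.ofReal_le_ofReal (mul_le_mul_of_nonneg_left ?_ (by positivity))
          calc Real.log (t + 2) ≤ Real.log (M ^ 2) :=
                Real.log_le_log (by linarith) (by nlinarith)
            _ = 2 * Real.log M := by rw [Real.log_pow]; norm_num
  · refine ENNReal.ofReal_le_ofReal ?_
    have e : M ^ (1 / (p - 1)) * M ^ ((n : ℝ) - p / (p - 1)) * M = M ^ n := by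
      rw [← Real.rpow_add hM0, ← Real.rpow_add_one hM0.ne', ← Real.rpow_natCast]
      congr 1
      field_simp
      ring
    rw [Real.mul_rpow (by norm_num) hM0.le, ← e]
    have : 0 ≤ M ^ (1 / (p - 1)) * M ^ ((n : ℝ) - p / (p - 1)) * M * Real.log M := by positivity
    nlinarith

/-- `∫_E e^{-d/2} ≲ M^n` over the slab `E`, where `d = t + 2 - |x|`. -/
theorem exists_lintegral_exp_le (hn : 2 ≤ n) :
    ∃ C : ℝ, 0 < C ∧ ∀ M M₁ : ℝ, 4 ≤ M →
      ∫⁻ z in coneSlab n M, ENNReal.ofReal (Real.exp (-((z.1 + 2 - ‖z.2‖) / 2)))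
          ∂((volume.restrict (Ioc 0 M₁)).prod volume)
        ≤ ENNReal.ofReal (C * M ^ n) := by
  set σ := ((volume : Measure (Space n)).toSphere univ).toReal
  have hσ : 0 ≤ σ := ENNReal.toReal_nonneg
  refine ⟨σ * (2 ^ (n - 1) * 2) + 1, by positivity, fun M M₁ hM => ?_⟩
  have hM0 : 0 < M := by linarith
  refine (lintegral_coneSlab_le (K := (2 * M) ^ (n - 1) * 2) hn
    (G := fun t r => Real.exp (-((t + 2 - r) / 2)))
    (by unfold Function.uncurry; fun_prop) M₁ hM0 ?_).trans ?_
  · rintro t ⟨ht1, ht2⟩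
    have ht : 0 < t := by linarith
    have h1 : ∫⁻ r in Ioc 0 (t + 1), ENNReal.ofReal (Real.exp (-((t + 2 - r) / 2)))
        = ENNReal.ofReal (2 * Real.exp (-((t + 2 - (t + 1)) / 2))
          - 2 * Real.exp (-((t + 2 - 0) / 2))) := by
      refine lintegral_Ioc_eq_sub (F := fun r => 2 * Real.exp (-((t + 2 - r) / 2)))
        (by linarith) ?_ ?_ ?_
      · rintro r ⟨hr0, hr⟩
        have h2 : HasDerivAt (fun r => -((t + 2 - r) / 2)) (1 / 2) r := by
          have := (((hasDerivAt_id' r).const_sub (t + 2)).div_const 2).fun_neg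
          rwa [← neg_div, neg_neg] at this
        have h3 := h2.exp.const_mul 2
        rwa [mul_comm (Real.exp _), ← mul_assoc, mul_one_div_cancel two_ne_zero, one_mul] at h3
      · fun_prop
      · exact fun r _ => (Real.exp_pos _).le
    calc ∫⁻ r in Ioc 0 (t + 1), ENNReal.ofReal (r ^ (n - 1) * Real.exp (-((t + 2 - r) / 2)))
        ≤ ∫⁻ r in Ioc 0 (t + 1), ENNReal.ofReal ((2 * M) ^ (n - 1))
            * ENNReal.ofReal (Real.exp (-((t + 2 - r) / 2))) := by
          refine setLIntegral_mono' measurableSet_Ioc fun r hr => ?_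
          rw [← ENNReal.ofReal_mul (by positivity)]
          have h5 : r ≤ 2 * M := by have := hr.2; linarith
          have h6 := hr.1.le
          gcongr
      _ ≤ ENNReal.ofReal ((2 * M) ^ (n - 1) * 2) := by
          rw [lintegral_const_mul _ (by fun_prop), h1, ← ENNReal.ofReal_mul (by positivity)]
          refine ENNReal.ofReal_le_ofReal (mul_le_mul_of_nonneg_left ?_ (by positivity))
          have h2 : Real.exp (-((t + 2 - (t + 1)) / 2)) ≤ 1 := Real.exp_le_one_iff.2 (by linarith)
          have h3 := Real.exp_pos (-((t + 2 - 0) / 2))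
          linarith
  · refine ENNReal.ofReal_le_ofReal ?_
    have e : M ^ n = M ^ (n - 1) * M := by
      rw [← pow_succ]
      congr 1
      omega
    rw [e, mul_pow]
    have : 0 ≤ M ^ (n - 1) * M := by positivity
    nlinarith

end

/-! ### The critical exponent and Hölder's inequality -/

section

variable {n : ℕ} {μ β p : ℝ}

theorem one_lt_straussExponent (hn : 2 ≤ n) : 1 < straussExponent n := by
  obtain ⟨h0, h⟩ := (pos_root_gammaPoly_iff hn _).2 rfl
  have hn' : (2 : ℝ) ≤ n := by exact_mod_cast hn
  set p := straussExponent n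
  unfold gammaPoly at h
  by_contra hcon
  push Not at hcon
  nlinarith [mul_nonneg (mul_nonneg (sub_nonneg.2 hcon) h0.le) (by linarith : (0 : ℝ) ≤ n - 1)]

/-- The order `(n - 1) / 2 - 1 / p` of the superposition is positive. -/
theorem inv_straussExponent_lt (hn : 2 ≤ n) : 1 / straussExponent n < ((n : ℝ) - 1) / 2 := by
  obtain ⟨h0, h⟩ := (pos_root_gammaPoly_iff hn _).2 rfl
  have hn' : (2 : ℝ) ≤ n := by exact_mod_cast hn
  set p := straussExponent n
  unfold gammaPoly at h
  rw [div_lt_iff₀ h0]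
  by_contra hcon
  push Not at hcon
  nlinarith [mul_le_mul_of_nonneg_right hcon h0.le]

/-- The Strauss exponent is at least `n / (n - 1)`; equivalently, its conjugate exponent is at most
`n`. -/
theorem straussExponent_conjugate_le (hn : 2 ≤ n) :
    straussExponent n / (straussExponent n - 1) ≤ n := by
  have h1 := one_lt_straussExponent hn
  obtain ⟨h0, h⟩ := (pos_root_gammaPoly_iff hn _).2 rfl
  have hn' : (2 : ℝ) ≤ n := by exact_mod_cast hn
  set p := straussExponent n
  unfold gammaPoly at h
  rw [div_le_iff₀ (by linarith)]
  by_contra hcon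
  push Not at hcon
  have h2 : ((n : ℝ) - 1) * p < n := by linarith
  nlinarith [mul_lt_mul_of_pos_right h2 h0]

/-- The scaling relation behind the critical exponent: with `q = (n - 1) / 2 - 1 / p`, the powers
of `M` in Hölder's inequality cancel. -/
theorem straussExponent_scaling (hn : 2 ≤ n) (hp : p = straussExponent n) :
    (((n : ℝ) - 1) / 2 - 1 / p) / p + (-(1 + ((n : ℝ) - 1) / 2) + n * (1 - 1 / p)) = 0 := by
  obtain ⟨h0, h⟩ := (pos_root_gammaPoly_iff hn p).2 hp
  unfold gammaPoly at h
  field_simp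
  linear_combination -h

theorem conjugateWave_nonneg (hn : 2 ≤ n) (hμ : 0 < μ) (hβ : 2 < β) {l : ℝ} (hl : 0 < l)
    (hl1 : l ≤ 1) (z : ℝ × Space n) : 0 ≤ conjugateWave n μ β l z := by
  have h := one_le_profile hn hμ hβ hl hl1 ‖z.2‖
  exact mul_nonneg (Real.exp_pos _).le (zero_le_one.trans h)

/-- Hölder's inequality on a set `E` that carries `f`, against a weight `Φ ≥ δ` on `E`. -/
theorem lintegral_mul_le_weighted {α : Type*} [MeasurableSpace α] {ν : Measure α} {p' : ℝ}
    (hpp : p.HolderConjugate p') {f S Φ : α → ENNReal} (hf : AEMeasurable f ν)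
    (hS : AEMeasurable S ν) {E : Set α} (hE : MeasurableSet E)
    (hfE : ∀ᵐ z ∂ν, z ∉ E → f z = 0) {δ : ENNReal} (hδ : δ ≠ 0) (hδt : δ ≠ ⊤)
    (hΦ : ∀ z ∈ E, δ ≤ Φ z) :
    ∫⁻ z, f z * S z ∂ν ≤
      (δ⁻¹ * ∫⁻ z, f z ^ p * Φ z ∂ν) ^ (1 / p) * (∫⁻ z in E, S z ^ p' ∂ν) ^ (1 / p') := by
  calc ∫⁻ z, f z * S z ∂ν = ∫⁻ z, (f * E.indicator S) z ∂ν := by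
        refine lintegral_congr_ae (hfE.mono fun z hz => ?_)
        by_cases h : z ∈ E
        · simp [h]
        · simp [h, hz h]
    _ ≤ (∫⁻ z, f z ^ p ∂ν) ^ (1 / p) * (∫⁻ z, (E.indicator S) z ^ p' ∂ν) ^ (1 / p') :=
        ENNReal.lintegral_mul_le_Lp_mul_Lq ν hpp hf (hS.indicator hE)
    _ ≤ _ := by
        refine mul_le_mul' (ENNReal.rpow_le_rpow ?_ (by have := hpp.pos; positivity))
          (ENNReal.rpow_le_rpow ?_ (by have := hpp.symm.pos; positivity))
        · rw [← lintegral_const_mul' _ _ (ENNReal.inv_ne_top.2 hδ)]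
          refine lintegral_mono_ae (hfE.mono fun z hz => ?_)
          by_cases h : z ∈ E
          · calc f z ^ p = δ⁻¹ * (f z ^ p * δ) := by
                  rw [mul_comm (f z ^ p), ← mul_assoc, ENNReal.inv_mul_cancel hδ hδt, one_mul]
              _ ≤ δ⁻¹ * (f z ^ p * Φ z) := by gcongr; exact hΦ z h
          · rw [hz h, ENNReal.zero_rpow_of_pos hpp.pos]
            exact zero_le
        · rw [← lintegral_indicator hE]
          refine lintegral_mono fun z => ?_
          by_cases h : z ∈ E
          · simp [h]
          · simp [h, ENNReal.zero_rpow_of_pos hpp.symm.pos]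

/-- The mass of `|w|^p` under a temporal cutoff at scale `M`, weighted by the superposition of
conjugate waves of order `(n - 1) / 2 - 1 / p`. -/
def cutoffMass (n : ℕ) (μ β p : ℝ) (θ : ℝ → ℝ) (w : ℝ × Space n → ℝ) (M₁ M : ℝ) : ENNReal :=
  ∫⁻ z, ENNReal.ofReal (|w z| ^ p * θ (z.1 / M))
      * waveSuperposition n μ β (((n : ℝ) - 1) / 2 - 1 / p) z
    ∂((volume.restrict (Ioc 0 M₁)).prod volume)

/-- Hölder's inequality against the mass in the shell `t ∼ M`. -/
theorem exists_lintegral_le_cutoffMass (hn : 2 ≤ n) (hμ : 0 < μ) (hβ : 2 < β)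
    {p' : ℝ} (hpp : p.HolderConjugate p') (hq : 0 < ((n : ℝ) - 1) / 2 - 1 / p) :
    ∃ c : ℝ, 0 < c ∧ ∀ {M₁ M C K : ℝ} {w : ℝ × Space n → ℝ} {η θ : ℝ → ℝ}
      {S : ℝ × Space n → ENNReal}, 1 ≤ M → Measurable w → Measurable S → IsCutoffPair p C η θ →
      (∀ᵐ z ∂((volume.restrict (Ioc 0 M₁)).prod (volume : Measure (Space n))),
        z.1 ∈ Ioc 0 M₁ ∧ (z.1 + 1 < ‖z.2‖ → w z = 0)) →
      0 ≤ K →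
      ∫⁻ z in coneSlab n M, S z ^ p' ∂((volume.restrict (Ioc 0 M₁)).prod volume)
        ≤ ENNReal.ofReal K →
      ∫⁻ z, ENNReal.ofReal (|w z| * θ (z.1 / M) ^ (1 / p)) * S z
          ∂((volume.restrict (Ioc 0 M₁)).prod volume)
        ≤ ENNReal.ofReal (c * (M ^ ((((n : ℝ) - 1) / 2 - 1 / p) / p) * K ^ (1 / p')))
          * cutoffMass n μ β p θ w M₁ M ^ (1 / p) := by
  set q := ((n : ℝ) - 1) / 2 - 1 / p with hqdef
  obtain ⟨c, hc, hlow⟩ := exists_le_waveSuperposition (n := n) hn hμ hβ hq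
  refine ⟨c⁻¹ ^ (1 / p), by positivity, ?_⟩
  intro M₁ M C K w η θ S hM hw hS hη hcone hK hSK
  have hM0 : 0 < M := by linarith
  have hp0 := hpp.pos
  have hp'0 := hpp.symm.pos
  set ν := (volume.restrict (Ioc 0 M₁)).prod (volume : Measure (Space n)) with hν
  have hθm : Measurable fun z : ℝ × Space n => θ (z.1 / M) :=
    hη.continuous.measurable.comp (by fun_prop)
  have hf : Measurable fun z => ENNReal.ofReal (|w z| * θ (z.1 / M) ^ (1 / p)) :=
    (hw.abs.mul (hθm.pow_const _)).ennreal_ofReal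
  have hfE : ∀ᵐ z ∂ν, z ∉ coneSlab n M →
      ENNReal.ofReal (|w z| * θ (z.1 / M) ^ (1 / p)) = 0 := by
    filter_upwards [hcone] with z hz hzE
    have h0 : θ (z.1 / M) = 0 → ENNReal.ofReal (|w z| * θ (z.1 / M) ^ (1 / p)) = 0 := by
      intro h
      rw [h, Real.zero_rpow (by positivity), mul_zero, ENNReal.ofReal_zero]
    by_cases h1 : z.1 / M ≤ 1 / 4
    · exact h0 (hη.weight_eq_zero _ h1)
    by_cases h2 : 1 ≤ z.1 / M
    · exact h0 (le_antisymm ((hη.le _).trans (hη.eq_zero _ h2).le) (hη.nonneg _))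
    have h3 : z.1 + 1 < ‖z.2‖ := by
      by_contra hcon
      push Not at h1 h2 hcon
      rw [lt_div_iff₀ hM0] at h1
      rw [div_lt_one hM0] at h2
      exact hzE ⟨⟨by linarith, h2.le⟩, hcon⟩
    rw [hz.2 h3, abs_zero, zero_mul, ENNReal.ofReal_zero]
  have hδ : 0 < c * M ^ (-q) := by positivity
  refine (lintegral_mul_le_weighted hpp hf.aemeasurable hS.aemeasurable (measurableSet_coneSlab M)
    hfE (δ := ENNReal.ofReal (c * M ^ (-q))) (by simpa using hδ) ENNReal.ofReal_ne_top
    fun z hz => hlow M z hM hz.1.2).trans ?_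
  have e1 : ∫⁻ z, ENNReal.ofReal (|w z| * θ (z.1 / M) ^ (1 / p)) ^ p
      * waveSuperposition n μ β q z ∂ν = cutoffMass n μ β p θ w M₁ M := by
    unfold cutoffMass
    refine lintegral_congr fun z => ?_
    congr 1
    rw [ENNReal.ofReal_rpow_of_nonneg (mul_nonneg (abs_nonneg _)
      (Real.rpow_nonneg (hη.nonneg _) _)) hp0.le,
      Real.mul_rpow (abs_nonneg _) (Real.rpow_nonneg (hη.nonneg _) _),
      ← Real.rpow_mul (hη.nonneg _), one_div_mul_cancel hp0.ne', Real.rpow_one]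
  rw [e1, ENNReal.mul_rpow_of_nonneg _ _ (by positivity), ← ENNReal.ofReal_inv_of_pos hδ,
    ENNReal.ofReal_rpow_of_pos (by positivity)]
  calc ENNReal.ofReal ((c * M ^ (-q))⁻¹ ^ (1 / p)) * cutoffMass n μ β p θ w M₁ M ^ (1 / p)
        * (∫⁻ z in coneSlab n M, S z ^ p' ∂ν) ^ (1 / p')
      ≤ ENNReal.ofReal ((c * M ^ (-q))⁻¹ ^ (1 / p)) * cutoffMass n μ β p θ w M₁ M ^ (1 / p)
        * ENNReal.ofReal K ^ (1 / p') := by gcongr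
    _ = _ := by
        rw [ENNReal.ofReal_rpow_of_nonneg hK (by positivity), mul_right_comm,
          ← ENNReal.ofReal_mul (by positivity)]
        congr 2
        rw [mul_inv, Real.rpow_neg hM0.le, inv_inv, Real.mul_rpow (by positivity) (by positivity),
          ← Real.rpow_mul hM0.le, mul_one_div, mul_assoc]

end

/-! ### Bounds by the mass in a shell -/

section

variable {n : ℕ} {μ β p : ℝ}

/-- The case `λ = 1` of the cut-off inequality bounds the data by the mass in the shell `t ∼ M`. -/
theorem exists_le_cutoffMass (hn : 2 ≤ n) (hμ : 0 < μ) (hβ : 2 < β) (hp : p = straussExponent n)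
    {C₀ : ℝ} (hC₀ : 0 < C₀) :
    ∃ C : ℝ, 0 < C ∧ ∀ {I : ENNReal} {M₁ M : ℝ} {w : ℝ × Space n → ℝ} {η θ : ℝ → ℝ},
      4 ≤ M → Measurable w → IsCutoffPair p C₀ η θ →
      (∀ᵐ z ∂((volume.restrict (Ioc 0 M₁)).prod (volume : Measure (Space n))),
        z.1 ∈ Ioc 0 M₁ ∧ (z.1 + 1 < ‖z.2‖ → w z = 0)) →
      I ≤ ∫⁻ z, ENNReal.ofReal (|w z| * (C₀ * θ (z.1 / M) ^ (1 / p)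
          * ((1 / M ^ 2 + 2 * 1 / M + damping μ β z.2 / M) * conjugateWave n μ β 1 z)))
          ∂((volume.restrict (Ioc 0 M₁)).prod volume) →
      I ≤ ENNReal.ofReal C * cutoffMass n μ β p θ w M₁ M ^ (1 / p) := by
  have hn' : (2 : ℝ) ≤ n := by exact_mod_cast hn
  have hp1 : 1 < p := hp ▸ one_lt_straussExponent hn
  have hq : 0 < ((n : ℝ) - 1) / 2 - 1 / p := by
    have := inv_straussExponent_lt hn
    rw [← hp] at this
    linarith
  have hscale := straussExponent_scaling hn hp
  set q := ((n : ℝ) - 1) / 2 - 1 / p with hqdef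
  set m := ((n : ℝ) - 1) / 2 with hm
  have hm0 : 0 < m := by rw [hm]; linarith
  have hp0 : 0 < p := by linarith
  have hpp : p.HolderConjugate (p / (p - 1)) := Real.HolderConjugate.conjExponent hp1
  have hinv : 1 / (p / (p - 1)) = 1 - 1 / p := by
    have : p - 1 ≠ 0 := by linarith
    field_simp
  have hp'1 : 1 < p / (p - 1) := hpp.symm.lt
  set p' := p / (p - 1) with hp'
  obtain ⟨c, hc, hslab⟩ := exists_lintegral_le_cutoffMass (n := n) hn hμ hβ hpp hq
  obtain ⟨C₁, hC₁, hconj⟩ := exists_conjugateWave_le (n := n) hn hμ hβ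
  obtain ⟨C₂, hC₂, hexp⟩ := exists_lintegral_exp_le (n := n) hn
  set D := C₀ * (3 + μ) * C₁ * 4 ^ m with hD
  have hD0 : 0 < D := by positivity
  refine ⟨c * (D * C₂ ^ (1 / p')), by positivity, ?_⟩
  intro I M₁ M w η θ hM hw hη hcone hI
  have hM0 : 0 < M := by linarith
  set ν := (volume.restrict (Ioc 0 M₁)).prod (volume : Measure (Space n)) with hν
  have hwave : Measurable fun z : ℝ × Space n => conjugateWave n μ β 1 z :=
    measurable_conjugateWave.comp (by fun_prop : Measurable fun z : ℝ × Space n => ((1 : ℝ), z))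
  have hdamp : Measurable fun z : ℝ × Space n => damping μ β z.2 :=
    (continuous_damping μ β).measurable.comp measurable_snd
  set S : ℝ × Space n → ENNReal := fun z =>
    ENNReal.ofReal (C₀ * ((1 / M ^ 2 + 2 * 1 / M + damping μ β z.2 / M)
      * conjugateWave n μ β 1 z)) with hS
  have hSm : Measurable S :=
    ((((hdamp.div_const M).const_add _).mul hwave).const_mul C₀).ennreal_ofReal
  -- on the slab, `S ≲ M^{-1-m} e^{-d/2}` with `d = t + 2 - |x|`
  have hSle : ∀ z ∈ coneSlab n M, S z ^ p' ≤ ENNReal.ofReal ((D * M ^ (-(1 + m))) ^ p')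
      * ENNReal.ofReal (Real.exp (-((z.1 + 2 - ‖z.2‖) / 2))) := by
    rintro z ⟨⟨hz1, hz2⟩, hz3⟩
    have hz0 : 0 < z.1 := by linarith
    have hd : 0 ≤ (z.1 + 2 - ‖z.2‖) / 2 := by linarith
    have hV : damping μ β z.2 ≤ μ := by
      have h1 := damping_le_inv hμ.le (by linarith : (1 : ℝ) ≤ β) z.2
      have h2 : (1 + ‖z.2‖)⁻¹ ≤ 1 := inv_le_one_of_one_le₀ (by linarith [norm_nonneg z.2])
      nlinarith
    have hV0 : 0 ≤ damping μ β z.2 := damping_nonneg hμ.le z.2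
    have h1 : 1 / M ^ 2 + 2 * 1 / M + damping μ β z.2 / M ≤ (3 + μ) * M⁻¹ := by
      have h2 : 1 / M ^ 2 ≤ M⁻¹ := by
        rw [← one_div]
        apply one_div_le_one_div_of_le hM0
        nlinarith
      have h3 : damping μ β z.2 / M ≤ μ * M⁻¹ := by
        rw [div_eq_mul_inv]
        gcongr
      calc _ ≤ M⁻¹ + 2 * 1 / M + μ * M⁻¹ := by gcongr
        _ = _ := by ring
    have h4 : conjugateWave n μ β 1 z
        ≤ C₁ * (4 ^ m * M ^ (-m)) * Real.exp (-((z.1 + 2 - ‖z.2‖) / 2)) := by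
      have h5 := hconj 1 z one_pos le_rfl hz0.le hz3
      have h6 : (1 + 1 * z.1) ^ (-m) ≤ 4 ^ m * M ^ (-m) := by
        calc (1 + 1 * z.1) ^ (-m) ≤ (M / 4) ^ (-m) :=
              Real.rpow_le_rpow_of_nonpos (by positivity) (by linarith) (by linarith)
          _ = 4 ^ m * M ^ (-m) := by
              rw [Real.div_rpow hM0.le (by norm_num), Real.rpow_neg (by norm_num : (0 : ℝ) ≤ 4),
                div_inv_eq_mul, mul_comm]
      calc conjugateWave n μ β 1 z
          ≤ C₁ * ((1 + 1 * z.1) ^ (-m) * Real.exp (-(1 * (z.1 + 2 - ‖z.2‖) / 2))) := h5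
        _ ≤ C₁ * (4 ^ m * M ^ (-m) * Real.exp (-(1 * (z.1 + 2 - ‖z.2‖) / 2))) := by gcongr
        _ = _ := by ring_nf
    have h7 : C₀ * ((1 / M ^ 2 + 2 * 1 / M + damping μ β z.2 / M) * conjugateWave n μ β 1 z)
        ≤ D * M ^ (-(1 + m)) * Real.exp (-((z.1 + 2 - ‖z.2‖) / 2)) := by
      calc _ ≤ C₀ * ((3 + μ) * M⁻¹
            * (C₁ * (4 ^ m * M ^ (-m)) * Real.exp (-((z.1 + 2 - ‖z.2‖) / 2)))) := by
            refine mul_le_mul_of_nonneg_left (mul_le_mul h1 h4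
              (conjugateWave_nonneg hn hμ hβ one_pos le_rfl z) (by positivity)) hC₀.le
        _ = _ := by
            rw [neg_add, Real.rpow_add hM0, Real.rpow_neg_one, hD]
            ring
    calc S z ^ p' ≤ ENNReal.ofReal
          (D * M ^ (-(1 + m)) * Real.exp (-((z.1 + 2 - ‖z.2‖) / 2))) ^ p' := by
          gcongr
          exact ENNReal.ofReal_le_ofReal h7
      _ = ENNReal.ofReal ((D * M ^ (-(1 + m))) ^ p')
            * ENNReal.ofReal (Real.exp (-((z.1 + 2 - ‖z.2‖) / 2)) ^ p') := by
          rw [ENNReal.ofReal_rpow_of_nonneg (by positivity) (by positivity),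
            Real.mul_rpow (by positivity) (by positivity), ENNReal.ofReal_mul (by positivity)]
      _ ≤ _ := by
          gcongr
          rw [← Real.exp_mul]
          apply Real.exp_le_exp.2
          nlinarith
  have hSint : ∫⁻ z in coneSlab n M, S z ^ p' ∂ν
      ≤ ENNReal.ofReal ((D * M ^ (-(1 + m))) ^ p' * (C₂ * M ^ n)) := by
    calc ∫⁻ z in coneSlab n M, S z ^ p' ∂ν
        ≤ ∫⁻ z in coneSlab n M, ENNReal.ofReal ((D * M ^ (-(1 + m))) ^ p')
            * ENNReal.ofReal (Real.exp (-((z.1 + 2 - ‖z.2‖) / 2))) ∂ν :=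
          setLIntegral_mono' (measurableSet_coneSlab M) hSle
      _ ≤ _ := by
          rw [lintegral_const_mul' _ _ ENNReal.ofReal_ne_top, ENNReal.ofReal_mul (by positivity)]
          gcongr
          exact hexp M M₁ hM
  refine hI.trans ?_
  have h8 := hslab (M₁ := M₁) (K := (D * M ^ (-(1 + m))) ^ p' * (C₂ * M ^ n)) (by linarith) hw hSm
    hη hcone (by positivity) hSint
  calc _ = ∫⁻ z, ENNReal.ofReal (|w z| * θ (z.1 / M) ^ (1 / p)) * S z ∂ν := by
        refine lintegral_congr fun z => ?_
        rw [hS, ← ENNReal.ofReal_mul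
          (mul_nonneg (abs_nonneg _) (Real.rpow_nonneg (hη.nonneg _) _))]
        congr 1
        ring
    _ ≤ _ := h8
    _ = _ := by
        congr 2
        rw [Real.mul_rpow (by positivity) (by positivity), ← Real.rpow_mul (by positivity),
          mul_one_div_cancel hpp.symm.pos.ne', Real.rpow_one,
          Real.mul_rpow (by positivity) (by positivity), ← Real.rpow_natCast,
          ← Real.rpow_mul hM0.le, hinv]
        have e : M ^ (q / p) * (M ^ (-(1 + m)) * M ^ ((n : ℝ) * (1 - 1 / p))) = 1 := by
          rw [← Real.rpow_add hM0, ← Real.rpow_add hM0, hscale, Real.rpow_zero]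
        linear_combination c * D * C₂ ^ (1 - 1 / p) * e

/-- Integrating against `λ^{s-1} dλ` turns conjugate waves into their superposition. -/
theorem lintegral_superposition (s : ℝ)
    {ν : Measure (ℝ × Space n)} [SFinite ν] {A : ℝ × Space n → ENNReal} (hA : Measurable A) :
    ∫⁻ l in Ioc (0 : ℝ) 1, ENNReal.ofReal (l ^ (s - 1))
        * ∫⁻ z, A z * ENNReal.ofReal (conjugateWave n μ β l z) ∂ν
      = ∫⁻ z, A z * waveSuperposition n μ β s z ∂ν := by
  have hm := measurable_superposition_integrand (n := n) (μ := μ) (β := β) s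
  calc _ = ∫⁻ l in Ioc (0 : ℝ) 1, ∫⁻ z,
          A z * ENNReal.ofReal (l ^ (s - 1) * conjugateWave n μ β l z) ∂ν := by
        refine setLIntegral_congr_fun measurableSet_Ioc fun l hl => ?_
        rw [← lintegral_const_mul' _ _ ENNReal.ofReal_ne_top]
        refine lintegral_congr fun z => ?_
        rw [ENNReal.ofReal_mul (Real.rpow_nonneg hl.1.le _)]
        ring
    _ = ∫⁻ z, (∫⁻ l in Ioc (0 : ℝ) 1,
          A z * ENNReal.ofReal (l ^ (s - 1) * conjugateWave n μ β l z)) ∂ν :=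
        lintegral_lintegral_swap ((hA.comp measurable_snd).mul hm).aemeasurable
    _ = _ := by
        refine lintegral_congr fun z => ?_
        exact lintegral_const_mul _
          (hm.comp (by fun_prop : Measurable fun l : ℝ => (l, z)))

/-- Superposing the cut-off inequalities over the frequencies `λ ∈ (0, 1]` bounds the total mass up
to time `M` by the mass in the shell `t ∼ M`, up to a power of `log M`. -/
theorem exists_cutoffMass_rpow_le (hn : 2 ≤ n) (hμ : 0 < μ) (hβ : 2 < β)
    (hp : p = straussExponent n) {C₀ : ℝ} (hC₀ : 0 < C₀) :
    ∃ C : ℝ, 0 < C ∧ ∀ {M₁ M : ℝ} {w : ℝ × Space n → ℝ} {η θ : ℝ → ℝ},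
      4 ≤ M → Measurable w → IsCutoffPair p C₀ η θ →
      (∀ᵐ z ∂((volume.restrict (Ioc 0 M₁)).prod (volume : Measure (Space n))),
        z.1 ∈ Ioc 0 M₁ ∧ (z.1 + 1 < ‖z.2‖ → w z = 0)) →
      (∀ l : ℝ, 0 < l → l ≤ 1 →
        ∫⁻ z, ENNReal.ofReal (|w z| ^ p * (η (z.1 / M) * conjugateWave n μ β l z))
          ∂((volume.restrict (Ioc 0 M₁)).prod volume)
        ≤ ∫⁻ z, ENNReal.ofReal (|w z| * (C₀ * θ (z.1 / M) ^ (1 / p)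
          * ((1 / M ^ 2 + 2 * l / M + damping μ β z.2 / M) * conjugateWave n μ β l z)))
          ∂((volume.restrict (Ioc 0 M₁)).prod volume)) →
      cutoffMass n μ β p η w M₁ M ^ p
        ≤ ENNReal.ofReal (C * Real.log M ^ (p - 1)) * cutoffMass n μ β p θ w M₁ M := by
  have hn' : (2 : ℝ) ≤ n := by exact_mod_cast hn
  have hp1 : 1 < p := hp ▸ one_lt_straussExponent hn
  have hp0 : 0 < p := by linarith
  have hq : 0 < ((n : ℝ) - 1) / 2 - 1 / p := by
    have := inv_straussExponent_lt hn
    rw [← hp] at this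
    linarith
  have hpn : p / (p - 1) ≤ n := hp ▸ straussExponent_conjugate_le hn
  have hscale := straussExponent_scaling hn hp
  have hqm : ((n : ℝ) - 1) / 2 - 1 / p < ((n : ℝ) - 1) / 2 := by
    have : 0 < 1 / p := by positivity
    linarith
  obtain ⟨C₁, hC₁, hΦ₁⟩ := exists_waveSuperposition_succ_le (n := n) hn hμ hβ hp1
  obtain ⟨C₂, hC₂, hΦ₂⟩ := exists_waveSuperposition_le (n := n) hn hμ hβ hq hqm
  have hpp : p.HolderConjugate (p / (p - 1)) := Real.HolderConjugate.conjExponent hp1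
  obtain ⟨c, hc, hslab⟩ := exists_lintegral_le_cutoffMass (n := n) hn hμ hβ hpp hq
  obtain ⟨C₃, hC₃, hdist⟩ := exists_lintegral_inv_dist_le (n := n) hn
  obtain ⟨C₄, hC₄, hnorm⟩ := exists_lintegral_inv_norm_le (n := n) hn hp1 hpn
  set q := ((n : ℝ) - 1) / 2 - 1 / p with hqdef
  set m := ((n : ℝ) - 1) / 2 with hm
  have hm0 : 0 < m := by rw [hm]; linarith
  have hinv : 1 / (p / (p - 1)) = 1 - 1 / p := by
    have : p - 1 ≠ 0 := by linarith
    field_simp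
  have hdiv : 1 / p * (p / (p - 1)) = 1 / (p - 1) := by field_simp
  have hp'1 : 1 < p / (p - 1) := hpp.symm.lt
  set p' := p / (p - 1) with hp'
  have hp'0 : 0 < p' := by linarith
  obtain ⟨D, hD⟩ : ∃ D : ℝ, D = C₀ * (2 + μ) * C₂ * 4 ^ q + C₀ * 2 * C₁ * 4 ^ m := ⟨_, rfl⟩
  have hD0 : 0 < D := by rw [hD]; positivity
  refine ⟨(c * (D * (2 ^ (p' - 1) * (C₃ + C₄)) ^ (1 / p'))) ^ p, by positivity, ?_⟩
  intro M₁ M w η θ hM hw hη hcone hcut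
  have hM0 : 0 < M := by linarith
  have hlog : 0 < Real.log M := Real.log_pos (by linarith)
  set ν := (volume.restrict (Ioc 0 M₁)).prod (volume : Measure (Space n)) with hν
  have hdamp : Measurable fun z : ℝ × Space n => damping μ β z.2 :=
    (continuous_damping μ β).measurable.comp measurable_snd
  have hθm : Measurable fun z : ℝ × Space n => θ (z.1 / M) :=
    hη.continuous.measurable.comp (by fun_prop)
  have hηm : Measurable fun z : ℝ × Space n => η (z.1 / M) :=
    hη.contDiff.continuous.measurable.comp (by fun_prop)
  set A : ℝ × Space n → ENNReal := fun z => ENNReal.ofReal (|w z| ^ p * η (z.1 / M)) with hA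
  have hAm : Measurable A := ((hw.abs.pow_const _).mul hηm).ennreal_ofReal
  set F : ℝ × Space n → ENNReal := fun z =>
    ENNReal.ofReal (|w z| * θ (z.1 / M) ^ (1 / p)) with hF
  have hFm : Measurable F := (hw.abs.mul (hθm.pow_const _)).ennreal_ofReal
  set B : ℝ × Space n → ENNReal := fun z =>
    ENNReal.ofReal (C₀ * (1 / M ^ 2 + damping μ β z.2 / M)) with hB
  have hBm : Measurable B := (((hdamp.div_const M).const_add _).const_mul C₀).ennreal_ofReal
  have hV0 : ∀ z : ℝ × Space n, 0 ≤ damping μ β z.2 := fun z => damping_nonneg hμ.le z.2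
  set S : ℝ × Space n → ENNReal := fun z =>
    B z * waveSuperposition n μ β q z
      + ENNReal.ofReal (C₀ * (2 / M)) * waveSuperposition n μ β (q + 1) z with hS
  have hSm : Measurable S := (hBm.mul (measurable_waveSuperposition _)).add
    ((measurable_waveSuperposition _).const_mul _)
  -- the factor `λ` in the cut-off inequality raises the order of the superposition to `q + 1`
  have hmass : cutoffMass n μ β p η w M₁ M ≤ ∫⁻ z, F z * S z ∂ν := by
    calc cutoffMass n μ β p η w M₁ M
        = ∫⁻ l in Ioc (0 : ℝ) 1, ENNReal.ofReal (l ^ (q - 1))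
            * ∫⁻ z, A z * ENNReal.ofReal (conjugateWave n μ β l z) ∂ν :=
          (lintegral_superposition q hAm).symm
      _ ≤ ∫⁻ l in Ioc (0 : ℝ) 1,
            (ENNReal.ofReal (l ^ (q - 1))
              * ∫⁻ z, F z * B z * ENNReal.ofReal (conjugateWave n μ β l z) ∂ν
            + ENNReal.ofReal (l ^ (q + 1 - 1))
              * ∫⁻ z, F z * ENNReal.ofReal (C₀ * (2 / M))
                * ENNReal.ofReal (conjugateWave n μ β l z) ∂ν) := by
          refine setLIntegral_mono' measurableSet_Ioc fun l hl => ?_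
          have hconj := fun z => conjugateWave_nonneg hn hμ hβ hl.1 hl.2 z
          have hwave : Measurable fun z : ℝ × Space n => conjugateWave n μ β l z :=
            measurable_conjugateWave.comp (by fun_prop : Measurable fun z : ℝ × Space n => (l, z))
          have e0 : ENNReal.ofReal (l ^ (q + 1 - 1))
              = ENNReal.ofReal (l ^ (q - 1)) * ENNReal.ofReal l := by
            rw [← ENNReal.ofReal_mul (Real.rpow_nonneg hl.1.le _),
              ← Real.rpow_add_one hl.1.ne']
            ring_nf
          rw [e0, mul_assoc (ENNReal.ofReal (l ^ (q - 1))), ← mul_add]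
          refine mul_le_mul_right ?_ _
          have hFB : Measurable fun z => F z * B z * ENNReal.ofReal (conjugateWave n μ β l z) :=
            (hFm.mul hBm).mul hwave.ennreal_ofReal
          rw [← lintegral_const_mul' _ _ ENNReal.ofReal_ne_top, ← lintegral_add_left hFB]
          calc ∫⁻ z, A z * ENNReal.ofReal (conjugateWave n μ β l z) ∂ν
              = ∫⁻ z, ENNReal.ofReal (|w z| ^ p * (η (z.1 / M) * conjugateWave n μ β l z)) ∂ν := by
                refine lintegral_congr fun z => ?_
                rw [hA, ← ENNReal.ofReal_mul
                  (mul_nonneg (Real.rpow_nonneg (abs_nonneg _) _) (hη.cutoff_nonneg _)), mul_assoc]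
            _ ≤ _ := hcut l hl.1 hl.2
            _ = _ := by
                refine lintegral_congr fun z => ?_
                have f0 := mul_nonneg (abs_nonneg (w z)) (Real.rpow_nonneg
                  (hη.nonneg (z.1 / M))
                  (1 / p))
                have b0 : 0 ≤ C₀ * (1 / M ^ 2 + damping μ β z.2 / M) := by
                  have := hV0 z
                  positivity
                have c0 := hconj z
                have l0 := hl.1.le
                rw [hF, hB]
                dsimp only
                rw [← ENNReal.ofReal_mul f0, ← ENNReal.ofReal_mul f0,
                  ← ENNReal.ofReal_mul (mul_nonneg f0 b0),
                  ← ENNReal.ofReal_mul (mul_nonneg f0 (by positivity)),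
                  ← ENNReal.ofReal_mul l0, ← ENNReal.ofReal_add
                    (mul_nonneg (mul_nonneg f0 b0) c0)
                    (mul_nonneg l0 (mul_nonneg (mul_nonneg f0 (by positivity)) c0))]
                congr 1
                ring
      _ = ∫⁻ z, F z * B z * waveSuperposition n μ β q z ∂ν
            + ∫⁻ z, F z * ENNReal.ofReal (C₀ * (2 / M))
              * waveSuperposition n μ β (q + 1) z ∂ν := by
          have hFB : Measurable fun z => F z * B z := hFm.mul hBm
          have hFc : Measurable fun z => F z * ENNReal.ofReal (C₀ * (2 / M)) := hFm.mul_const _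
          have hmeas : Measurable fun l : ℝ => ENNReal.ofReal (l ^ (q - 1))
              * ∫⁻ z, F z * B z * ENNReal.ofReal (conjugateWave n μ β l z) ∂ν :=
            (measurable_id.pow_const _).ennreal_ofReal.mul
              (Measurable.lintegral_prod_right'
                (f := fun y : ℝ × (ℝ × Space n) =>
                  F y.2 * B y.2 * ENNReal.ofReal (conjugateWave n μ β y.1 y.2))
                (((hFm.mul hBm).comp measurable_snd).mul
                  measurable_conjugateWave.ennreal_ofReal))
          rw [lintegral_add_left hmeas, lintegral_superposition q hFB,
            lintegral_superposition (q + 1) hFc]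
      _ = ∫⁻ z, F z * S z ∂ν := by
          have hFB : Measurable fun z => F z * B z * waveSuperposition n μ β q z :=
            (hFm.mul hBm).mul (measurable_waveSuperposition _)
          rw [← lintegral_add_left hFB]
          refine lintegral_congr fun z => ?_
          rw [hS]
          ring
  -- on the slab, `S ≲ M^{-1-m} (d^{-1/p'} + M^{1/p} (1 + |x|)^{-1})` with `d = t + 2 - |x|`
  have hSle : ∀ z ∈ coneSlab n M, S z ^ p' ≤ ENNReal.ofReal ((D * M ^ (-(1 + m))) ^ p')
      * (ENNReal.ofReal (2 ^ (p' - 1)) * (ENNReal.ofReal ((z.1 + 2 - ‖z.2‖)⁻¹)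
        + ENNReal.ofReal (M ^ (1 / (p - 1)) * (1 + ‖z.2‖) ^ (-p')))) := by
    rintro z ⟨⟨hz1, hz2⟩, hz3⟩
    have hz0 : 0 < z.1 := by linarith
    have hd : 0 < z.1 + 2 - ‖z.2‖ := by linarith
    have hr := norm_nonneg z.2
    have hpow : ∀ a : ℝ, 0 < a → z.1 ^ (-a) ≤ 4 ^ a * M ^ (-a) := fun a ha => by
      calc z.1 ^ (-a) ≤ (M / 4) ^ (-a) :=
            Real.rpow_le_rpow_of_nonpos (by positivity) hz1 (by linarith)
        _ = 4 ^ a * M ^ (-a) := by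
            rw [Real.div_rpow hM0.le (by norm_num), Real.rpow_neg (by norm_num : (0 : ℝ) ≤ 4),
              div_inv_eq_mul, mul_comm]
    have hMm : M ^ (-(1 + m)) = M⁻¹ * M ^ (-m) := by
      rw [neg_add, Real.rpow_add hM0, Real.rpow_neg_one]
    have hMq : M ^ (-q) = M ^ (-m) * M ^ (1 / p) := by
      rw [← Real.rpow_add hM0, hqdef]
      ring_nf
    have h1 : B z * waveSuperposition n μ β q z ≤ ENNReal.ofReal (D * M ^ (-(1 + m)))
        * ENNReal.ofReal (M ^ (1 / p) * (1 + ‖z.2‖)⁻¹) := by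
      have h2 : 1 / M ^ 2 + damping μ β z.2 / M ≤ (2 + μ) * (M⁻¹ * (1 + ‖z.2‖)⁻¹) := by
        have h3 := damping_le_inv hμ.le (by linarith : (1 : ℝ) ≤ β) z.2
        have h4 : M⁻¹ ≤ 2 * (1 + ‖z.2‖)⁻¹ := by
          rw [← div_eq_mul_inv, le_div_iff₀ (by positivity), inv_mul_le_iff₀ hM0]
          linarith
        calc 1 / M ^ 2 + damping μ β z.2 / M
            = M⁻¹ * (M⁻¹ + damping μ β z.2) := by
              field_simp
          _ ≤ M⁻¹ * (2 * (1 + ‖z.2‖)⁻¹ + μ * (1 + ‖z.2‖)⁻¹) := by gcongr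
          _ = _ := by ring
      calc B z * waveSuperposition n μ β q z
          ≤ ENNReal.ofReal (C₀ * ((2 + μ) * (M⁻¹ * (1 + ‖z.2‖)⁻¹)))
            * ENNReal.ofReal (C₂ * (4 ^ q * M ^ (-q))) := by
            refine mul_le_mul' (ENNReal.ofReal_le_ofReal (mul_le_mul_of_nonneg_left h2 hC₀.le))
              ((hΦ₂ z hz0 hz3).trans (ENNReal.ofReal_le_ofReal
                (mul_le_mul_of_nonneg_left (hpow q hq) hC₂.le)))
        _ = ENNReal.ofReal (C₀ * (2 + μ) * C₂ * 4 ^ q * M ^ (-(1 + m)))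
            * ENNReal.ofReal (M ^ (1 / p) * (1 + ‖z.2‖)⁻¹) := by
            rw [← ENNReal.ofReal_mul (by positivity), ← ENNReal.ofReal_mul (by positivity),
              hMq, hMm]
            ring_nf
        _ ≤ _ := by
            gcongr
            rw [hD]
            have : 0 < C₀ * 2 * C₁ * 4 ^ m := by positivity
            linarith
    have h5 : ENNReal.ofReal (C₀ * (2 / M)) * waveSuperposition n μ β (q + 1) z
        ≤ ENNReal.ofReal (D * M ^ (-(1 + m)))
          * ENNReal.ofReal ((z.1 + 2 - ‖z.2‖) ^ (-(1 - 1 / p))) := by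
      calc ENNReal.ofReal (C₀ * (2 / M)) * waveSuperposition n μ β (q + 1) z
          ≤ ENNReal.ofReal (C₀ * (2 / M)) * ENNReal.ofReal (C₁ * (4 ^ m * M ^ (-m)
              * (z.1 + 2 - ‖z.2‖) ^ (-(1 - 1 / p)))) := by
            refine mul_le_mul_right ((hΦ₁ z hz0 hz3).trans (ENNReal.ofReal_le_ofReal ?_)) _
            have := hpow m hm0
            gcongr
        _ = ENNReal.ofReal (C₀ * 2 * C₁ * 4 ^ m * M ^ (-(1 + m)))
            * ENNReal.ofReal ((z.1 + 2 - ‖z.2‖) ^ (-(1 - 1 / p))) := by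
            rw [← ENNReal.ofReal_mul (by positivity), ← ENNReal.ofReal_mul (by positivity), hMm]
            ring_nf
        _ ≤ _ := by
            gcongr
            rw [hD]
            have : 0 < C₀ * (2 + μ) * C₂ * 4 ^ q := by positivity
            linarith
    have h6 : S z ≤ ENNReal.ofReal (D * M ^ (-(1 + m)))
        * (ENNReal.ofReal ((z.1 + 2 - ‖z.2‖) ^ (-(1 - 1 / p)))
          + ENNReal.ofReal (M ^ (1 / p) * (1 + ‖z.2‖)⁻¹)) := by
      rw [mul_add, add_comm]
      exact add_le_add h1 h5
    have e1 : ((z.1 + 2 - ‖z.2‖) ^ (-(1 - 1 / p))) ^ p' = (z.1 + 2 - ‖z.2‖)⁻¹ := by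
      rw [← Real.rpow_mul hd.le, ← hinv, neg_mul, one_div_mul_cancel hp'0.ne', Real.rpow_neg_one]
    have e2 : (M ^ (1 / p) * (1 + ‖z.2‖)⁻¹) ^ p'
        = M ^ (1 / (p - 1)) * (1 + ‖z.2‖) ^ (-p') := by
      rw [Real.mul_rpow (by positivity) (by positivity), ← Real.rpow_mul hM0.le, hdiv,
        Real.inv_rpow (by positivity), Real.rpow_neg (by positivity)]
    calc S z ^ p' ≤ _ := ENNReal.rpow_le_rpow h6 hp'0.le
      _ = ENNReal.ofReal ((D * M ^ (-(1 + m))) ^ p')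
          * (ENNReal.ofReal ((z.1 + 2 - ‖z.2‖) ^ (-(1 - 1 / p)))
            + ENNReal.ofReal (M ^ (1 / p) * (1 + ‖z.2‖)⁻¹)) ^ p' := by
          rw [ENNReal.mul_rpow_of_nonneg _ _ hp'0.le,
            ENNReal.ofReal_rpow_of_nonneg (by positivity) hp'0.le]
      _ ≤ _ := by
          refine mul_le_mul_right ((ENNReal.rpow_add_le_mul_rpow_add_rpow _ _ hp'1.le).trans
            (le_of_eq ?_)) _
          rw [ENNReal.ofReal_rpow_of_nonneg (by positivity) hp'0.le,
            ENNReal.ofReal_rpow_of_nonneg (by positivity) hp'0.le, e1, e2,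
            ← ENNReal.ofReal_rpow_of_pos two_pos, ENNReal.ofReal_ofNat]
  have hSint : ∫⁻ z in coneSlab n M, S z ^ p' ∂ν
      ≤ ENNReal.ofReal ((D * M ^ (-(1 + m))) ^ p'
        * (2 ^ (p' - 1) * ((C₃ + C₄) * (M ^ n * Real.log M)))) := by
    calc ∫⁻ z in coneSlab n M, S z ^ p' ∂ν
        ≤ _ := setLIntegral_mono' (measurableSet_coneSlab M) hSle
      _ ≤ _ := by
          rw [lintegral_const_mul' _ _ ENNReal.ofReal_ne_top,
            lintegral_const_mul' _ _ ENNReal.ofReal_ne_top, lintegral_add_left (by fun_prop),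
            ENNReal.ofReal_mul (by positivity), ENNReal.ofReal_mul (by positivity), add_mul,
            ENNReal.ofReal_add (by positivity) (by positivity)]
          gcongr
          · exact hdist M M₁ hM
          · exact hnorm M M₁ hM
  have h8 := hslab (M₁ := M₁) (by linarith) hw hSm hη hcone (by positivity) hSint
  calc cutoffMass n μ β p η w M₁ M ^ p
      ≤ (ENNReal.ofReal _ * cutoffMass n μ β p θ w M₁ M ^ (1 / p)) ^ p :=
        ENNReal.rpow_le_rpow (hmass.trans h8) hp0.le
    _ = _ := by
        rw [ENNReal.mul_rpow_of_nonneg _ _ hp0.le, ← ENNReal.rpow_mul,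
          one_div_mul_cancel hp0.ne', ENNReal.rpow_one,
          ENNReal.ofReal_rpow_of_nonneg (by positivity) hp0.le]
        congr 2
        have e : M ^ (q / p) * (M ^ (-(1 + m)) * M ^ ((n : ℝ) * (1 - 1 / p))) = 1 := by
          rw [← Real.rpow_add hM0, ← Real.rpow_add hM0, hscale, Real.rpow_zero]
        have e2 : (Real.log M ^ (1 - 1 / p)) ^ p = Real.log M ^ (p - 1) := by
          rw [← Real.rpow_mul hlog.le]
          congr 1
          field_simp
        rw [← e2, ← Real.mul_rpow (by positivity) (by positivity)]
        congr 1
        rw [← mul_assoc (2 ^ (p' - 1)), Real.mul_rpow (by positivity) (by positivity),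
          ← Real.rpow_mul (by positivity), mul_one_div_cancel hp'0.ne', Real.rpow_one,
          Real.mul_rpow (by positivity) (by positivity),
          Real.mul_rpow (by positivity) hlog.le, ← Real.rpow_natCast,
          ← Real.rpow_mul hM0.le, hinv]
        linear_combination c * D * (2 ^ (p' - 1) * (C₃ + C₄)) ^ (1 - 1 / p)
          * Real.log M ^ (1 - 1 / p) * e

end

/-! ### The mass as a function of the logarithmic scale -/

section

variable {n : ℕ} {μ β p : ℝ}

/-- A differential inequality with logarithmic scaling: if `Y(s) = ∫_{s₀}^s y` satisfies
`Y^p ≤ B s^{p-1} Y'` on `[s₀, S]` and `y ≥ κ`, then `S` cannot be large. On `[S/2, S]` the function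
`Y^{1-p}` decreases at the rate `(p - 1) / (B S^{p-1})` at least, and at `S / 2` it is at most
`(κ S / 4)^{1-p}`. -/
theorem le_of_integral_rpow_le (hp : 1 < p) {B κ s₀ S : ℝ} (hB : 0 < B) (hκ : 0 < κ)
    (hs₀ : 0 < s₀) {y : ℝ → ℝ} (hy : Continuous y) (hκy : ∀ s ∈ Icc s₀ S, κ ≤ y s)
    (hY : ∀ s ∈ Icc s₀ S, (∫ r in s₀..s, y r) ^ p ≤ B * s ^ (p - 1) * y s) :
    S ≤ max (4 * s₀) (2 * B / (p - 1) * (κ / 4) ^ (1 - p)) := by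
  rcases le_or_gt S (4 * s₀) with h | hS
  · exact h.trans (le_max_left _ _)
  refine le_trans ?_ (le_max_right _ _)
  have hS0 : 0 < S := by linarith
  set Y : ℝ → ℝ := fun s => ∫ r in s₀..s, y r with hYdef
  have hYd : ∀ s, HasDerivAt Y (y s) s := fun s =>
    intervalIntegral.integral_hasDerivAt_right (hy.intervalIntegrable _ _)
      (hy.stronglyMeasurableAtFilter _ _) hy.continuousAt
  have hlow : ∀ s ∈ Icc (S / 2) S, κ * S / 4 ≤ Y s := by
    rintro s ⟨hs1, hs2⟩
    have h1 : ∫ _ in s₀..s, κ ≤ Y s :=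
      intervalIntegral.integral_mono_on (by linarith) (by simp) (hy.intervalIntegrable _ _)
        fun r hr => hκy r ⟨hr.1, hr.2.trans hs2⟩
    rw [intervalIntegral.integral_const, smul_eq_mul] at h1
    nlinarith
  have hpos : ∀ s ∈ Icc (S / 2) S, 0 < Y s := fun s hs =>
    lt_of_lt_of_le (by positivity) (hlow s hs)
  set b := (p - 1) / (B * S ^ (p - 1)) with hb
  have hd : ∀ s ∈ Icc (S / 2) S,
      HasDerivAt (fun s => Y s ^ (1 - p) + b * s) (y s * (1 - p) * Y s ^ (1 - p - 1) + b) s := by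
    intro s hs
    have h1 := (hYd s).rpow_const (p := 1 - p) (Or.inl (hpos s hs).ne')
    have h2 := h1.fun_add ((hasDerivAt_id' s).const_mul b)
    rwa [mul_one] at h2
  have hanti : AntitoneOn (fun s => Y s ^ (1 - p) + b * s) (Icc (S / 2) S) := by
    refine antitoneOn_of_deriv_nonpos (convex_Icc _ _)
      (fun s hs => (hd s hs).continuousAt.continuousWithinAt)
      (fun s hs => (hd s (interior_subset hs)).differentiableAt.differentiableWithinAt) ?_
    intro s hs
    have hs' := interior_subset hs
    have hs0 : 0 < s := by have := hs'.1; linarith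
    rw [(hd s hs').deriv]
    have hYs := hpos s hs'
    have h1 := hY s ⟨by have := hs'.1; linarith, hs'.2⟩
    have hys : 0 < y s := hκ.trans_le (hκy s ⟨by have := hs'.1; linarith, hs'.2⟩)
    have h2 : Y s ^ p ≤ B * S ^ (p - 1) * y s := by
      refine h1.trans ?_
      have := hs'.2
      gcongr
    have e : Y s ^ (1 - p - 1) = (Y s ^ p)⁻¹ := by
      rw [← Real.rpow_neg hYs.le]
      ring_nf
    have h3 : (B * S ^ (p - 1))⁻¹ ≤ y s * (Y s ^ p)⁻¹ := by
      rw [← div_eq_mul_inv, le_div_iff₀ (by positivity), inv_mul_le_iff₀ (by positivity)]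
      exact h2
    rw [e, hb, div_eq_mul_inv]
    have h4 : (p - 1) * (B * S ^ (p - 1))⁻¹ ≤ (p - 1) * (y s * (Y s ^ p)⁻¹) :=
      mul_le_mul_of_nonneg_left h3 (by linarith)
    linarith
  have h5 := hanti (left_mem_Icc.2 (by linarith)) (right_mem_Icc.2 (by linarith))
    (by linarith : S / 2 ≤ S)
  have h6 : Y (S / 2) ^ (1 - p) ≤ (κ * S / 4) ^ (1 - p) :=
    Real.rpow_le_rpow_of_nonpos (by positivity) (hlow _ (left_mem_Icc.2 (by linarith)))
      (by linarith)
  have h7 : 0 ≤ Y S ^ (1 - p) := Real.rpow_nonneg (hpos S (right_mem_Icc.2 (by linarith))).le _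
  have h8 : b * (S / 2) ≤ (κ / 4) ^ (1 - p) * S ^ (1 - p) := by
    rw [← Real.mul_rpow (by positivity) hS0.le, show κ / 4 * S = κ * S / 4 by ring]
    dsimp only at h5
    linarith
  have e : S ^ (1 - p) = (S ^ (p - 1))⁻¹ := by
    rw [← Real.rpow_neg hS0.le]
    ring_nf
  have hp1 : 0 < p - 1 := by linarith
  have hSp : 0 < S ^ (p - 1) := Real.rpow_pos_of_pos hS0 _
  rw [e, hb, ← div_eq_mul_inv, le_div_iff₀ hSp] at h8
  calc S = 2 * B / (p - 1) * ((p - 1) / (B * S ^ (p - 1)) * (S / 2) * S ^ (p - 1)) := by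
        field_simp
    _ ≤ _ := by gcongr

/-- Averaging the shells `t ∼ e^r` over `r ≤ s` gives at most the mass up to time `e^s`, since
each point lies in the shells of a set of `r` of length `log 4`. -/
theorem lintegral_cutoffMass_exp_le {C : ℝ} {η θ : ℝ → ℝ} (hη : IsCutoffPair p C η θ)
    {w : ℝ × Space n → ℝ} (hw : Measurable w) (M₁ s₀ s : ℝ) :
    ∫⁻ r in Ioc s₀ s, cutoffMass n μ β p θ w M₁ (Real.exp r)
      ≤ ENNReal.ofReal (Real.log 4) * cutoffMass n μ β p η w M₁ (Real.exp s) := by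
  set ν := (volume.restrict (Ioc 0 M₁)).prod (volume : Measure (Space n)) with hν
  have hΦ := measurable_waveSuperposition (n := n) (μ := μ) (β := β) (((n : ℝ) - 1) / 2 - 1 / p)
  have hpos : ∀ᵐ z ∂ν, 0 < z.1 := by
    have h1 : ∀ᵐ t ∂(volume.restrict (Ioc 0 M₁)), 0 < t :=
      (ae_restrict_iff' measurableSet_Ioc).2 (Eventually.of_forall fun t ht => ht.1)
    exact Measure.quasiMeasurePreserving_fst.ae h1
  have hθm : Measurable fun y : ℝ × (ℝ × Space n) => θ (y.2.1 / Real.exp y.1) :=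
    hη.continuous.measurable.comp (by fun_prop)
  have hm : Measurable fun y : ℝ × (ℝ × Space n) =>
      ENNReal.ofReal (|w y.2| ^ p * θ (y.2.1 / Real.exp y.1))
        * waveSuperposition n μ β (((n : ℝ) - 1) / 2 - 1 / p) y.2 :=
    ((((hw.comp measurable_snd).abs.pow_const _).mul hθm).ennreal_ofReal).mul
      (hΦ.comp measurable_snd)
  unfold cutoffMass
  rw [lintegral_lintegral_swap hm.aemeasurable, ← lintegral_const_mul' _ _ ENNReal.ofReal_ne_top]
  refine lintegral_mono_ae (hpos.mono fun z hz => ?_)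
  have hshell : ∀ r ∈ Ioc s₀ s, ENNReal.ofReal (|w z| ^ p * θ (z.1 / Real.exp r))
      ≤ (Icc (Real.log z.1) (Real.log (4 * z.1))).indicator
        (fun _ => ENNReal.ofReal (|w z| ^ p * η (z.1 / Real.exp s))) r := by
    intro r hr
    by_cases h : r ∈ Icc (Real.log z.1) (Real.log (4 * z.1))
    · rw [indicator_of_mem h]
      refine ENNReal.ofReal_le_ofReal (mul_le_mul_of_nonneg_left ((hη.le _).trans
        (hη.antitone ?_)) (Real.rpow_nonneg (abs_nonneg _) _))
      have := hr.2
      gcongr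
    · rw [indicator_of_notMem h]
      have h0 : θ (z.1 / Real.exp r) = 0 := by
        rw [mem_Icc, not_and_or, not_le, not_le, Real.lt_log_iff_exp_lt hz,
          Real.log_lt_iff_lt_exp (by positivity)] at h
        have he := Real.exp_pos r
        rcases h with h | h
        · refine le_antisymm ((hη.le _).trans (hη.eq_zero _ ?_).le) (hη.nonneg _)
          rw [le_div_iff₀ he]
          linarith
        · refine hη.weight_eq_zero _ ?_
          rw [div_le_iff₀ he]
          linarith
      rw [h0, mul_zero, ENNReal.ofReal_zero]
  have hvol : volume (Icc (Real.log z.1) (Real.log (4 * z.1))) = ENNReal.ofReal (Real.log 4) := by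
    rw [Real.volume_Icc, Real.log_mul (by norm_num) hz.ne']
    ring_nf
  have hθz : Measurable fun r : ℝ => ENNReal.ofReal (|w z| ^ p * θ (z.1 / Real.exp r)) :=
    ((hη.continuous.measurable.comp (by fun_prop)).const_mul _).ennreal_ofReal
  rw [lintegral_mul_const _ hθz, ← mul_assoc]
  refine mul_le_mul_left ?_ _
  calc ∫⁻ r in Ioc s₀ s, ENNReal.ofReal (|w z| ^ p * θ (z.1 / Real.exp r))
      ≤ _ := setLIntegral_mono' measurableSet_Ioc hshell
    _ ≤ _ := setLIntegral_le_lintegral _ _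
    _ = _ := by rw [lintegral_indicator measurableSet_Icc, setLIntegral_const, hvol, mul_comm]

/-- The weighted mass of `|w|^p` in the cone is finite, since the superposition is bounded there. -/
theorem lintegral_mul_waveSuperposition_lt_top (hn : 2 ≤ n) (hμ : 0 < μ) (hβ : 2 < β) (hp : 0 < p)
    {s : ℝ} (hs : 0 < s) {w : ℝ × Space n → ℝ} {M₁ : ℝ}
    (hcone : ∀ᵐ z ∂((volume.restrict (Ioc 0 M₁)).prod (volume : Measure (Space n))),
      z.1 ∈ Ioc 0 M₁ ∧ (z.1 + 1 < ‖z.2‖ → w z = 0))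
    (hint : Integrable (fun z => |w z| ^ p * (Metric.closedBall 0 (M₁ + 1)).indicator 1 z.2)
      ((volume.restrict (Ioc 0 M₁)).prod (volume : Measure (Space n)))) :
    ∫⁻ z, ENNReal.ofReal (|w z| ^ p) * waveSuperposition n μ β s z
      ∂((volume.restrict (Ioc 0 M₁)).prod (volume : Measure (Space n))) < ⊤ := by
  obtain ⟨C, hC, hconj⟩ := exists_conjugateWave_le (n := n) hn hμ hβ
  have hn' : (2 : ℝ) ≤ n := by exact_mod_cast hn
  have hΦ : ∀ z : ℝ × Space n, 0 < z.1 → ‖z.2‖ ≤ z.1 + 1 →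
      waveSuperposition n μ β s z ≤ ENNReal.ofReal (C * (1 ^ s / s)) := by
    intro z hz0 hz
    calc waveSuperposition n μ β s z
        ≤ ∫⁻ l in Ioc (0 : ℝ) 1, ENNReal.ofReal C * ENNReal.ofReal (l ^ (s - 1)) := by
          refine setLIntegral_mono' measurableSet_Ioc fun l hl => ?_
          rw [← ENNReal.ofReal_mul hC.le, mul_comm C]
          have hl0 := hl.1
          refine ENNReal.ofReal_le_ofReal (mul_le_mul_of_nonneg_left
            ((hconj l z hl0 hl.2 hz0.le hz).trans ?_) (Real.rpow_nonneg hl0.le _))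
          have h1 : (1 + l * z.1) ^ (-(((n : ℝ) - 1) / 2)) ≤ 1 :=
            Real.rpow_le_one_of_one_le_of_nonpos (by nlinarith) (by linarith)
          have h2 : Real.exp (-(l * (z.1 + 2 - ‖z.2‖) / 2)) ≤ 1 := by
            apply Real.exp_le_one_iff.2
            have : 0 ≤ l * (z.1 + 2 - ‖z.2‖) := mul_nonneg hl0.le (by linarith)
            linarith
          exact mul_le_of_le_one_right hC.le (mul_le_one₀ h1 (Real.exp_pos _).le h2)
      _ = _ := by
          rw [lintegral_const_mul' _ _ ENNReal.ofReal_ne_top, lintegral_rpow_Ioc hs zero_le_one,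
            ← ENNReal.ofReal_mul hC.le]
  refine lt_of_le_of_lt (lintegral_mono_ae (g := fun z => ENNReal.ofReal (C * (1 ^ s / s))
    * ‖|w z| ^ p * (Metric.closedBall (0 : Space n) (M₁ + 1)).indicator 1 z.2‖ₑ)
    (hcone.mono fun z hz => ?_)) ?_
  · by_cases hx : z.1 + 1 < ‖z.2‖
    · rw [hz.2 hx, abs_zero, Real.zero_rpow hp.ne', ENNReal.ofReal_zero, zero_mul]
      exact zero_le
    · push Not at hx
      have hmem : z.2 ∈ Metric.closedBall (0 : Space n) (M₁ + 1) := by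
        rw [mem_closedBall_zero_iff]
        linarith [hz.1.2]
      rw [indicator_of_mem hmem, Pi.one_apply, mul_one,
        Real.enorm_of_nonneg (Real.rpow_nonneg (abs_nonneg _) _), mul_comm]
      gcongr
      exact hΦ z hz.1.1 hx
  · rw [lintegral_const_mul' _ _ ENNReal.ofReal_ne_top]
    exact ENNReal.mul_lt_top ENNReal.ofReal_lt_top hint.hasFiniteIntegral

/-- A mass that is finite without cutoff depends continuously on the logarithm of the scale. -/
theorem continuous_cutoffMass_exp {C : ℝ} {η θ : ℝ → ℝ} (hη : IsCutoffPair p C η θ)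
    {w : ℝ × Space n → ℝ} (hw : Measurable w) {M₁ : ℝ}
    (hfin : ∫⁻ z, ENNReal.ofReal (|w z| ^ p)
      * waveSuperposition n μ β (((n : ℝ) - 1) / 2 - 1 / p) z
      ∂((volume.restrict (Ioc 0 M₁)).prod (volume : Measure (Space n))) < ⊤) :
    Continuous fun r => (cutoffMass n μ β p θ w M₁ (Real.exp r)).toReal := by
  set ν := (volume.restrict (Ioc 0 M₁)).prod (volume : Measure (Space n)) with hν
  have hΦ := measurable_waveSuperposition (n := n) (μ := μ) (β := β) (((n : ℝ) - 1) / 2 - 1 / p)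
  set G : ℝ × Space n → ℝ := fun z => (ENNReal.ofReal (|w z| ^ p)
      * waveSuperposition n μ β (((n : ℝ) - 1) / 2 - 1 / p) z).toReal with hG
  have hGm : Measurable fun z => ENNReal.ofReal (|w z| ^ p)
      * waveSuperposition n μ β (((n : ℝ) - 1) / 2 - 1 / p) z :=
    (hw.abs.pow_const _).ennreal_ofReal.mul hΦ
  have hGint : Integrable G ν := integrable_toReal_of_lintegral_ne_top hGm.aemeasurable hfin.ne
  have hθ1 : ∀ s, θ s ≤ 1 := fun s => (hη.le s).trans (hη.le_one s)
  have hθm : ∀ r : ℝ, Measurable fun z : ℝ × Space n => θ (z.1 / Real.exp r) := fun r =>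
    hη.continuous.measurable.comp (by fun_prop)
  have e : ∀ r, (cutoffMass n μ β p θ w M₁ (Real.exp r)).toReal
      = ∫ z, G z * θ (z.1 / Real.exp r) ∂ν := by
    intro r
    have h1 : cutoffMass n μ β p θ w M₁ (Real.exp r) = ∫⁻ z, ENNReal.ofReal (|w z| ^ p)
        * waveSuperposition n μ β (((n : ℝ) - 1) / 2 - 1 / p) z
        * ENNReal.ofReal (θ (z.1 / Real.exp r)) ∂ν := by
      refine lintegral_congr fun z => ?_
      rw [ENNReal.ofReal_mul (Real.rpow_nonneg (abs_nonneg _) _), mul_right_comm]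
    have hm : Measurable fun z => ENNReal.ofReal (|w z| ^ p)
        * waveSuperposition n μ β (((n : ℝ) - 1) / 2 - 1 / p) z
        * ENNReal.ofReal (θ (z.1 / Real.exp r)) := hGm.mul (hθm r).ennreal_ofReal
    have h2 : ∀ᵐ z ∂ν, ENNReal.ofReal (|w z| ^ p)
        * waveSuperposition n μ β (((n : ℝ) - 1) / 2 - 1 / p) z
        * ENNReal.ofReal (θ (z.1 / Real.exp r)) < ⊤ :=
      (ae_lt_top hGm hfin.ne).mono fun z hz => ENNReal.mul_lt_top hz ENNReal.ofReal_lt_top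
    rw [h1, ← integral_toReal hm.aemeasurable h2]
    refine integral_congr_ae (Eventually.of_forall fun z => ?_)
    dsimp only
    rw [ENNReal.toReal_mul, ENNReal.toReal_ofReal (hη.nonneg _)]
  simp_rw [e]
  refine continuous_of_dominated (bound := G)
    (fun r => (hGint.aestronglyMeasurable.mul (hθm r).aestronglyMeasurable))
    (fun r => Eventually.of_forall fun z => ?_) hGint (Eventually.of_forall fun z => ?_)
  · have h0 : 0 ≤ G z := ENNReal.toReal_nonneg
    rw [Real.norm_of_nonneg (mul_nonneg h0 (hη.nonneg _))]
    exact mul_le_of_le_one_right h0 (hθ1 _)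
  · exact continuous_const.mul (hη.continuous.comp
      (continuous_const.div Real.continuous_exp fun r => (Real.exp_pos r).ne'))

end

/-! ### The lifespan bound -/

section

variable {n : ℕ} {μ β p : ℝ}

theorem integral_pos_of_supportedInBall {g : L2 n} {R : ℝ} (hg0 : 0 ≤ g) (hg : g ≠ 0)
    (hgR : SupportedInBall R g) : 0 < ∫ x, g x := by
  have hnn : 0 ≤ᵐ[volume] (g : Space n → ℝ) := (Lp.coeFn_nonneg g).2 hg0
  have hint : Integrable (g : Space n → ℝ) := by
    have hcpt := isCompact_closedBall (0 : Space n) R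
    have h1 : IntegrableOn (g : Space n → ℝ) (Metric.closedBall 0 R) :=
      ((Lp.memLp g).locallyIntegrable (by norm_num)).integrableOn_isCompact hcpt
    refine (integrableOn_iff_integrable_of_support_subset (s := Metric.closedBall 0 R)
      (f := (Metric.closedBall 0 R).indicator g) support_indicator_subset).1
        (h1.congr_fun (fun x hx => (indicator_of_mem hx _).symm)
          Metric.isClosed_closedBall.measurableSet) |>.congr ?_
    filter_upwards [hgR] with x hx
    by_cases h : x ∈ Metric.closedBall (0 : Space n) R
    · exact indicator_of_mem h _
    · rw [indicator_of_notMem h, hx]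
      rw [mem_closedBall_zero_iff] at h
      exact not_le.1 h
  refine (integral_nonneg_of_ae hnn).lt_of_ne fun h => hg ?_
  rw [Lp.eq_zero_iff_ae_eq_zero]
  exact (integral_eq_zero_iff_of_nonneg_ae hnn hint).1 h.symm

/-- The lifespan bound on a closed time interval `[0, M₁]` inside the interval of existence. -/
theorem exists_lifespan_le (hn : 2 ≤ n) (hμ : 0 < μ) (hβ : 2 < β) (hp : p = straussExponent n)
    {f : H1 n} {g : L2 n} (hf0 : 0 ≤ f.toL2) (hg0 : 0 ≤ g) (hg : g ≠ 0)
    (hg1 : SupportedInBall 1 g) :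
    ∃ C : ℝ, 0 < C ∧ ∀ ε : ℝ, 0 < ε → ε ≤ 1 → ∀ (T : ℝ) (u : ℝ → H1 n),
      IsEnergySolution μ β p ε f g T u →
      (∀ t ∈ Set.Ico 0 T, SupportedInBall (t + 1) (u t).toL2) →
      ∀ M₁ : ℝ, 4 < M₁ → M₁ < T → Real.log M₁ ≤ C * ε ^ (-(p * (p - 1))) := by
  have hp1 : 1 < p := hp ▸ one_lt_straussExponent hn
  have hp0 : 0 < p := by linarith
  have hq : 0 < ((n : ℝ) - 1) / 2 - 1 / p := by
    have := inv_straussExponent_lt hn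
    rw [← hp] at this
    linarith
  have hI := integral_pos_of_supportedInBall hg0 hg hg1
  set I := ∫ x, g x with hIdef
  obtain ⟨C₀, hC₀, η, θ, hη⟩ := exists_isCutoffPair hp1
  obtain ⟨C₁, hC₁, hone⟩ := exists_le_cutoffMass (n := n) hn hμ hβ hp hC₀
  obtain ⟨C₂, hC₂, hall⟩ := exists_cutoffMass_rpow_le (n := n) hn hμ hβ hp hC₀
  have hlog4 : 0 < Real.log 4 := Real.log_pos (by norm_num)
  set B := Real.log 4 ^ p * C₂ with hB
  have hB0 : 0 < B := by positivity
  set C := 4 * Real.log 4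
    + 2 * B / (p - 1) * ((I / C₁) ^ p / 4) ^ (1 - p) with hC
  have hp10 : 0 < p - 1 := by linarith
  refine ⟨C, by positivity, ?_⟩
  intro ε hε hε1 T u hs hsupp M₁ hM₁ hMT
  have hM₁0 : 0 < M₁ := by linarith
  obtain ⟨w, hw, hwu⟩ := exists_measurable_representative (M := M₁)
    (hs.continuousOn_toL2.mono fun t ht => ⟨ht.1, ht.2.trans_lt hMT⟩)
  set ν := (volume.restrict (Ioc 0 M₁)).prod (volume : Measure (Space n)) with hν
  have hcone := ae_support_prod hMT hsupp hw hwu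
  have hint := integrable_nonlinear hs hp0.le hM₁0 hMT hw hwu (M₁ + 1)
  have hfin := lintegral_mul_waveSuperposition_lt_top hn hμ hβ hp0 hq hcone hint
  have hcut := fun {M : ℝ} (hM : 0 < M) (hMM : M ≤ M₁) {l : ℝ} (hl : 0 < l) (hl1 : l ≤ 1) =>
    hs.cutoff_inequality hn hp0 hμ hβ hε hf0 hg0 hg1 hsupp hM hMM hMT hw hwu hη hl hl1
  have hΦ := measurable_waveSuperposition (n := n) (μ := μ) (β := β) (((n : ℝ) - 1) / 2 - 1 / p)
  have hle : ∀ {χ : ℝ → ℝ}, (∀ s, χ s ≤ 1) → ∀ M, cutoffMass n μ β p χ w M₁ M < ⊤ := by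
    intro χ hχ M
    refine lt_of_le_of_lt (lintegral_mono fun z => ?_) hfin
    gcongr
    exact mul_le_of_le_one_right (Real.rpow_nonneg (abs_nonneg _) _) (hχ _)
  have hθfin := hle fun s => (hη.le s).trans (hη.le_one s)
  have hηfin := hle hη.le_one
  have hscale : ∀ s ∈ Icc (Real.log 4) (Real.log M₁), 4 ≤ Real.exp s ∧ Real.exp s ≤ M₁ :=
    fun s hs => ⟨(Real.log_le_iff_le_exp (by norm_num)).1 hs.1,
      (Real.le_log_iff_exp_le hM₁0).1 hs.2⟩
  set y : ℝ → ℝ := fun r => (cutoffMass n μ β p θ w M₁ (Real.exp r)).toReal with hy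
  have hyc : Continuous y := continuous_cutoffMass_exp hη hw hfin
  -- the hypotheses of `le_of_integral_rpow_le`, on `[log 4, log M₁]`
  have hκ : ∀ s ∈ Icc (Real.log 4) (Real.log M₁), (ε * I / C₁) ^ p ≤ y s := by
    intro s hs
    obtain ⟨h4, hM⟩ := hscale s hs
    have h1 := hone h4 hw hη hcone (I := ENNReal.ofReal (ε * I)) (le_self_add.trans
      (hcut (Real.exp_pos s) hM one_pos le_rfl))
    have h2 := ENNReal.toReal_mono
      (ENNReal.mul_ne_top ENNReal.ofReal_ne_top
        (ENNReal.rpow_ne_top_of_nonneg (by positivity) (hθfin (Real.exp s)).ne)) h1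
    rw [ENNReal.toReal_mul, ENNReal.toReal_ofReal (by positivity), ENNReal.toReal_ofReal hC₁.le,
      ← ENNReal.toReal_rpow] at h2
    have h3 : ε * I / C₁ ≤ y s ^ (1 / p) := by
      rw [div_le_iff₀' hC₁]
      exact h2
    calc (ε * I / C₁) ^ p ≤ (y s ^ (1 / p)) ^ p := by gcongr
      _ = y s := by
          rw [← Real.rpow_mul ENNReal.toReal_nonneg, one_div_mul_cancel hp0.ne', Real.rpow_one]
  have hY : ∀ s ∈ Icc (Real.log 4) (Real.log M₁),
      (∫ r in Real.log 4..s, y r) ^ p ≤ B * s ^ (p - 1) * y s := by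
    intro s hs
    obtain ⟨h4, hM⟩ := hscale s hs
    have hs0 : 0 < s := hlog4.trans_le hs.1
    have h1 := hall h4 hw hη hcone fun l hl hl1 =>
      le_add_self.trans (hcut (Real.exp_pos s) hM hl hl1)
    rw [Real.log_exp] at h1
    have h2 : (cutoffMass n μ β p η w M₁ (Real.exp s)).toReal ^ p ≤ C₂ * s ^ (p - 1) * y s := by
      have h3 := ENNReal.toReal_mono
        (ENNReal.mul_ne_top ENNReal.ofReal_ne_top (hθfin (Real.exp s)).ne) h1
      rwa [ENNReal.toReal_mul, ENNReal.toReal_ofReal (by positivity), ← ENNReal.toReal_rpow] at h3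
    have h4 : ∫ r in Real.log 4..s, y r
        ≤ Real.log 4 * (cutoffMass n μ β p η w M₁ (Real.exp s)).toReal := by
      have h5 := ENNReal.toReal_mono (ENNReal.mul_ne_top ENNReal.ofReal_ne_top
        (hηfin (Real.exp s)).ne)
        (lintegral_cutoffMass_exp_le (n := n) (μ := μ) (β := β) hη hw M₁ (Real.log 4) s)
      rw [ENNReal.toReal_mul, ENNReal.toReal_ofReal hlog4.le] at h5
      rw [intervalIntegral.integral_of_le hs.1,
        integral_eq_lintegral_of_nonneg_ae (Eventually.of_forall fun r => ENNReal.toReal_nonneg)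
          hyc.aestronglyMeasurable]
      simp only [ENNReal.ofReal_toReal (hθfin _).ne]
      exact h5
    have h6 : 0 ≤ ∫ r in Real.log 4..s, y r :=
      intervalIntegral.integral_nonneg hs.1 fun r _ => ENNReal.toReal_nonneg
    calc (∫ r in Real.log 4..s, y r) ^ p
        ≤ (Real.log 4 * (cutoffMass n μ β p η w M₁ (Real.exp s)).toReal) ^ p := by gcongr
      _ = Real.log 4 ^ p * (cutoffMass n μ β p η w M₁ (Real.exp s)).toReal ^ p :=
          Real.mul_rpow hlog4.le ENNReal.toReal_nonneg
      _ ≤ Real.log 4 ^ p * (C₂ * s ^ (p - 1) * y s) := by gcongr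
      _ = _ := by rw [hB]; ring
  have hmain := le_of_integral_rpow_le hp1 hB0 (κ := (ε * I / C₁) ^ p) (by positivity) hlog4 hyc
    hκ hY
  have hεpow : 1 ≤ ε ^ (-(p * (p - 1))) :=
    Real.one_le_rpow_of_pos_of_le_one_of_nonpos hε hε1 (by
      have : 0 < p * (p - 1) := by positivity
      linarith)
  -- `κ ∼ ε^p`, so `κ^{1-p} ∼ ε^{-p(p-1)}`
  have hκε : ((ε * I / C₁) ^ p / 4) ^ (1 - p)
      = ε ^ (-(p * (p - 1))) * ((I / C₁) ^ p / 4) ^ (1 - p) := by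
    rw [mul_div_assoc, Real.mul_rpow hε.le (by positivity), mul_div_assoc,
      Real.mul_rpow (by positivity) (by positivity), ← Real.rpow_mul hε.le]
    ring_nf
  rw [hκε] at hmain
  have hD : 0 < 2 * B / (p - 1) * ((I / C₁) ^ p / 4) ^ (1 - p) := by positivity
  refine hmain.trans (max_le ?_ ?_)
  · calc 4 * Real.log 4 ≤ C * 1 := by rw [hC]; linarith
      _ ≤ _ := by gcongr
  · calc 2 * B / (p - 1) * (ε ^ (-(p * (p - 1))) * ((I / C₁) ^ p / 4) ^ (1 - p))
        = (2 * B / (p - 1) * ((I / C₁) ^ p / 4) ^ (1 - p)) * ε ^ (-(p * (p - 1))) := by ring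
      _ ≤ _ := by
          gcongr
          rw [hC]
          linarith

end

end DampedWave

end

theorem theorem2p2 (n : ℕ) (hn : 2 ≤ n) (μ β p : ℝ) (hμ : 0 < μ) (hβ : 2 < β)
    (hp : p = DampedWave.straussExponent n)
    (f : DampedWave.H1 n) (g : DampedWave.L2 n)
    (hf_nonneg : 0 ≤ f.toL2) (hg_nonneg : 0 ≤ g)
    (hf_ne : f.toL2 ≠ 0) (hg_ne : g ≠ 0)
    (hf_supp : DampedWave.SupportedInBall 1 f.toL2)
    (hg_supp : DampedWave.SupportedInBall 1 g) :
    ∃ ε₀ : ℝ, 0 < ε₀ ∧ ∃ C : ℝ, 0 < C ∧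
      ∀ ε : ℝ, 0 < ε → ε ≤ ε₀ →
        ∀ (T : ℝ) (u : ℝ → DampedWave.H1 n), 0 < T →
          DampedWave.IsEnergySolution μ β p ε f g T u →
          (∀ t ∈ Set.Ico 0 T, DampedWave.SupportedInBall (t + 1) (u t).toL2) →
          T ≤ Real.exp (C * ε ^ (-(p * (p - 1)))) := by
  obtain ⟨C, hC, h⟩ := DampedWave.exists_lifespan_le hn hμ hβ hp hf_nonneg hg_nonneg hg_ne hg_supp
  have hlog4 : 0 < Real.log 4 := Real.log_pos (by norm_num)
  -- any bounded range of `ε` will do, as `ε^{-p(p-1)} ≥ 1` then; the summand `log 4` covers `T ≤ 4`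
  refine ⟨1, one_pos, C + Real.log 4, by positivity, ?_⟩
  intro ε hε hε1 T u hT hs hsupp
  have hp1 : 1 < p := hp ▸ DampedWave.one_lt_straussExponent hn
  have hεpow : 1 ≤ ε ^ (-(p * (p - 1))) :=
    Real.one_le_rpow_of_pos_of_le_one_of_nonpos hε hε1 (by nlinarith)
  -- the bound on each `[0, M₁]`, `M₁ < T`, passes to the limit `M₁ → T`
  refine le_of_forall_lt fun M hM => ?_
  obtain ⟨M₁, hMM, hMT⟩ := exists_between hM
  refine hMM.trans_le ?_
  rcases le_or_gt M₁ 4 with h4 | h4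
  · refine h4.trans ((Real.log_le_iff_le_exp (by norm_num)).1 ?_)
    nlinarith
  · refine (Real.log_le_iff_le_exp (by linarith)).1 ((h ε hε hε1 T u hs hsupp M₁ h4 hMT).trans ?_)
    nlinarith
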